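/- Let $(\mathcal C,\otimes,K,c)$ be a symmetric monoidal category with split idempotents (we write as if it were strict). Let $H$ be a weak Hopf algebra in $\mathcal C$, with unit $\eta$, counit $\epsilon$ and antipode, let $\Pi^L=(\epsilon\mu\otimes H)(H\otimes c)(\Delta\eta\otimes H)$ and $\Pi^R=(H\otimes\epsilon\mu)(c\otimes H)(H\otimes\Delta\eta)$, and let $A$ be a unitary algebra in $\mathcal C$. Let $\rho\colon H\otimes A\to A$ be a weak left action, i.e. $\rho(\eta\otimes A)=\mathrm{id}_A$; $\rho(H\otimes\mu_A)=\mu_A(\rho\otimes\rho)(H\otimes c\otimes A)(\Delta\otimes A\otimes A)$; $\rho(\mu\otimes\eta_A)=\rho(H\otimes\rho)(H\otimes H\otimes\eta_A)$; and $\rho(\Pi^L\otimes A)=\mu_A(\rho\otimes A)(H\otimes\eta_A\otimes A)$. Put $u_1=\rho(H\otimes\eta_A)$, $u_2=u_1\mu$, $\chi_\rho=(\rho\otimes H)(H\otimes c)(\Delta\otimes A)$, $\nabla_\rho=(\mu_A\otimes H)(A\otimes\chi_\rho)(A\otimes H\otimes\eta_A)$ and $\nu=\nabla_\rho(\eta_A\otimes\eta)\colon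 K\to A\otimes H$. Let $f\colon H\otimes H\to A$ be a map, let $\Delta_{H\otimes H}=(H\otimes c\otimes H)(\Delta\otimes\Delta)$ and $\mathcal F_f=(f\otimes\mu)\Delta_{H\otimes H}$, and assume: 1. $f=\mu_A(A\otimes\rho)(\mathcal F_f\otimes\eta_A)$; 2. (twisted module condition) $\mu_A(A\otimes\rho)(\mathcal F_f\otimes A)=\mu_A(A\otimes f)(\chi_\rho\otimes H)(H\otimes\chi_\rho)$, and (cocycle condition) $\mu_A(A\otimes f)(\chi_\rho\otimes H)(H\otimes\mathcal F_f)=\mu_A(A\otimes f)(\mathcal F_f\otimes H)$; 3. $u_1=\mu_A(\rho\otimes f)(H\otimes c\otimes H)(\Delta\otimes\nu)$; 4. $u_1=\mu_A(A\otimes f)(\nu\otimes H)$; 5. $(\mu_A\otimes H)(A\otimes\chi_\rho)(\nu\otimes A)=(\mu_A\otimes H)(A\otimes\nu)$. Then $\nabla_\rho$ splits. Let $E=A\times_\rho^f H$ be its image, given by any choice of maps $\imath\colon E\to A\otimes H$ and $p\colon A\otimes H\to E$ with $p\,\imath=\mathrm{id}_E$ and $\imath\,p=\nabla_\rho$. Equip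 $E$ with the multiplication $\mu_E=p\,(\mu_A\otimes H)(\mu_A\otimes\mathcal F_f)(A\otimes\chi_\rho\otimes H)(\imath\otimes\imath)$, the unit $\eta_E=p\,\nu$ and the coaction $\delta_E=(p\otimes H)(A\otimes\Delta)\,\imath$. Let $\jmath_\nu=p\,(\mu_A\otimes H)(A\otimes\nu)\colon A\to E$ and $\gamma=p\,(\eta_A\otimes H)\colon H\to E$. If $f$ is convolution invertible (regular), i.e. $f*u_2=f$ and there is $f'\colon H\otimes H\to A$ with $f*f'=f'*f=u_2$ (convolution with respect to $\Delta_{H\otimes H}$), then $(E,\jmath_\nu)$ is an $H$-cleft extension of $A$ with cleaving map $\gamma$. That is: - $E$ is a unitary associative algebra and a right $H$-comodule algebra: $\delta_E$ is a counitary coassociative coaction, $\mu_E$ is $H$-colinear, and $(E\otimes\Delta)\delta_E\eta_E=(E\otimes\mu\otimes H)(\delta_E\otimes\Delta)(\eta_E\otimes\eta)$; - $\jmath_\nu$ is a monomorphism of unitary algebras and is the equalizer of $\delta_E$ and $(E\otimes\Pi^L)\delta_E$; - $\gamma$ is a morphism of right $H$-comodules with $\gamma\eta=\eta_E$, and there is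 $\gamma^{-1}\colon H\to E$ with $\gamma^{-1}*\gamma=\gamma\Pi^R$, $\gamma*\gamma^{-1}=\gamma\Pi^L$ and $(\gamma\Pi^R)*\gamma^{-1}=\gamma^{-1}$; - $\gamma\Pi^L$ factorizes through $\jmath_\nu$. -/

import Mathlib

open CategoryTheory MonoidalCategory BraidedCategory
open scoped MonObj ComonObj

universe v u

namespace WeakCleft

variable {C : Type u} [Category.{v} C] [MonoidalCategory C] [SymmetricCategory C]

/-! ### Maps built from an algebra and a coalgebra structure -/

section Basic

variable (H : C) [MonObj H] [ComonObj H]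

/-- The comultiplication `(H ⊗ c ⊗ H) ∘ (Δ ⊗ Δ)` of `H ⊗ H`. -/
def comul₂ : H ⊗ H ⟶ (H ⊗ H) ⊗ (H ⊗ H) :=
  (Δ[H] ⊗ₘ Δ[H]) ≫ tensorμ H H H H

/-- `Δ ∘ η : K ⟶ H ⊗ H`, in Sweedler notation the element `1₁ ⊗ 1₂`. -/
def comulOne : 𝟙_ C ⟶ H ⊗ H := η[H] ≫ Δ[H]

/-- `ε ∘ μ : H ⊗ H ⟶ K`. -/
def counitMul : H ⊗ H ⟶ 𝟙_ C := μ[H] ≫ ε[H]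

/-- `Π^L = (ε ∘ μ ⊗ H) ∘ (H ⊗ c) ∘ (Δ ∘ η ⊗ H)`, that is `h ↦ ε(1₁ h) 1₂`. -/
def piL : H ⟶ H :=
  (λ_ H).inv ≫ comulOne H ▷ H ≫ (α_ H H H).hom ≫ H ◁ (β_ H H).hom ≫ (α_ H H H).inv ≫
    counitMul H ▷ H ≫ (λ_ H).hom

/-- `Π^R = (H ⊗ ε ∘ μ) ∘ (c ⊗ H) ∘ (H ⊗ Δ ∘ η)`, that is `h ↦ 1₁ ε(h 1₂)`. -/
def piR : H ⟶ H :=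
  (ρ_ H).inv ≫ H ◁ comulOne H ≫ (α_ H H H).inv ≫ (β_ H H).hom ▷ H ≫ (α_ H H H).hom ≫
    H ◁ counitMul H ≫ (ρ_ H).hom

end Basic

/-- The convolution product `μ_B ∘ (g ⊗ h) ∘ d` of two maps `g, h : X ⟶ B`, where `B` is an
algebra and `X` is a coalgebra with comultiplication `d`. -/
def conv {X B : C} [MonObj B] (d : X ⟶ X ⊗ X) (g h : X ⟶ B) : X ⟶ B :=
  d ≫ (g ⊗ₘ h) ≫ μ[B]

/-! ### Weak bialgebras and weak Hopf algebras -/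

/-- A weak bialgebra in a symmetric monoidal category. -/
class WeakBialgebraObj (H : C) extends MonObj H, ComonObj H where
  /-- `Δ` is multiplicative. -/
  mul_comul : μ[H] ≫ Δ[H] = (Δ[H] ⊗ₘ Δ[H]) ≫ tensorμ H H H H ≫ (μ[H] ⊗ₘ μ[H])
  /-- `ε(h k l) = ε(h k₁) ε(k₂ l)`. -/
  counit_mul_mul :
    μ[H] ▷ H ≫ μ[H] ≫ ε[H] =
      (H ◁ Δ[H]) ▷ H ≫ (α_ H H H).inv ▷ H ≫ (α_ (H ⊗ H) H H).hom ≫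
        (counitMul H ⊗ₘ counitMul H) ≫ (λ_ (𝟙_ C)).hom
  /-- `ε(h k l) = ε(h k₂) ε(k₁ l)`. -/
  counit_mul_mul' :
    μ[H] ▷ H ≫ μ[H] ≫ ε[H] =
      (H ◁ (Δ[H] ≫ (β_ H H).hom)) ▷ H ≫ (α_ H H H).inv ▷ H ≫ (α_ (H ⊗ H) H H).hom ≫
        (counitMul H ⊗ₘ counitMul H) ≫ (λ_ (𝟙_ C)).hom
  /-- `1₁ ⊗ 1₂ ⊗ 1₃ = 1₁ ⊗ 1₂ 1'₁ ⊗ 1'₂`. -/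
  comul_comul_one :
    comulOne H ≫ Δ[H] ▷ H =
      (λ_ (𝟙_ C)).inv ≫ (comulOne H ⊗ₘ comulOne H) ≫ (α_ (H ⊗ H) H H).inv ≫
        (α_ H H H).hom ▷ H ≫ (H ◁ μ[H]) ▷ H
  /-- `1₁ ⊗ 1₂ ⊗ 1₃ = 1₁ ⊗ 1'₁ 1₂ ⊗ 1'₂`. -/
  comul_comul_one' :
    comulOne H ≫ Δ[H] ▷ H =
      (λ_ (𝟙_ C)).inv ≫ (comulOne H ⊗ₘ comulOne H) ≫ (α_ (H ⊗ H) H H).inv ≫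
        (α_ H H H).hom ▷ H ≫ (H ◁ ((β_ H H).hom ≫ μ[H])) ▷ H

/-- A weak Hopf algebra in a symmetric monoidal category: a weak bialgebra with an antipode. -/
class WeakHopfObj (H : C) extends WeakBialgebraObj H where
  /-- The antipode. -/
  antipode : H ⟶ H
  /-- `h₁ S(h₂) = Π^L(h)`. -/
  id_conv_antipode : Δ[H] ≫ H ◁ antipode ≫ μ[H] = piL H
  /-- `S(h₁) h₂ = Π^R(h)`. -/
  antipode_conv_id : Δ[H] ≫ antipode ▷ H ≫ μ[H] = piR H
  /-- `S(h₁) h₂ S(h₃) = S(h)`. -/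
  antipode_conv_id_conv_antipode :
    Δ[H] ≫ Δ[H] ▷ H ≫ ((antipode ⊗ₘ 𝟙 H) ⊗ₘ antipode) ≫ μ[H] ▷ H ≫ μ[H] = antipode

/-! ### Weak actions -/

section Action

variable {H A : C} [WeakBialgebraObj H] [MonObj A]

/-- The map `u₁ = ρ ∘ (H ⊗ η_A)`, that is `h ↦ h · 1_A`. -/
def u₁ (act : H ⊗ A ⟶ A) : H ⟶ A := (ρ_ H).inv ≫ H ◁ η[A] ≫ act

/-- The map `u₂ = u₁ ∘ μ`, that is `h ⊗ k ↦ (h k) · 1_A`. -/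
def u₂ (act : H ⊗ A ⟶ A) : H ⊗ H ⟶ A := μ[H] ≫ u₁ act

/-- The map `act` is a weak left action of the weak bialgebra `H` on the algebra `A`, or
equivalently `A` is a left weak `H`-module algebra via `act`. -/
structure IsWeakAction (act : H ⊗ A ⟶ A) : Prop where
  /-- `1 · a = a`. -/
  one_act : (λ_ A).inv ≫ η[H] ▷ A ≫ act = 𝟙 A
  /-- `h · (a b) = (h₁ · a) (h₂ · b)`: the map is a weak measure. -/
  act_mul : H ◁ μ[A] ≫ act = Δ[H] ▷ (A ⊗ A) ≫ tensorμ H H A A ≫ (act ⊗ₘ act) ≫ μ[A]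
  /-- `(h k) · 1 = h · (k · 1)`. -/
  mul_act_one : μ[H] ≫ u₁ act = H ◁ u₁ act ≫ act
  /-- `Π^L(h) · a = (h · 1) a`. -/
  piL_act : piL H ▷ A ≫ act = u₁ act ▷ A ≫ μ[A]

/-! ### Crossed products -/

/-- The twisting map `χ_ρ = (ρ ⊗ H) ∘ (H ⊗ c) ∘ (Δ ⊗ A)`, that is `h ⊗ a ↦ h₁ · a ⊗ h₂`. -/
def chi (act : H ⊗ A ⟶ A) : H ⊗ A ⟶ A ⊗ H :=
  Δ[H] ▷ A ≫ (α_ H H A).hom ≫ H ◁ (β_ H A).hom ≫ (α_ H A H).inv ≫ act ▷ H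

/-- The endomorphism `∇_ρ` of `A ⊗ H`, that is `a ⊗ h ↦ a (h₁ · 1_A) ⊗ h₂`. -/
def nabla (act : H ⊗ A ⟶ A) : A ⊗ H ⟶ A ⊗ H :=
  (ρ_ (A ⊗ H)).inv ≫ (A ⊗ H) ◁ η[A] ≫ (α_ A H A).hom ≫ A ◁ chi act ≫ (α_ A A H).inv ≫
    μ[A] ▷ H

/-- The preunit `ν = ∇_ρ ∘ (η_A ⊗ η)`. -/
def nu (act : H ⊗ A ⟶ A) : 𝟙_ C ⟶ A ⊗ H :=
  (λ_ (𝟙_ C)).inv ≫ (η[A] ⊗ₘ η[H]) ≫ nabla act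

/-- `F_f = (f ⊗ μ) ∘ Δ_{H ⊗ H}`, that is `h ⊗ k ↦ f(h₁, k₁) ⊗ h₂ k₂`. -/
def cocycleMap (f : H ⊗ H ⟶ A) : H ⊗ H ⟶ A ⊗ H := comul₂ H ≫ (f ⊗ₘ μ[H])

/-- `j'_ν = (μ_A ⊗ H) ∘ (A ⊗ ν) : A ⟶ A ⊗ H`. -/
def jPre (act : H ⊗ A ⟶ A) : A ⟶ A ⊗ H :=
  (ρ_ A).inv ≫ A ◁ nu act ≫ (α_ A A H).inv ≫ μ[A] ▷ H

/-- The hypotheses on a weak measure `act` and a map `f` under which the unitary crossed product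
of `A` by `H` associated with `act` and `f` is defined. -/
structure IsCrossedProductDatum (act : H ⊗ A ⟶ A) (f : H ⊗ H ⟶ A) : Prop where
  /-- `f(h, k) = f(h₁, k₁) ((h₂ k₂) · 1)`. -/
  cocycle_normalized : f = cocycleMap f ≫ A ◁ u₁ act ≫ μ[A]
  /-- The twisted module condition
  `f(h₁, k₁) ((h₂ k₂) · a) = (h₁ · (k₁ · a)) f(h₂, k₂)`. -/
  twisted_module :
    cocycleMap f ▷ A ≫ (α_ A H A).hom ≫ A ◁ act ≫ μ[A] =
      (α_ H H A).hom ≫ H ◁ chi act ≫ (α_ H A H).inv ≫ chi act ▷ H ≫ (α_ A H H).hom ≫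
        A ◁ f ≫ μ[A]
  /-- The cocycle condition
  `(h₁ · f(k₁, l₁)) f(h₂, k₂ l₂) = f(h₁, k₁) f(h₂ k₂, l)`. -/
  cocycle :
    (α_ H H H).hom ≫ H ◁ cocycleMap f ≫ (α_ H A H).inv ≫ chi act ▷ H ≫ (α_ A H H).hom ≫
        A ◁ f ≫ μ[A] =
      cocycleMap f ▷ H ≫ (α_ A H H).hom ≫ A ◁ f ≫ μ[A]
  /-- `ρ ∘ (H ⊗ η_A) = μ_A ∘ (ρ ⊗ f) ∘ (H ⊗ c ⊗ H) ∘ (Δ ⊗ ν)`. -/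
  preunit_right :
    u₁ act = (ρ_ H).inv ≫ (Δ[H] ⊗ₘ nu act) ≫ tensorμ H H A H ≫ (act ⊗ₘ f) ≫ μ[A]
  /-- `ρ ∘ (H ⊗ η_A) = μ_A ∘ (A ⊗ f) ∘ (ν ⊗ H)`. -/
  preunit_left :
    u₁ act = (λ_ H).inv ≫ nu act ▷ H ≫ (α_ A H H).hom ≫ A ◁ f ≫ μ[A]
  /-- `(μ_A ⊗ H) ∘ (A ⊗ χ_ρ) ∘ (ν ⊗ A) = (μ_A ⊗ H) ∘ (A ⊗ ν)`. -/
  preunit_central :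
    (λ_ A).inv ≫ nu act ▷ A ≫ (α_ A H A).hom ≫ A ◁ chi act ≫ (α_ A A H).inv ≫ μ[A] ▷ H =
      jPre act

/-- A map `f : H ⊗ H ⟶ A` is convolution invertible (regular) if `f * u₂ = f` and there is `f'`
with `f * f' = f' * f = u₂`. -/
def IsRegular (act : H ⊗ A ⟶ A) (f : H ⊗ H ⟶ A) : Prop :=
  conv (comul₂ H) f (u₂ act) = f ∧
    ∃ f' : H ⊗ H ⟶ A,
      conv (comul₂ H) f f' = u₂ act ∧ conv (comul₂ H) f' f = u₂ act

/-- The multiplication `(μ_A ⊗ H) ∘ (μ_A ⊗ F_f) ∘ (A ⊗ χ_ρ ⊗ H)` on `A ⊗ H`, that is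
`(a ⊗ h) (b ⊗ k) = a (h₁ · b) f(h₂, k₁) ⊗ h₃ k₂`. -/
def mulPre (act : H ⊗ A ⟶ A) (f : H ⊗ H ⟶ A) : (A ⊗ H) ⊗ (A ⊗ H) ⟶ A ⊗ H :=
  (α_ A H (A ⊗ H)).hom ≫ A ◁ ((α_ H A H).inv ≫ chi act ▷ H ≫ (α_ A H H).hom) ≫
    (α_ A A (H ⊗ H)).inv ≫ (μ[A] ⊗ₘ cocycleMap f) ≫ (α_ A A H).inv ≫ μ[A] ▷ H

/-- A choice of the object `E = A × H`, the image of `∇_ρ`, with its structure maps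
`i : E ⟶ A ⊗ H` and `r : A ⊗ H ⟶ E`: here `r ∘ i = id_E` and `i ∘ r = ∇_ρ`. -/
structure NablaSplitting (act : H ⊗ A ⟶ A) (E : C) extends Retract E (A ⊗ H) where
  r_i : r ≫ i = nabla act

namespace NablaSplitting

variable {act : H ⊗ A ⟶ A} {E : C} (s : NablaSplitting act E)

/-- The multiplication of the crossed product `E`. -/
def mul (f : H ⊗ H ⟶ A) : E ⊗ E ⟶ E := (s.i ⊗ₘ s.i) ≫ mulPre act f ≫ s.r

/-- The unit `p ∘ ν` of the crossed product `E`. -/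
def one : 𝟙_ C ⟶ E := nu act ≫ s.r

/-- The coaction `(p ⊗ H) ∘ (A ⊗ Δ) ∘ ι` of `H` on `E`. -/
def coact : E ⟶ E ⊗ H := s.i ≫ A ◁ Δ[H] ≫ (α_ A H H).inv ≫ s.r ▷ H

/-- The canonical map `j_ν = p ∘ j'_ν : A ⟶ E`. -/
def j : A ⟶ E := jPre act ≫ s.r

/-- The canonical map `γ = p ∘ (η_A ⊗ H) : H ⟶ E`. -/
def gamma : H ⟶ E := (λ_ H).inv ≫ η[A] ▷ H ≫ s.r

end NablaSplitting

end Action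

/-! ### Comodule algebras, extensions and cleft extensions -/

section Cleft

variable {H A B : C} [WeakBialgebraObj H] [MonObj A] [MonObj B]

/-- The algebra `B` with `δ : B ⟶ B ⊗ H` is a right `H`-comodule algebra. -/
structure IsComoduleAlgebra (δ : B ⟶ B ⊗ H) : Prop where
  coassoc : δ ≫ δ ▷ H ≫ (α_ B H H).hom = δ ≫ B ◁ Δ[H]
  counit : δ ≫ B ◁ ε[H] = (ρ_ B).inv
  /-- `μ_B` is colinear: `(b b')₀ ⊗ (b b')₁ = b₀ b'₀ ⊗ b₁ b'₁`. -/
  mul_colinear : μ[B] ≫ δ = (δ ⊗ₘ δ) ≫ tensorμ B H B H ≫ (μ[B] ⊗ₘ μ[H])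
  /-- `(B ⊗ Δ) ∘ δ ∘ η_B = (B ⊗ μ ⊗ H) ∘ (δ ⊗ Δ) ∘ (η_B ⊗ η)`. -/
  one_compat :
    η[B] ≫ δ ≫ B ◁ Δ[H] =
      (λ_ (𝟙_ C)).inv ≫ (η[B] ⊗ₘ η[H]) ≫ (δ ⊗ₘ Δ[H]) ≫ (α_ (B ⊗ H) H H).inv ≫
        (α_ B H H).hom ▷ H ≫ (B ◁ μ[H]) ▷ H ≫ (α_ B H H).hom

/-- The pair `(B, j)` is an extension of `A` by `H`: `B` is a right `H`-comodule algebra via `δ`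
and `j : A ⟶ B` is an algebra monomorphism which is the equalizer of `δ` and
`(B ⊗ Π^L) ∘ δ`. -/
structure IsExtension (δ : B ⟶ B ⊗ H) (j : A ⟶ B) : Prop where
  comoduleAlgebra : IsComoduleAlgebra δ
  isMonHom : IsMonHom j
  mono : Mono j
  isEqualizer :
    ∃ w : j ≫ δ = j ≫ δ ≫ B ◁ piL H, Nonempty (Limits.IsLimit (Limits.Fork.ofι j w))

/-- The map `g : H ⟶ B` is a total integral: a morphism of right `H`-comodules with
`g ∘ η = η_B`. -/
structure IsTotalIntegral (δ : B ⟶ B ⊗ H) (g : H ⟶ B) : Prop where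
  colinear : g ≫ δ = Δ[H] ≫ g ▷ H
  map_one : η[H] ≫ g = η[B]

/-- Convolution invertibility of an integral: there is `g'` with `g' * g = g ∘ Π^R`,
`g * g' = g ∘ Π^L` and `(g ∘ Π^R) * g' = g'`. -/
def IsConvInvertible (g : H ⟶ B) : Prop :=
  ∃ g' : H ⟶ B,
    conv Δ[H] g' g = piR H ≫ g ∧ conv Δ[H] g g' = piL H ≫ g ∧ conv Δ[H] (piR H ≫ g) g' = g'

/-- The map `g` is a cleaving map for `(B, j)`: a convolution invertible total integral such that
`g ∘ Π^L` factorizes through `j`. -/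
structure IsCleavingMap (δ : B ⟶ B ⊗ H) (j : A ⟶ B) (g : H ⟶ B) : Prop where
  totalIntegral : IsTotalIntegral δ g
  convInvertible : IsConvInvertible g
  factors : ∃ t : H ⟶ A, piL H ≫ g = t ≫ j

/-- The pair `(B, j)` is an `H`-cleft extension of `A`. -/
def IsCleftExtension (δ : B ⟶ B ⊗ H) (j : A ⟶ B) : Prop :=
  IsExtension δ j ∧ ∃ g : H ⟶ B, IsCleavingMap δ j g

end Cleft

end WeakCleft

/-! In Sweedler notation `nabla` is a ⊗ h ↦ a(h₁·1) ⊗ h₂, and both p and ι absorb the factor h₁·1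
(`prjU`, `incU`). After applying p, the formula a(h₁·b)f(h₂,k₁) ⊗ h₃k₂ does not change when ∇ is
applied to either argument (`prjMulLeft`, `prjMulRight`), so statements about E become identities
between representatives in A ⊗ H. Associativity then comes from the twisted module and cocycle
conditions, the unit laws from the preunit conditions, and colinearity from the multiplicativity of
Δ.

The equalizer is a split one. With q = (A ⊗ ε)ι : E → A one has qj = id, p(q ⊗ H)δ = id and p(q ⊗
H)(E ⊗ Π^L)δ = jq (`incl_inc_eps`, `coact_retract`, `coact_piL_retract`), so a map that equalizes
the pair factors through j by way of q.

For the cleaving map, f' is first replaced by g = u₂ * f' * u₂, which satisfies g = g * u₂ = u₂ * g.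
The candidate inverse is h ↦ p(g(S(h₂),h₃) ⊗ S(h₁)). That it is a left inverse rests on g * f = u₂
and on S reversing Δ (`antCom`). That it is a right inverse also needs (h₁·g(k₁,l))f(h₂,k₂) =
f(h₁,k₁l₁)g(h₂k₂,l₂) (`star`), which is the cocycle condition with f(k,l) moved to the other side.
The normalization (γΠ^R) * γ⁻¹ = γ⁻¹ is arranged at the end by multiplying with γΠ^R
(`IsConvInvertible.of_weak`).

Each such identity is an equation of string diagrams. A diagram is written as a program, a list of
operations on named wires. By coherence (`Str.unique`) a structural isomorphism between tensor
products of distinct wires depends only on its source and target, so a program has a well-defined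
value, which is independent of the order of its operations (`Sem.reorder`) and stable under
rewriting inside a context (`Sem.replace`). `Rule.derive` proves an equation from a list of
rewriting steps, each given by an equation and the wire where it applies, by evaluating a decidable
check. `Seg` translates between morphisms and programs. -/

namespace WeakCleft

/-! ### Coherence for tensor products of named wires -/

/-- Bracketed tensor products of named wires. -/
inductive Tr (W : Type) where
  | one : Tr W
  | leaf (w : W) : Tr W
  | node (a b : Tr W) : Tr W
  deriving DecidableEq

namespace Tr

variable {W : Type}

/-- The wires of a tree, from left to right. -/
def leaves : Tr W → List W
  | one => []
  | leaf w => [w]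
  | node a b => a.leaves ++ b.leaves

/-- The right-bracketed tree with given leaves. -/
def ofList : List W → Tr W
  | [] => one
  | w :: l => node (leaf w) (ofList l)

@[simp] lemma leaves_one : (one : Tr W).leaves = [] := rfl
@[simp] lemma leaves_leaf (w : W) : (leaf w).leaves = [w] := rfl
@[simp] lemma leaves_node (a b : Tr W) : (node a b).leaves = a.leaves ++ b.leaves := rfl

@[simp] lemma leaves_ofList (l : List W) : (ofList l).leaves = l := by
  induction l with
  | nil => rfl
  | cons w l ih => simp [ofList, ih]

/-- Renaming the wires of a tree. -/
def map {V : Type} (σ : W → V) : Tr W → Tr V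
  | one => one
  | leaf w => leaf (σ w)
  | node a b => node (a.map σ) (b.map σ)

variable {C : Type u} [Category.{v} C] [MonoidalCategory C]

/-- The tensor product of the objects carried by the wires of a tree. -/
@[reducible] def obj (ob : W → C) : Tr W → C
  | one => 𝟙_ C
  | leaf w => ob w
  | node a b => a.obj ob ⊗ b.obj ob

end Tr

open Tr

variable {C : Type u} [Category.{v} C] [MonoidalCategory C] [SymmetricCategory C]
-- Moving a tensor factor to the front, and its compatibility with the structural isomorphisms.
section

variable {X Y Z Y' Z' V : C}

lemma whisker_right_pull (f : Y ⟶ X ⊗ Y') (m : Z ⟶ Z') :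
    Z ◁ f ≫ (α_ Z X Y').inv ≫ (β_ Z X).hom ▷ Y' ≫ (α_ X Z Y').hom ≫ X ◁ m ▷ Y' =
      m ▷ Y ≫ Z' ◁ f ≫ (α_ Z' X Y').inv ≫ (β_ Z' X).hom ▷ Y' ≫ (α_ X Z' Y').hom := by
  rw [← associator_naturality_middle, ← comp_whiskerRight_assoc, ← braiding_naturality_left,
    comp_whiskerRight_assoc, ← associator_inv_naturality_left_assoc, whisker_exchange_assoc]

lemma whisker_left_pull (g : Z ⟶ Z') :
    V ◁ X ◁ g ≫ (α_ V X Z').inv ≫ (β_ V X).hom ▷ Z' ≫ (α_ X V Z').hom =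
      (α_ V X Z).inv ≫ (β_ V X).hom ▷ Z ≫ (α_ X V Z).hom ≫ X ◁ V ◁ g := by
  rw [associator_inv_naturality_right_assoc, whisker_exchange_assoc,
    associator_naturality_right]

lemma assoc_pull (f : Z ⟶ X ⊗ Z') :
    (α_ V Y Z).hom ≫ V ◁ (Y ◁ f ≫ (α_ Y X Z').inv ≫ (β_ Y X).hom ▷ Z' ≫ (α_ X Y Z').hom) ≫
        (α_ V X (Y ⊗ Z')).inv ≫ (β_ V X).hom ▷ (Y ⊗ Z') ≫ (α_ X V (Y ⊗ Z')).hom =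
      ((V ⊗ Y) ◁ f ≫ (α_ (V ⊗ Y) X Z').inv ≫ (β_ (V ⊗ Y) X).hom ▷ Z' ≫
        (α_ X (V ⊗ Y) Z').hom) ≫ X ◁ (α_ V Y Z').hom := by
  simp only [whiskerLeft_comp, Category.assoc, braiding_tensor_left_hom, comp_whiskerRight,
    tensor_whiskerLeft]
  monoidal

lemma assocMiddle_pull (f : Y ⟶ X ⊗ Y') :
    (α_ V Y Z).hom ≫ V ◁ (f ▷ Z ≫ (α_ X Y' Z).hom) ≫ (α_ V X (Y' ⊗ Z)).inv ≫
        (β_ V X).hom ▷ (Y' ⊗ Z) ≫ (α_ X V (Y' ⊗ Z)).hom =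
      ((V ◁ f ≫ (α_ V X Y').inv ≫ (β_ V X).hom ▷ Y' ≫ (α_ X V Y').hom) ▷ Z ≫
        (α_ X (V ⊗ Y') Z).hom) ≫ X ◁ (α_ V Y' Z).hom := by
  monoidal

lemma braid_pull_left (f : Y ⟶ X ⊗ Y') :
    (β_ Y Z).hom ≫ Z ◁ f ≫ (α_ Z X Y').inv ≫ (β_ Z X).hom ▷ Y' ≫ (α_ X Z Y').hom =
      (f ▷ Z ≫ (α_ X Y' Z).hom) ≫ X ◁ (β_ Y' Z).hom := by
  rw [← braiding_naturality_left_assoc, braiding_tensor_left_hom]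
  simp only [Category.assoc, Iso.hom_inv_id_assoc, ← comp_whiskerRight_assoc,
    SymmetricCategory.symmetry]
  simp

lemma braid_pull_right (f : Z ⟶ X ⊗ Z') :
    (β_ Y Z).hom ≫ f ▷ Y ≫ (α_ X Z' Y).hom =
      (Y ◁ f ≫ (α_ Y X Z').inv ≫ (β_ Y X).hom ▷ Z' ≫ (α_ X Y Z').hom) ≫
        X ◁ (β_ Y Z').hom := by
  rw [← braiding_naturality_right_assoc, braiding_tensor_right_hom]
  simp

omit [SymmetricCategory C] in
lemma assoc_un (f : X ⟶ 𝟙_ C) (g : Y ⟶ 𝟙_ C) (h : Z ⟶ 𝟙_ C) :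
    (α_ X Y Z).hom ≫ (f ⊗ₘ ((g ⊗ₘ h) ≫ (λ_ (𝟙_ C)).hom)) ≫ (λ_ (𝟙_ C)).hom =
      (((f ⊗ₘ g) ≫ (λ_ (𝟙_ C)).hom) ⊗ₘ h) ≫ (λ_ (𝟙_ C)).hom := by
  simp only [MonoidalCategory.tensorHom_def]
  monoidal

lemma braid_un (f : X ⟶ 𝟙_ C) (g : Y ⟶ 𝟙_ C) :
    (β_ X Y).hom ≫ (g ⊗ₘ f) ≫ (λ_ (𝟙_ C)).hom = (f ⊗ₘ g) ≫ (λ_ (𝟙_ C)).hom := by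
  rw [← braiding_naturality_assoc, braiding_tensorUnit_left]
  simp [unitors_equal]

end

variable {W : Type} (ob : W → C)

/-- `Str ob s t m`: the morphism `m` is a composite of structural isomorphisms which preserves the
names of the wires. -/
inductive Str : (s t : Tr W) → (s.obj ob ⟶ t.obj ob) → Prop
  | id (s : Tr W) : Str s s (𝟙 _)
  | comp {s t r : Tr W} {m : s.obj ob ⟶ t.obj ob} {n : t.obj ob ⟶ r.obj ob} :
      Str s t m → Str t r n → Str s r (m ≫ n)
  | whiskerLeft (r : Tr W) {s t : Tr W} {m : s.obj ob ⟶ t.obj ob} :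
      Str s t m → Str (node r s) (node r t) (r.obj ob ◁ m)
  | whiskerRight {s t : Tr W} {m : s.obj ob ⟶ t.obj ob} (r : Tr W) :
      Str s t m → Str (node s r) (node t r) (m ▷ r.obj ob)
  | assoc (a b c : Tr W) : Str (node (node a b) c) (node a (node b c))
      (α_ (a.obj ob) (b.obj ob) (c.obj ob)).hom
  | assocInv (a b c : Tr W) : Str (node a (node b c)) (node (node a b) c)
      (α_ (a.obj ob) (b.obj ob) (c.obj ob)).inv
  | leftUnitor (a : Tr W) : Str (node one a) a (λ_ (a.obj ob)).hom
  | leftUnitorInv (a : Tr W) : Str a (node one a) (λ_ (a.obj ob)).inv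
  | rightUnitor (a : Tr W) : Str (node a one) a (ρ_ (a.obj ob)).hom
  | rightUnitorInv (a : Tr W) : Str a (node a one) (ρ_ (a.obj ob)).inv
  | braid (a b : Tr W) : Str (node a b) (node b a) (β_ (a.obj ob) (b.obj ob)).hom

variable {ob}

lemma Str.perm {s t : Tr W} {m : s.obj ob ⟶ t.obj ob} (h : Str ob s t m) :
    s.leaves.Perm t.leaves := by
  induction h with
  | id s => exact List.Perm.refl _
  | comp _ _ h₁ h₂ => exact h₁.trans h₂
  | whiskerLeft r _ h => exact h.append_left _
  | whiskerRight r _ h => exact h.append_right _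
  | assoc a b c => simp
  | assocInv a b c => simp
  | leftUnitor a => simp
  | leftUnitorInv a => simp
  | rightUnitor a => simp
  | rightUnitorInv a => simp
  | braid a b => exact List.perm_append_comm

lemma Str.exists_inv {s t : Tr W} {m : s.obj ob ⟶ t.obj ob} (h : Str ob s t m) :
    ∃ n, Str ob t s n ∧ m ≫ n = 𝟙 _ ∧ n ≫ m = 𝟙 _ := by
  induction h with
  | id s => exact ⟨_, .id s, by simp, by simp⟩
  | comp _ _ h₁ h₂ =>
    obtain ⟨n₁, a₁, b₁, c₁⟩ := h₁
    obtain ⟨n₂, a₂, b₂, c₂⟩ := h₂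
    refine ⟨_, a₂.comp a₁, ?_, ?_⟩
    · rw [Category.assoc, reassoc_of% b₂, b₁]
    · rw [Category.assoc, reassoc_of% c₁, c₂]
  | whiskerLeft r _ h =>
    obtain ⟨n, a, b, c⟩ := h
    refine ⟨_, a.whiskerLeft r, ?_, ?_⟩
    · rw [← whiskerLeft_comp, b, whiskerLeft_id]
    · rw [← whiskerLeft_comp, c, whiskerLeft_id]
  | whiskerRight r _ h =>
    obtain ⟨n, a, b, c⟩ := h
    refine ⟨_, a.whiskerRight r, ?_, ?_⟩
    · rw [← comp_whiskerRight, b, id_whiskerRight]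
    · rw [← comp_whiskerRight, c, id_whiskerRight]
  | assoc a b c => exact ⟨_, .assocInv a b c, Iso.hom_inv_id _, Iso.inv_hom_id _⟩
  | assocInv a b c => exact ⟨_, .assoc a b c, Iso.inv_hom_id _, Iso.hom_inv_id _⟩
  | leftUnitor a => exact ⟨_, .leftUnitorInv a, Iso.hom_inv_id _, Iso.inv_hom_id _⟩
  | leftUnitorInv a => exact ⟨_, .leftUnitor a, Iso.inv_hom_id _, Iso.hom_inv_id _⟩
  | rightUnitor a => exact ⟨_, .rightUnitorInv a, Iso.hom_inv_id _, Iso.inv_hom_id _⟩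
  | rightUnitorInv a => exact ⟨_, .rightUnitor a, Iso.inv_hom_id _, Iso.hom_inv_id _⟩
  | braid a b => exact ⟨_, .braid b a, SymmetricCategory.symmetry _ _,
      SymmetricCategory.symmetry _ _⟩

/-! #### Existence of structural isomorphisms -/

lemma exists_str_append (l l' : List W) :
    ∃ m, Str ob (node (ofList l) (ofList l')) (ofList (l ++ l')) m := by
  induction l with
  | nil => exact ⟨_, .leftUnitor _⟩
  | cons w l ih =>
    obtain ⟨m, hm⟩ := ih
    exact ⟨_, (Str.assoc (leaf w) _ _).comp (hm.whiskerLeft (leaf w))⟩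

lemma exists_str_ofList (t : Tr W) : ∃ m, Str ob t (ofList t.leaves) m := by
  induction t with
  | one => exact ⟨_, .id one⟩
  | leaf w => exact ⟨_, .rightUnitorInv (leaf w)⟩
  | node a b ha hb =>
    obtain ⟨m, hm⟩ := ha
    obtain ⟨n, hn⟩ := hb
    obtain ⟨k, hk⟩ := exists_str_append (ob := ob) a.leaves b.leaves
    exact ⟨_, ((hm.whiskerRight b).comp (hn.whiskerLeft _)).comp hk⟩

lemma exists_str_of_perm {l l' : List W} (h : l.Perm l') :
    ∃ m, Str ob (ofList l) (ofList l') m := by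
  induction h with
  | nil => exact ⟨_, .id one⟩
  | cons w _ ih =>
    obtain ⟨m, hm⟩ := ih
    exact ⟨_, hm.whiskerLeft (leaf w)⟩
  | swap x y l =>
    exact ⟨_, ((Str.assocInv (leaf y) (leaf x) (ofList l)).comp
      ((Str.braid (leaf y) (leaf x)).whiskerRight _)).comp (.assoc _ _ _)⟩
  | trans _ _ h₁ h₂ =>
    obtain ⟨m, hm⟩ := h₁
    obtain ⟨n, hn⟩ := h₂
    exact ⟨_, hm.comp hn⟩

lemma exists_str {s t : Tr W} (h : s.leaves.Perm t.leaves) : ∃ m, Str ob s t m := by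
  obtain ⟨m, hm⟩ := exists_str_ofList (ob := ob) s
  obtain ⟨n, hn⟩ := exists_str_ofList (ob := ob) t
  obtain ⟨k, hk⟩ := exists_str_of_perm (ob := ob) h
  obtain ⟨n', hn', -, -⟩ := hn.exists_inv
  exact ⟨_, (hm.comp hk).comp hn'⟩

/-! #### Extraction of a wire -/

variable (ob) in
/-- `Pull ob x t r p`: the morphism `p` moves an occurrence of the wire `x` to the front of `t`,
leaving `r`. -/
inductive Pull (x : W) : (t r : Tr W) → (t.obj ob ⟶ ob x ⊗ r.obj ob) → Prop
  | leaf : Pull x (leaf x) one (ρ_ (ob x)).inv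
  | left {a r : Tr W} {p : a.obj ob ⟶ ob x ⊗ r.obj ob} (b : Tr W) :
      Pull x a r p → Pull x (node a b) (node r b)
        (p ▷ b.obj ob ≫ (α_ (ob x) (r.obj ob) (b.obj ob)).hom)
  | right {b r : Tr W} {p : b.obj ob ⟶ ob x ⊗ r.obj ob} (a : Tr W) :
      Pull x b r p → Pull x (node a b) (node a r)
        (a.obj ob ◁ p ≫ (α_ (a.obj ob) (ob x) (r.obj ob)).inv ≫
          (β_ (a.obj ob) (ob x)).hom ▷ r.obj ob ≫ (α_ (ob x) (a.obj ob) (r.obj ob)).hom)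

lemma exists_pull {x : W} {t : Tr W} (h : x ∈ t.leaves) : ∃ r p, Pull ob x t r p := by
  induction t with
  | one => simp at h
  | leaf w => obtain rfl : x = w := by simpa using h
              exact ⟨_, _, .leaf⟩
  | node a b ha hb =>
    rcases List.mem_append.1 h with h | h
    · obtain ⟨r, p, hp⟩ := ha h
      exact ⟨_, _, hp.left b⟩
    · obtain ⟨r, p, hp⟩ := hb h
      exact ⟨_, _, hp.right a⟩

lemma Pull.isIso {x : W} {t r : Tr W} {p : t.obj ob ⟶ ob x ⊗ r.obj ob} (h : Pull ob x t r p) :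
    IsIso p := by
  induction h with
  | leaf => infer_instance
  | left b _ ih => have := ih; infer_instance
  | right a _ ih => have := ih; infer_instance

lemma Pull.perm {x : W} {t r : Tr W} {p : t.obj ob ⟶ ob x ⊗ r.obj ob} (h : Pull ob x t r p) :
    t.leaves.Perm (x :: r.leaves) := by
  induction h with
  | leaf => simp
  | left b _ ih => exact ih.append_right _
  | right a _ ih => exact (ih.append_left _).trans List.perm_middle

/-- With distinct names the wire occurs only once, so there is only one way to extract it. The
remaining trees are not known to agree beforehand, hence the equality of dependent pairs. -/
lemma Pull.unique {x : W} {t r r' : Tr W} {p : t.obj ob ⟶ ob x ⊗ r.obj ob}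
    {p' : t.obj ob ⟶ ob x ⊗ r'.obj ob} (h : Pull ob x t r p) (h' : Pull ob x t r' p')
    (ht : t.leaves.Nodup) :
    (⟨r, p⟩ : Σ r : Tr W, (t.obj ob ⟶ ob x ⊗ r.obj ob)) = ⟨r', p'⟩ := by
  induction h generalizing r' with
  | leaf => cases h'; rfl
  | left b h ih =>
    obtain ⟨h1, h2, h3⟩ := List.nodup_append.1 ht
    cases h' with
    | left _ h' => cases ih h' h1; rfl
    | right _ h' =>
      exact absurd rfl (h3 x (h.perm.symm.subset (by simp)) x (h'.perm.symm.subset (by simp)))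
  | right a h ih =>
    obtain ⟨h1, h2, h3⟩ := List.nodup_append.1 ht
    cases h' with
    | left _ h' =>
      exact absurd rfl (h3 x (h'.perm.symm.subset (by simp)) x (h.perm.symm.subset (by simp)))
    | right _ h' => cases ih h' h2; rfl

/-- This is the inductive step of coherence: once a wire has been moved to the front, a structural
morphism becomes the identity on that wire tensored with a structural morphism on one wire fewer. -/
lemma Str.pull {s t : Tr W} {m : s.obj ob ⟶ t.obj ob} (h : Str ob s t m) {x : W} {r : Tr W}
    {p : s.obj ob ⟶ ob x ⊗ r.obj ob} (hp : Pull ob x s r p) :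
    ∃ (r' : Tr W) (p' : t.obj ob ⟶ ob x ⊗ r'.obj ob) (m' : r.obj ob ⟶ r'.obj ob),
      Pull ob x t r' p' ∧ Str ob r r' m' ∧ m ≫ p' = p ≫ ob x ◁ m' := by
  induction h generalizing r with
  | id s => exact ⟨_, _, _, hp, .id _, by simp⟩
  | comp _ _ h₁ h₂ =>
    obtain ⟨r₁, p₁, m₁, a₁, b₁, c₁⟩ := h₁ hp
    obtain ⟨r₂, p₂, m₂, a₂, b₂, c₂⟩ := h₂ a₁
    refine ⟨_, _, _, a₂, b₁.comp b₂, ?_⟩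
    rw [Category.assoc, c₂, reassoc_of% c₁, whiskerLeft_comp]
  | @whiskerLeft q s t m hm ih =>
    cases hp with
    | left _ hp =>
      exact ⟨_, _, _, hp.left _, hm.whiskerLeft _, by simp [whisker_exchange_assoc]⟩
    | right _ hp =>
      obtain ⟨r₁, p₁, m₁, a₁, b₁, c₁⟩ := ih hp
      refine ⟨_, _, _, a₁.right _, b₁.whiskerLeft _, ?_⟩
      rw [← whiskerLeft_comp_assoc, c₁, whiskerLeft_comp_assoc, whisker_left_pull]
      simp only [Category.assoc]
  | @whiskerRight s t m q hm ih =>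
    cases hp with
    | left _ hp =>
      obtain ⟨r₁, p₁, m₁, a₁, b₁, c₁⟩ := ih hp
      refine ⟨_, _, _, a₁.left _, b₁.whiskerRight _, ?_⟩
      rw [← comp_whiskerRight_assoc, c₁]
      simp
    | right _ hp =>
      refine ⟨_, _, _, hp.right _, hm.whiskerRight _, ?_⟩
      simp only [Category.assoc]
      exact (whisker_right_pull _ _).symm
  | assoc a b c =>
    cases hp with
    | left _ hp =>
      cases hp with
      | left _ hp => exact ⟨_, _, _, hp.left _, .assoc _ _ _, by simp⟩
      | right _ hp => exact ⟨_, _, _, (hp.left _).right _, .assoc _ _ _, assocMiddle_pull _⟩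
    | right _ hp => exact ⟨_, _, _, (hp.right _).right _, .assoc _ _ _, assoc_pull _⟩
  | assocInv a b c =>
    cases hp with
    | left _ hp => exact ⟨_, _, _, (hp.left _).left _, .assocInv _ _ _, by simp⟩
    | right _ hp =>
      cases hp with
      | left _ hp =>
        refine ⟨_, _, _, (hp.right _).left _, .assocInv _ _ _, ?_⟩
        -- The case of the inverse associator follows from the case of the associator by cancelling
        -- associators on both sides.
        rw [← cancel_epi (α_ _ _ _).hom, Iso.hom_inv_id_assoc]
        rw [← cancel_mono (_ ◁ (α_ _ _ _).hom), Category.assoc, Category.assoc]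
        simp only [Category.assoc, ← whiskerLeft_comp, Iso.inv_hom_id, whiskerLeft_id,
          Category.comp_id]
        simpa only [Category.assoc] using (assocMiddle_pull _).symm
      | right _ hp =>
        refine ⟨_, _, _, hp.right _, .assocInv _ _ _, ?_⟩
        rw [← cancel_epi (α_ _ _ _).hom, Iso.hom_inv_id_assoc]
        rw [← cancel_mono (_ ◁ (α_ _ _ _).hom), Category.assoc, Category.assoc]
        simp only [Category.assoc, ← whiskerLeft_comp, Iso.inv_hom_id, whiskerLeft_id,
          Category.comp_id]
        simpa only [Category.assoc] using (assoc_pull _).symm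
  | leftUnitor a =>
    cases hp with
    | left _ hp => cases hp
    | right _ hp => exact ⟨_, _, _, hp, .leftUnitor _, by simp⟩
  | leftUnitorInv a => exact ⟨_, _, _, hp.right one, .leftUnitorInv _, by simp⟩
  | rightUnitor a =>
    cases hp with
    | right _ hp => cases hp
    | left _ hp => exact ⟨_, _, _, hp, .rightUnitor _, by simp⟩
  | rightUnitorInv a => exact ⟨_, _, _, hp.left one, .rightUnitorInv _, by simp⟩
  | braid a b =>
    cases hp with
    | left _ hp => exact ⟨_, _, _, hp.right _, .braid _ _, braid_pull_left _⟩
    | right _ hp => exact ⟨_, _, _, hp.left _, .braid _ _, braid_pull_right _⟩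

/-! #### Trees without wires -/

variable (ob) in
/-- The structural isomorphism from a tree without wires to the unit object. -/
inductive Un : (t : Tr W) → (t.obj ob ⟶ 𝟙_ C) → Prop
  | one : Un one (𝟙 _)
  | node {a b : Tr W} {m : a.obj ob ⟶ 𝟙_ C} {n : b.obj ob ⟶ 𝟙_ C} :
      Un a m → Un b n → Un (node a b) ((m ⊗ₘ n) ≫ (λ_ (𝟙_ C)).hom)

omit [SymmetricCategory C] in
lemma exists_un {t : Tr W} (h : t.leaves = []) : ∃ m, Un ob t m := by
  induction t with
  | one => exact ⟨_, .one⟩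
  | leaf w => simp at h
  | node a b ha hb =>
    obtain ⟨h1, h2⟩ := List.append_eq_nil_iff.1 h
    obtain ⟨m, hm⟩ := ha h1
    obtain ⟨n, hn⟩ := hb h2
    exact ⟨_, hm.node hn⟩

omit [SymmetricCategory C] in
lemma Un.isIso {t : Tr W} {m : t.obj ob ⟶ 𝟙_ C} (h : Un ob t m) : IsIso m := by
  induction h with
  | one => exact inferInstanceAs (IsIso (𝟙 (𝟙_ C)))
  | node _ _ h₁ h₂ => have := h₁; have := h₂; infer_instance

omit [SymmetricCategory C] in
lemma Un.unique {t : Tr W} {m n : t.obj ob ⟶ 𝟙_ C} (h : Un ob t m) (h' : Un ob t n) :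
    m = n := by
  induction h with
  | one => cases h'; rfl
  | node _ _ h₁ h₂ => cases h' with | node a b => rw [h₁ a, h₂ b]

lemma Str.un {s t : Tr W} {m : s.obj ob ⟶ t.obj ob} (h : Str ob s t m) {p : s.obj ob ⟶ 𝟙_ C}
    (hp : Un ob s p) : ∃ q, Un ob t q ∧ m ≫ q = p := by
  induction h with
  | id s => exact ⟨_, hp, Category.id_comp _⟩
  | comp _ _ h₁ h₂ =>
    obtain ⟨q₁, a₁, b₁⟩ := h₁ hp
    obtain ⟨q₂, a₂, b₂⟩ := h₂ a₁
    exact ⟨_, a₂, by rw [Category.assoc, b₂, b₁]⟩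
  | whiskerLeft r _ ih =>
    cases hp with
    | node h₁ h₂ =>
      obtain ⟨q, a, rfl⟩ := ih h₂
      exact ⟨_, h₁.node a, by simp [MonoidalCategory.tensorHom_def']⟩
  | whiskerRight r _ ih =>
    cases hp with
    | node h₁ h₂ =>
      obtain ⟨q, a, rfl⟩ := ih h₁
      exact ⟨_, a.node h₂, by simp [MonoidalCategory.tensorHom_def]⟩
  | assoc a b c =>
    cases hp with
    | node h₁ h₂ =>
      cases h₁ with
      | node h₁ h₃ =>
        exact ⟨_, h₁.node (h₃.node h₂), assoc_un _ _ _⟩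
  | assocInv a b c =>
    cases hp with
    | node h₁ h₂ =>
      cases h₂ with
      | node h₂ h₃ =>
        exact ⟨_, (h₁.node h₂).node h₃, by rw [← assoc_un, Iso.inv_hom_id_assoc]⟩
  | leftUnitor a =>
    cases hp with
    | node h₁ h₂ =>
      cases h₁
      exact ⟨_, h₂, by simp⟩
  | leftUnitorInv a => exact ⟨_, Un.one.node hp, by simp⟩
  | rightUnitor a =>
    cases hp with
    | node h₁ h₂ =>
      cases h₂
      exact ⟨_, h₁, by simp [unitors_equal]⟩
  | rightUnitorInv a => exact ⟨_, hp.node Un.one, by simp [unitors_equal]⟩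
  | braid a b =>
    cases hp with
    | node h₁ h₂ => exact ⟨_, h₂.node h₁, braid_un _ _⟩

/-- Coherence: a structural isomorphism between tensor products of distinct wires is determined by
its source and target. -/
lemma Str.unique {s t : Tr W} {m n : s.obj ob ⟶ t.obj ob} (hm : Str ob s t m) (hn : Str ob s t n)
    (hs : s.leaves.Nodup) : m = n := by
  induction hk : s.leaves.length generalizing s t with
  -- Without wires, every tree has a canonical isomorphism to the unit object, and structural
  -- morphisms commute with these isomorphisms.
  | zero =>
    obtain ⟨p, hp⟩ := exists_un (ob := ob) (List.length_eq_zero_iff.1 hk)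
    obtain ⟨q, hq, e⟩ := hm.un hp
    obtain ⟨q', hq', e'⟩ := hn.un hp
    obtain rfl := hq.unique hq'
    have := hq.isIso
    rw [← cancel_mono q, e, e']
  | succ k ih =>
    obtain ⟨x, hx⟩ := List.exists_mem_of_length_pos (l := s.leaves) (by omega)
    obtain ⟨r, p, hp⟩ := exists_pull (ob := ob) hx
    obtain ⟨r₁, p₁, m₁, a₁, b₁, c₁⟩ := hm.pull hp
    obtain ⟨r₂, p₂, m₂, a₂, b₂, c₂⟩ := hn.pull hp
    -- Both morphisms lead to the same extraction on the target, so only the parts on the remaining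
    -- wires are to be compared.
    cases a₁.unique a₂ (hm.perm.nodup_iff.1 hs)
    have hr := hp.perm
    have e := ih b₁ b₂ ((List.nodup_cons.1 (hr.nodup_iff.1 hs)).2)
      (by have := hr.length_eq; simp at this; omega)
    subst e
    have := a₁.isIso
    rw [← cancel_mono p₁, c₁, c₂]

end WeakCleft

namespace WeakCleft

open Tr

/-! ### Programs of named wires and their interpretation -/

/-- Named wires, which carry the objects `H`, `A` and `E`. -/
inductive Wire where
  | h (n : ℕ) | a (n : ℕ) | e (n : ℕ)
  deriving DecidableEq

/-- Renaming a wire. -/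
def Wire.map (σ : ℕ → ℕ) : Wire → Wire
  | h n => h (σ n) | a n => a (σ n) | e n => e (σ n)

/-- Elementary operations. The arguments are the names of the wires which are consumed, followed by
the names of the wires which are produced. -/
inductive Instr where
  | idH (x y : ℕ) | idA (x y : ℕ) | idE (x y : ℕ)
  | mul (x y z : ℕ) | one (x : ℕ) | com (x y z : ℕ) | eps (x : ℕ)
  | ant (x y : ℕ) | piL (x y : ℕ) | piR (x y : ℕ)
  | mulA (x y z : ℕ) | oneA (x : ℕ)
  | act (x y z : ℕ) | u (x y : ℕ) | f (x y z : ℕ) | g (x y z : ℕ)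
  | inc (x y z : ℕ) | prj (x y z : ℕ)
  deriving DecidableEq

namespace Instr

/-- The tensor product of two wires. -/
abbrev pair (x y : Wire) : Tr Wire := node (leaf x) (leaf y)

/-- The wires which are consumed. -/
def ins : Instr → Tr Wire
  | idH x _ => leaf (.h x) | idA x _ => leaf (.a x) | idE x _ => leaf (.e x)
  | mul x y _ => pair (.h x) (.h y) | .one _ => Tr.one | com x _ _ => leaf (.h x)
  | eps x => leaf (.h x)
  | ant x _ => leaf (.h x) | piL x _ => leaf (.h x) | piR x _ => leaf (.h x)
  | mulA x y _ => pair (.a x) (.a y) | oneA _ => Tr.one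
  | act x y _ => pair (.h x) (.a y) | u x _ => leaf (.h x)
  | f x y _ => pair (.h x) (.h y) | g x y _ => pair (.h x) (.h y)
  | inc x _ _ => leaf (.e x) | prj x y _ => pair (.a x) (.h y)

/-- The wires which are produced. -/
def outs : Instr → Tr Wire
  | idH _ y => leaf (.h y) | idA _ y => leaf (.a y) | idE _ y => leaf (.e y)
  | mul _ _ z => leaf (.h z) | .one x => leaf (.h x) | com _ y z => pair (.h y) (.h z)
  | eps _ => Tr.one
  | ant _ y => leaf (.h y) | piL _ y => leaf (.h y) | piR _ y => leaf (.h y)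
  | mulA _ _ z => leaf (.a z) | oneA x => leaf (.a x)
  | act _ _ z => leaf (.a z) | u _ y => leaf (.a y)
  | f _ _ z => leaf (.a z) | g _ _ z => leaf (.a z)
  | inc _ y z => pair (.a y) (.h z) | prj _ _ z => leaf (.e z)

/-- Renaming the wires of an operation. -/
def map (σ : ℕ → ℕ) : Instr → Instr
  | idH x y => idH (σ x) (σ y) | idA x y => idA (σ x) (σ y) | idE x y => idE (σ x) (σ y)
  | mul x y z => mul (σ x) (σ y) (σ z) | .one x => .one (σ x)
  | com x y z => com (σ x) (σ y) (σ z) | eps x => eps (σ x)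
  | ant x y => ant (σ x) (σ y) | piL x y => piL (σ x) (σ y) | piR x y => piR (σ x) (σ y)
  | mulA x y z => mulA (σ x) (σ y) (σ z) | oneA x => oneA (σ x)
  | act x y z => act (σ x) (σ y) (σ z) | u x y => u (σ x) (σ y)
  | f x y z => f (σ x) (σ y) (σ z) | g x y z => g (σ x) (σ y) (σ z)
  | inc x y z => inc (σ x) (σ y) (σ z) | prj x y z => prj (σ x) (σ y) (σ z)

end Instr

/-- An interpretation of the operations in a category. -/
structure Interp (C : Type u) [Category.{v} C] [MonoidalCategory C] where
  /-- The object carried by the wires `h n`. -/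
  H : C
  /-- The object carried by the wires `a n`. -/
  A : C
  /-- The object carried by the wires `e n`. -/
  E : C
  mul : H ⊗ H ⟶ H
  one : 𝟙_ C ⟶ H
  com : H ⟶ H ⊗ H
  eps : H ⟶ 𝟙_ C
  ant : H ⟶ H
  piL : H ⟶ H
  piR : H ⟶ H
  mulA : A ⊗ A ⟶ A
  oneA : 𝟙_ C ⟶ A
  act : H ⊗ A ⟶ A
  u : H ⟶ A
  f : H ⊗ H ⟶ A
  g : H ⊗ H ⟶ A
  inc : E ⟶ A ⊗ H
  prj : A ⊗ H ⟶ E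

variable {C : Type u} [Category.{v} C] [MonoidalCategory C]

namespace Interp

variable (M : Interp C)

/-- The object carried by a wire. -/
@[reducible] def ob : Wire → C
  | .h _ => M.H | .a _ => M.A | .e _ => M.E

/-- The object carried by a tree of wires. -/
abbrev obj (t : Tr Wire) : C := t.obj M.ob

/-- `M.Mor I i o m`: the operation `I` consumes `i`, produces `o` and is interpreted by `m`. -/
inductive Mor : Instr → (i o : Tr Wire) → (M.obj i ⟶ M.obj o) → Prop
  | idH (x y) : Mor (.idH x y) (leaf (.h x)) (leaf (.h y)) (𝟙 M.H)
  | idA (x y) : Mor (.idA x y) (leaf (.a x)) (leaf (.a y)) (𝟙 M.A)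
  | idE (x y) : Mor (.idE x y) (leaf (.e x)) (leaf (.e y)) (𝟙 M.E)
  | mul (x y z) : Mor (.mul x y z) (node (leaf (.h x)) (leaf (.h y))) (leaf (.h z)) M.mul
  | one (x) : Mor (.one x) Tr.one (leaf (.h x)) M.one
  | com (x y z) : Mor (.com x y z) (leaf (.h x)) (node (leaf (.h y)) (leaf (.h z))) M.com
  | eps (x) : Mor (.eps x) (leaf (.h x)) Tr.one M.eps
  | ant (x y) : Mor (.ant x y) (leaf (.h x)) (leaf (.h y)) M.ant
  | piL (x y) : Mor (.piL x y) (leaf (.h x)) (leaf (.h y)) M.piL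
  | piR (x y) : Mor (.piR x y) (leaf (.h x)) (leaf (.h y)) M.piR
  | mulA (x y z) : Mor (.mulA x y z) (node (leaf (.a x)) (leaf (.a y))) (leaf (.a z)) M.mulA
  | oneA (x) : Mor (.oneA x) Tr.one (leaf (.a x)) M.oneA
  | act (x y z) : Mor (.act x y z) (node (leaf (.h x)) (leaf (.a y))) (leaf (.a z)) M.act
  | u (x y) : Mor (.u x y) (leaf (.h x)) (leaf (.a y)) M.u
  | f (x y z) : Mor (.f x y z) (node (leaf (.h x)) (leaf (.h y))) (leaf (.a z)) M.f
  | g (x y z) : Mor (.g x y z) (node (leaf (.h x)) (leaf (.h y))) (leaf (.a z)) M.g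
  | inc (x y z) : Mor (.inc x y z) (leaf (.e x)) (node (leaf (.a y)) (leaf (.h z))) M.inc
  | prj (x y z) : Mor (.prj x y z) (node (leaf (.a x)) (leaf (.h y))) (leaf (.e z)) M.prj

variable {M}

lemma exists_mor (I : Instr) : ∃ m, M.Mor I I.ins I.outs m := by
  cases I <;> exact ⟨_, by constructor⟩

lemma Mor.ins_eq {I : Instr} {i o : Tr Wire} {m : M.obj i ⟶ M.obj o} (h : M.Mor I i o m) :
    I.ins = i := by
  cases h <;> rfl

lemma Mor.outs_eq {I : Instr} {i o : Tr Wire} {m : M.obj i ⟶ M.obj o} (h : M.Mor I i o m) :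
    I.outs = o := by
  cases h <;> rfl

lemma Mor.unique {I : Instr} {i o : Tr Wire} {m m' : M.obj i ⟶ M.obj o} (h : M.Mor I i o m)
    (h' : M.Mor I i o m') : m = m' := by
  cases h <;> cases h' <;> rfl

variable (M) in
/-- The comparison between the objects carried by a wire and by its renaming. -/
def renWire (σ : ℕ → ℕ) : (w : Wire) → (M.ob w ⟶ M.ob (w.map σ))
  | .h _ => 𝟙 M.H | .a _ => 𝟙 M.A | .e _ => 𝟙 M.E

variable (M) in
/-- The comparison between the objects carried by a tree and by its renaming. -/
def ren (σ : ℕ → ℕ) : (t : Tr Wire) → (M.obj t ⟶ M.obj (t.map (Wire.map σ)))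
  | .one => 𝟙 (𝟙_ C)
  | .leaf w => M.renWire σ w
  | .node a b => ren σ a ⊗ₘ ren σ b

lemma eqToHom_tensorHom_eqToHom {X Y X' Y' : C} (h : X = X') (h' : Y = Y')
    (h'' : X ⊗ Y = X' ⊗ Y') : (eqToHom h ⊗ₘ eqToHom h') = eqToHom h'' := by
  subst h h'
  simp

lemma ren_isIso (σ : ℕ → ℕ) (t : Tr Wire) : IsIso (M.ren σ t) := by
  induction t with
  | one => exact inferInstanceAs (IsIso (𝟙 (𝟙_ C)))
  | leaf w => cases w <;> exact inferInstanceAs (IsIso (𝟙 _))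
  | node a b ha hb => exact inferInstanceAs (IsIso (_ ⊗ₘ _))

/-- A renaming that fixes the outer wires therefore leaves the interpretation of a program
unchanged, see `Sem.rename`. -/
lemma ren_eq_eqToHom (σ : ℕ → ℕ) (t : Tr Wire) (h : t.map (Wire.map σ) = t) :
    M.ren σ t = eqToHom (congrArg M.obj h.symm) := by
  induction t with
  | one => rfl
  | leaf w =>
    cases w <;> rfl
  | node a b ha hb =>
    obtain ⟨h₁, h₂⟩ : a.map (Wire.map σ) = a ∧ b.map (Wire.map σ) = b := by
      simpa [Tr.map] using h
    simp only [ren]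
    rw [ha h₁, hb h₂]
    exact eqToHom_tensorHom_eqToHom _ _ _

lemma id_tensorHom_id_comp {X Y Z : C} (m : X ⊗ Y ⟶ Z) : (𝟙 X ⊗ₘ 𝟙 Y) ≫ m = m ≫ 𝟙 Z := by
  simp

lemma id_comp_id_tensorHom {X Y Z : C} (m : Z ⟶ X ⊗ Y) : 𝟙 Z ≫ m = m ≫ (𝟙 X ⊗ₘ 𝟙 Y) := by
  simp

lemma Mor.map {I : Instr} {i o : Tr Wire} {m : M.obj i ⟶ M.obj o} (h : M.Mor I i o m)
    (σ : ℕ → ℕ) :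
    ∃ n, M.Mor (I.map σ) (i.map (Wire.map σ)) (o.map (Wire.map σ)) n ∧
      M.ren σ i ≫ n = m ≫ M.ren σ o := by
  cases h <;> refine ⟨_, by constructor, ?_⟩ <;>
    first
    | exact (Category.id_comp _).trans (Category.comp_id _).symm
    | exact id_tensorHom_id_comp _
    | exact id_comp_id_tensorHom _

end Interp

variable [SymmetricCategory C] {M : Interp C}

section

variable {X Y : C}

omit [SymmetricCategory C] in
lemma leftUnitor_tensorHom_naturality (m : X ⟶ Y) :
    (𝟙 (𝟙_ C) ⊗ₘ m) ≫ (λ_ Y).hom = (λ_ X).hom ≫ m := by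
  simp

omit [SymmetricCategory C] in
lemma leftUnitor_inv_tensorHom_naturality (m : X ⟶ Y) :
    m ≫ (λ_ Y).inv = (λ_ X).inv ≫ (𝟙 (𝟙_ C) ⊗ₘ m) := by
  simp

omit [SymmetricCategory C] in
lemma rightUnitor_tensorHom_naturality (m : X ⟶ Y) :
    (m ⊗ₘ 𝟙 (𝟙_ C)) ≫ (ρ_ Y).hom = (ρ_ X).hom ≫ m := by
  simp

omit [SymmetricCategory C] in
lemma rightUnitor_inv_tensorHom_naturality (m : X ⟶ Y) :
    m ≫ (ρ_ Y).inv = (ρ_ X).inv ≫ (m ⊗ₘ 𝟙 (𝟙_ C)) := by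
  simp

end

lemma Str.map {s t : Tr Wire} {m : M.obj s ⟶ M.obj t} (h : Str M.ob s t m) (σ : ℕ → ℕ) :
    ∃ n, Str M.ob (s.map (Wire.map σ)) (t.map (Wire.map σ)) n ∧
      M.ren σ s ≫ n = m ≫ M.ren σ t := by
  induction h with
  | id s => exact ⟨_, .id _, by simp⟩
  | comp _ _ h₁ h₂ =>
    obtain ⟨m₁, a₁, b₁⟩ := h₁
    obtain ⟨m₂, a₂, b₂⟩ := h₂
    exact ⟨_, a₁.comp a₂, by rw [reassoc_of% b₁, b₂, Category.assoc]⟩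
  | whiskerLeft r _ h =>
    obtain ⟨m₁, a₁, b₁⟩ := h
    refine ⟨_, a₁.whiskerLeft _, ?_⟩
    exact (tensorHom_comp_whiskerLeft _ _ _).trans
      ((congrArg _ b₁).trans (whiskerLeft_comp_tensorHom _ _ _).symm)
  | whiskerRight r _ h =>
    obtain ⟨m₁, a₁, b₁⟩ := h
    refine ⟨_, a₁.whiskerRight _, ?_⟩
    exact (tensorHom_comp_whiskerRight _ _ _).trans
      ((congrArg (· ⊗ₘ _) b₁).trans (whiskerRight_comp_tensorHom _ _ _).symm)
  | assoc a b c => exact ⟨_, .assoc _ _ _, associator_naturality _ _ _⟩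
  | assocInv a b c => exact ⟨_, .assocInv _ _ _, associator_inv_naturality _ _ _⟩
  | leftUnitor a => exact ⟨_, .leftUnitor _, leftUnitor_tensorHom_naturality _⟩
  | leftUnitorInv a => exact ⟨_, .leftUnitorInv _, leftUnitor_inv_tensorHom_naturality _⟩
  | rightUnitor a => exact ⟨_, .rightUnitor _, rightUnitor_tensorHom_naturality _⟩
  | rightUnitorInv a => exact ⟨_, .rightUnitorInv _, rightUnitor_inv_tensorHom_naturality _⟩
  | braid a b => exact ⟨_, .braid _ _, braiding_naturality _ _⟩

variable (M) in
/-- `Sem M s P t m`: the program `P` transforms the wires of `s` into those of `t`, and its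
interpretation is `m`. -/
inductive Sem : (s : Tr Wire) → List Instr → (t : Tr Wire) → (M.obj s ⟶ M.obj t) → Prop
  | nil {s t : Tr Wire} {m : M.obj s ⟶ M.obj t} : Str M.ob s t m → Sem s [] t m
  | cons {I : Instr} {i o s t r : Tr Wire} {P : List Instr} {p : M.obj s ⟶ M.obj (node i r)}
      {g : M.obj i ⟶ M.obj o} {m : M.obj (node o r) ⟶ M.obj t} :
      Str M.ob s (node i r) p → M.Mor I i o g → Sem (node o r) P t m →
      Sem s (I :: P) t (p ≫ g ▷ M.obj r ≫ m)

namespace Sem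

variable {s s' t t' r : Tr Wire} {P Q : List Instr}

lemma pre {q : M.obj s' ⟶ M.obj s} {m : M.obj s ⟶ M.obj t} (hq : Str M.ob s' s q)
    (h : Sem M s P t m) : Sem M s' P t (q ≫ m) := by
  cases h with
  | nil h => exact .nil (hq.comp h)
  | cons hp hg h =>
    rw [← Category.assoc]
    exact .cons (hq.comp hp) hg h

lemma append {m : M.obj s ⟶ M.obj t} {n : M.obj t ⟶ M.obj r} (h : Sem M s P t m)
    (h' : Sem M t Q r n) : Sem M s (P ++ Q) r (m ≫ n) := by
  induction h with
  | nil h => exact h'.pre h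
  | cons hp hg _ ih =>
    rw [Category.assoc, Category.assoc]
    exact .cons hp hg (ih h')

lemma post {q : M.obj t ⟶ M.obj t'} {m : M.obj s ⟶ M.obj t} (h : Sem M s P t m)
    (hq : Str M.ob t t' q) : Sem M s P t' (m ≫ q) := by
  simpa using h.append (.nil hq)

lemma exists_of_append {k : M.obj s ⟶ M.obj t} (h : Sem M s (P ++ Q) t k) :
    ∃ (r : Tr Wire) (m : M.obj s ⟶ M.obj r) (n : M.obj r ⟶ M.obj t),
      Sem M s P r m ∧ Sem M r Q t n ∧ k = m ≫ n := by
  induction P generalizing s with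
  | nil => exact ⟨_, _, _, .nil (.id s), h, by simp⟩
  | cons I P ih =>
    cases h with
    | cons hp hg h =>
      obtain ⟨r, m, n, a, b, rfl⟩ := ih h
      exact ⟨_, _, _, .cons hp hg a, b, by simp⟩

lemma whiskerRight {m : M.obj s ⟶ M.obj t} (h : Sem M s P t m) (r : Tr Wire) :
    Sem M (node s r) P (node t r) (m ▷ M.obj r) := by
  induction h with
  | nil h => exact .nil (h.whiskerRight r)
  | @cons I i o s t r' P p g m hp hg _ ih =>
    have := Sem.cons ((hp.whiskerRight r).comp (.assoc _ _ _)) hg (ih.pre (.assocInv _ _ _))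
    convert this using 1
    simp

lemma whiskerLeft_eq_braid_comp {X Y : C} (Z : C) (m : X ⟶ Y) :
    ((β_ Z X).hom ≫ m ▷ Z) ≫ (β_ Y Z).hom = Z ◁ m := by
  simp

omit [SymmetricCategory C] in
-- The operation `g` acts on Y while the spectators Z are rearranged by `k`; the two commute by the
-- interchange law.
lemma frame_exchange {X Y Z Z' V V' T : C} {p : X ⟶ Y ⊗ Z} {p' : X ⟶ Y ⊗ Z'} {k : Z ⟶ Z'}
    (g : Y ⟶ V) {m : V ⊗ Z ⟶ T} {m' : V ⊗ Z' ⟶ V'} {q : T ⟶ V'}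
    (hp : p ≫ Y ◁ k = p') (hq : m ≫ q = V ◁ k ≫ m') :
    (p ≫ g ▷ Z ≫ m) ≫ q = p' ≫ g ▷ Z' ≫ m' := by
  subst hp
  rw [Category.assoc, Category.assoc, Category.assoc, hq, whisker_exchange_assoc]

lemma whiskerLeft {m : M.obj s ⟶ M.obj t} (h : Sem M s P t m) (r : Tr Wire) :
    Sem M (node r s) P (node r t) (M.obj r ◁ m) := by
  have := ((h.whiskerRight r).pre (.braid _ _)).post (.braid _ _)
  convert this using 1
  exact (whiskerLeft_eq_braid_comp _ _).symm

/-- The wires which are consumed or produced when `P` is run from the wires `l` have distinct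
names. -/
def Good (l : List Wire) (P : List Instr) : Prop :=
  (l ++ P.flatMap fun I => I.outs.leaves).Nodup

instance (l : List Wire) (P : List Instr) : Decidable (Good l P) :=
  inferInstanceAs (Decidable (List.Nodup _))

lemma Good.nodup {l : List Wire} (h : Good l P) : l.Nodup :=
  (List.nodup_append.1 h).1

lemma Good.perm {l l' : List Wire} (h : Good l P) (hl : l.Perm l') : Good l' P :=
  ((hl.append_right _).nodup_iff).1 h

lemma Good.perm_right {l : List Wire} (h : Good l P) (hP : P.Perm Q) : Good l Q :=
  (((hP.flatMap_right _).append_left l).nodup_iff).1 h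

lemma Good.cons {I : Instr} {l : List Wire} (h : Good (I.ins.leaves ++ l) (I :: P)) :
    Good (I.outs.leaves ++ l) P := by
  unfold Good at h ⊢
  rw [List.flatMap_cons, List.append_assoc] at h
  have h := (List.nodup_append.1 h).2.1
  rw [← List.append_assoc] at h
  exact ((List.perm_append_comm.append_right _).nodup_iff).1 h

lemma Good.str {q : M.obj s ⟶ M.obj t} (h : Good s.leaves P) (hq : Str M.ob s t q) :
    Good t.leaves P := h.perm hq.perm

lemma Good.sem {m : M.obj s ⟶ M.obj t} (h : Good s.leaves (P ++ Q)) (hm : Sem M s P t m) :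
    Good t.leaves Q := by
  induction hm with
  | nil hq => exact h.perm hq.perm
  | cons hp hg _ ih =>
    apply ih
    obtain rfl := hg.ins_eq
    obtain rfl := hg.outs_eq
    exact Good.cons (h.str hp)

/-- Two runs of the same program have the same interpretation. -/
lemma deterministic {m : M.obj s ⟶ M.obj t} {m' : M.obj s ⟶ M.obj t'} (h : Sem M s P t m)
    (h' : Sem M s P t' m') (hs : Good s.leaves P) : ∃ q, Str M.ob t t' q ∧ m ≫ q = m' := by
  induction h generalizing t' with
  | nil h =>
    cases h' with
    | nil h' =>
      obtain ⟨n, a, b, -⟩ := h.exists_inv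
      exact ⟨_, a.comp h', by rw [reassoc_of% b]⟩
  | @cons I i o s t r P p g m hp hg h ih =>
    cases h' with
    | @cons _ i' o' _ _ r' _ p' g' m' hp' hg' h' =>
      obtain rfl := hg.ins_eq
      obtain rfl := hg'.ins_eq
      obtain rfl := hg.outs_eq
      obtain rfl := hg'.outs_eq
      obtain rfl := hg.unique hg'
      -- Both runs put the same inputs in front, so the spectators carry the same names in a
      -- possibly different arrangement. Coherence makes the two arrangements compatible.
      have e : r.leaves.Perm r'.leaves :=
        (List.perm_append_left_iff _).1 (hp.perm.symm.trans hp'.perm)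
      obtain ⟨k, hk⟩ := exists_str (ob := M.ob) e
      have e' := Str.unique (hp.comp (hk.whiskerLeft I.ins)) hp' hs.nodup
      obtain ⟨q, hq, eq⟩ := ih (h'.pre (hk.whiskerLeft I.outs)) (Good.cons (hs.str hp))
      exact ⟨q, hq, frame_exchange g e' eq⟩

end Sem
end WeakCleft

namespace WeakCleft

open Tr

variable {C : Type u} [Category.{v} C] [MonoidalCategory C] [SymmetricCategory C] {M : Interp C}

namespace Sem

variable {s s' t t' r : Tr Wire} {P Q : List Instr}

/-- The structural map that compares two runs preserves the names of the target wires, which are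
distinct, so it is the identity. -/
lemma unique {m m' : M.obj s ⟶ M.obj t} (h : Sem M s P t m) (h' : Sem M s P t m')
    (hs : Good s.leaves P) : m = m' := by
  obtain ⟨q, hq, rfl⟩ := h.deterministic h' hs
  have ht : t.leaves.Nodup := by
    have : Good s.leaves (P ++ []) := by simpa using hs
    exact (this.sem h).nodup
  rw [Str.unique hq (.id _) ht, Category.comp_id]

/-! #### Running programs on lists of wires -/

/-- The wires which result from running a program, if this is possible. -/
def exec (l : List Wire) : List Instr → Option (List Wire)
  | [] => some l
  | I :: P =>
    -- The test says that all inputs are available in `l`; `diff` removes them.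
    if l.Perm (I.ins.leaves ++ l.diff I.ins.leaves) then
      exec (I.outs.leaves ++ l.diff I.ins.leaves) P
    else none

lemma exists_of_exec {l l' : List Wire} (h : exec l P = some l') (hs : s.leaves.Perm l) :
    ∃ (t : Tr Wire) (m : M.obj s ⟶ M.obj t), Sem M s P t m ∧ t.leaves.Perm l' := by
  induction P generalizing s l with
  | nil =>
    obtain rfl : l = l' := by simpa [exec] using h
    exact ⟨s, _, .nil (.id s), hs⟩
  | cons I P ih =>
    rw [exec] at h
    split at h
    · rename_i hl
      obtain ⟨p, hp⟩ := exists_str (ob := M.ob) (s := s)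
        (t := node I.ins (ofList (l.diff I.ins.leaves))) (by simpa using hs.trans hl)
      obtain ⟨g, hg⟩ := Interp.exists_mor (M := M) I
      obtain ⟨t, m, hm, ht⟩ := ih (s := node I.outs (ofList (l.diff I.ins.leaves))) h (by simp)
      exact ⟨t, _, .cons hp hg hm, ht⟩
    · simp at h

lemma exists_of_exec_perm {l : List Wire} (h : exec s.leaves P = some l)
    (ht : l.Perm t.leaves) : ∃ m, Sem M s P t m := by
  obtain ⟨t', m, hm, h'⟩ := exists_of_exec (M := M) h (List.Perm.refl _)
  obtain ⟨q, hq⟩ := exists_str (ob := M.ob) (h'.trans ht)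
  exact ⟨_, hm.post hq⟩

lemma perm_of_exec {l : List Wire} {m : M.obj s ⟶ M.obj t} (hm : Sem M s P t m)
    (hs : Good s.leaves P) (h : exec s.leaves P = some l) : t.leaves.Perm l := by
  obtain ⟨t', m', hm', h'⟩ := exists_of_exec (M := M) h (List.Perm.refl _)
  obtain ⟨q, hq, -⟩ := hm.deterministic hm' hs
  exact hq.perm.trans h'

/-! #### Reordering -/

lemma ins_subset {m : M.obj s ⟶ M.obj t} (hm : Sem M s P t m) {I : Instr} (hI : I ∈ P)
    {w : Wire} (hw : w ∈ I.ins.leaves) :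
    w ∈ s.leaves ++ P.flatMap fun I => I.outs.leaves := by
  induction hm with
  | nil => simp at hI
  | @cons J i o s t r P p g m hp hg _ ih =>
    obtain rfl := hg.ins_eq
    obtain rfl := hg.outs_eq
    rcases List.mem_cons.1 hI with rfl | hI
    · exact List.mem_append_left _ (hp.perm.symm.subset (by simp [hw]))
    · have := ih hI
      simp only [leaves_node, List.append_assoc, List.mem_append] at this
      simp only [List.flatMap_cons, List.mem_append]
      rcases this with h | h | h
      · exact Or.inr (Or.inl h)
      · exact Or.inl (hp.perm.symm.subset (by simp [h]))
      · exact Or.inr (Or.inr h)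

section

variable {X Y Z V : C}

/-- The isomorphism `X ⊗ Y ⊗ Z ⟶ Y ⊗ X ⊗ Z`. -/
def midSwap (X Y Z : C) : X ⊗ Y ⊗ Z ⟶ Y ⊗ X ⊗ Z :=
  (α_ X Y Z).inv ≫ (β_ X Y).hom ▷ Z ≫ (α_ Y X Z).hom

lemma midSwap_midSwap : midSwap X Y Z ≫ midSwap Y X Z = 𝟙 _ := by
  simp only [midSwap, Category.assoc, Iso.hom_inv_id_assoc, ← comp_whiskerRight_assoc,
    SymmetricCategory.symmetry, id_whiskerRight, Category.id_comp, Iso.inv_hom_id]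

lemma midSwap_naturality_middle (f : Y ⟶ V) :
    X ◁ f ▷ Z ≫ midSwap X V Z = midSwap X Y Z ≫ f ▷ (X ⊗ Z) := by
  simp only [midSwap, Category.assoc]
  rw [associator_inv_naturality_middle_assoc, ← comp_whiskerRight_assoc,
    braiding_naturality_right, comp_whiskerRight_assoc, associator_naturality_left]

lemma str_midSwap (a b c : Tr Wire) :
    Str M.ob (node a (node b c)) (node b (node a c)) (midSwap (M.obj a) (M.obj b) (M.obj c)) :=
  (Str.assocInv a b c).comp (((Str.braid a b).whiskerRight c).comp (.assoc b a c))

lemma exchange {S R R₂ T X' Y' K : C} {p : S ⟶ X ⊗ R} {k : R ⟶ Y ⊗ K} (f : X ⟶ X') (g : Y ⟶ Y')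
    {q : X' ⊗ R ⟶ Y ⊗ R₂} {e : X' ⊗ K ⟶ R₂} {n : Y' ⊗ R₂ ⟶ T}
    (hq : q = (X' ◁ k ≫ midSwap X' Y K) ≫ Y ◁ e) :
    (p ≫ X ◁ k ≫ midSwap X Y K) ≫ g ▷ (X ⊗ K) ≫ (midSwap Y' X K ≫ f ▷ (Y' ⊗ K) ≫
      (midSwap X' Y' K ≫ Y' ◁ e) ≫ n) = p ≫ f ▷ R ≫ q ≫ g ▷ R₂ ≫ n := by
  subst hq
  simp only [Category.assoc]
  rw [← reassoc_of% (midSwap_naturality_middle g), reassoc_of% (midSwap_midSwap (X := X) (Y := Y'))]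
  simp only [whisker_exchange_assoc]
  rw [reassoc_of% (midSwap_naturality_middle g)]

end

/-- If the inputs of both operations are present at the start, the operations act on disjoint tensor
factors and the interchange law applies. -/
lemma swap {I J : Instr} {a : Tr Wire} {m : M.obj s ⟶ M.obj t} (hm : Sem M s (J :: I :: P) t m)
    (hs : Good s.leaves (J :: I :: P))
    (ha : s.leaves.Perm (J.ins.leaves ++ (I.ins.leaves ++ a.leaves))) :
    Sem M s (I :: J :: P) t m := by
  cases hm with
  | @cons _ i o _ _ r _ p g m hp hg h =>
    obtain rfl := hg.ins_eq
    obtain rfl := hg.outs_eq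
    have hs' := Good.cons (hs.str hp)
    cases h with
    | @cons _ i' o' _ _ r' _ p' g' m' hp' hg' h' =>
      obtain rfl := hg'.ins_eq
      obtain rfl := hg'.outs_eq
      have hr : r.leaves.Perm (I.ins.leaves ++ a.leaves) :=
        (List.perm_append_left_iff _).1 (hp.perm.symm.trans ha)
      have hr' : (node J.outs a).leaves.Perm r'.leaves := by
        refine (List.perm_append_left_iff I.ins.leaves).1 (List.Perm.trans ?_ hp'.perm)
        refine List.Perm.trans ?_ (hr.symm.append_left _)
        simp only [leaves_node, ← List.append_assoc]
        exact List.perm_append_comm.append_right _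
      obtain ⟨k, hk⟩ := exists_str (ob := M.ob) (s := r) (t := node I.ins a) hr
      obtain ⟨e, he⟩ := exists_str (ob := M.ob) hr'
      have eq := Str.unique hp' (((hk.whiskerLeft J.outs).comp (str_midSwap _ _ _)).comp
        (he.whiskerLeft I.ins)) hs'.nodup
      have := Sem.cons (hp.comp ((hk.whiskerLeft _).comp (str_midSwap _ _ _))) hg'
        (.cons (str_midSwap _ _ _) hg (h'.pre ((str_midSwap _ _ _).comp (he.whiskerLeft _))))
      exact (exchange g g' eq) ▸ this

/-- An operation whose inputs are all present at the start depends on none of the operations before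
it, and moves to the front by successive swaps. -/
lemma bubble {I : Instr} {P₁ P₂ : List Instr} {l : List Wire} {m : M.obj s ⟶ M.obj t}
    (hm : Sem M s (P₁ ++ I :: P₂) t m) (hs : Good s.leaves (P₁ ++ I :: P₂))
    (hl : s.leaves.Perm (I.ins.leaves ++ l)) : Sem M s (I :: (P₁ ++ P₂)) t m := by
  induction P₁ generalizing s l with
  | nil => exact hm
  | cons J P₁ ih =>
    cases hm with
    | @cons _ i o _ _ r _ p g m hp hg h =>
      obtain rfl := hg.ins_eq
      obtain rfl := hg.outs_eq
      have hn : (I.ins.leaves ++ l).Nodup := hl.nodup_iff.1 hs.nodup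
      have hs₁ := hs.str hp
      -- An input of `I` consumed by `J` would have to be produced again before `I`, against the
      -- distinctness of all names.
      have hsub : I.ins.leaves ⊆ r.leaves := by
        intro w hw
        have h₁ := hp.perm.subset (hl.symm.subset (List.mem_append_left _ hw))
        rcases List.mem_append.1 h₁ with h₁ | h₁
        · have h₂ := h.ins_subset (I := I) (by simp) hw
          unfold Good at hs₁
          simp only [List.cons_append, List.flatMap_cons, leaves_node, List.append_assoc] at hs₁ h₂
          refine absurd rfl ((List.nodup_append.1 hs₁).2.2 w h₁ w ?_)
          simp only [List.mem_append] at h₂ ⊢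
          tauto
        · exact h₁
      obtain ⟨a', ha₁, ha₂⟩ := List.subperm_of_subset (List.nodup_append.1 hn).1 hsub
      obtain ⟨a, ha₃⟩ := ha₂.exists_perm_append
      have ha := ha₃.trans (ha₁.append_right a)
      have hJ : s.leaves.Perm (J.ins.leaves ++ (I.ins.leaves ++ a)) :=
        hp.perm.trans (ha.append_left _)
      have := ih h (Good.cons hs₁) (l := J.outs.leaves ++ a) (by
        refine (ha.append_left _).trans ?_
        simp only [← List.append_assoc]
        exact List.perm_append_comm.append_right _)
      exact (Sem.cons hp hg this).swap (hs.perm_right (List.Perm.cons J List.perm_middle))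
        (a := ofList a) (by simpa using hJ)

/-- The interpretation of a program does not depend on the order of its operations. -/
lemma reorder {l : List Wire} {m : M.obj s ⟶ M.obj t} (hm : Sem M s P t m)
    (hs : Good s.leaves P) (hP : P.Perm Q) (hQ : (exec l Q).isSome) (hl : s.leaves.Perm l) :
    Sem M s Q t m := by
  induction Q generalizing s P l with
  | nil => rwa [hP.eq_nil] at hm
  | cons I Q ih =>
    -- The first operation of the new order is runnable from the start, so it can be brought to the
    -- front of the old order; then recursion.
    obtain ⟨P₁, P₂, rfl⟩ := List.append_of_mem (hP.symm.subset (List.mem_cons_self))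
    rw [exec] at hQ
    split at hQ
    · rename_i h
      have h₁ := hm.bubble hs (hl.trans h)
      have hP' : (P₁ ++ P₂).Perm Q := (List.perm_cons I).1 (List.perm_middle.symm.trans hP)
      cases h₁ with
      | @cons _ i o _ _ r _ p g m hp hg h' =>
        obtain rfl := hg.ins_eq
        obtain rfl := hg.outs_eq
        have hr := (List.perm_append_left_iff _).1 (hp.perm.symm.trans (hl.trans h))
        exact .cons hp hg (ih h' (Good.cons ((hs.perm_right List.perm_middle).str hp)) hP' hQ
          (hr.append_left _))
    · simp at hQ

/-! #### Replacing, renaming and removing operations -/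

/-- After `P₁` the wires split into the source of `L` and spectators. By determinism the run of `L`
is its interpretation whiskered with the spectators, up to a structural isomorphism, so `L'` can
take its place. -/
lemma replace {A B : Tr Wire} {L L' P₁ P₂ : List Instr} {l l' : List Wire}
    {m : M.obj s ⟶ M.obj t} {k : M.obj A ⟶ M.obj B} (hm : Sem M s (P₁ ++ (L ++ P₂)) t m)
    (hs : Good s.leaves (P₁ ++ (L ++ P₂))) (hL : Sem M A L B k) (hL' : Sem M A L' B k)
    (h₁ : exec s.leaves P₁ = some l) (hl : l.Perm (A.leaves ++ l')) :
    Sem M s (P₁ ++ (L' ++ P₂)) t m := by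
  obtain ⟨r, m₁, n, a, b, rfl⟩ := hm.exists_of_append
  have hr := hs.sem a
  have hs₁ : Good s.leaves P₁ := by
    unfold Good at hs ⊢
    rw [List.flatMap_append, ← List.append_assoc] at hs
    exact (List.nodup_append.1 hs).1
  have e := (a.perm_of_exec hs₁ h₁).trans hl
  obtain ⟨q, hq⟩ := exists_str (ob := M.ob) (s := r) (t := node A (ofList l')) (by simpa using e)
  have hr₁ : Good r.leaves L := by
    unfold Good at hr ⊢
    rw [List.flatMap_append, ← List.append_assoc] at hr
    exact (List.nodup_append.1 hr).1
  obtain ⟨r₁, n₁, n₂, a₁, b₁, rfl⟩ := b.exists_of_append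
  obtain ⟨j, hj, eq⟩ := a₁.deterministic ((hL.whiskerRight (ofList l')).pre hq) hr₁
  obtain ⟨j', hj', e₁, -⟩ := hj.exists_inv
  have := ((hL'.whiskerRight (ofList l')).pre hq).append (b₁.pre hj')
  rw [← eq, Category.assoc, reassoc_of% e₁] at this
  exact a.append this

omit [MonoidalCategory C] [SymmetricCategory C] in
lemma comp_square₃ {X₁ X₂ X₃ X₄ Y₁ Y₂ Y₃ Y₄ : C} {a : X₁ ⟶ Y₁} {b : X₂ ⟶ Y₂} {c : X₃ ⟶ Y₃}
    {d : X₄ ⟶ Y₄} {p : X₁ ⟶ X₂} {p' : Y₁ ⟶ Y₂} {g : X₂ ⟶ X₃} {g' : Y₂ ⟶ Y₃} {m : X₃ ⟶ X₄}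
    {m' : Y₃ ⟶ Y₄} (h₁ : a ≫ p' = p ≫ b) (h₂ : b ≫ g' = g ≫ c) (h₃ : c ≫ m' = m ≫ d) :
    a ≫ p' ≫ g' ≫ m' = (p ≫ g ≫ m) ≫ d := by
  rw [reassoc_of% h₁, reassoc_of% h₂, h₃, Category.assoc, Category.assoc]

lemma map {m : M.obj s ⟶ M.obj t} (hm : Sem M s P t m) (σ : ℕ → ℕ) :
    ∃ n, Sem M (s.map (Wire.map σ)) (P.map (Instr.map σ)) (t.map (Wire.map σ)) n ∧
      M.ren σ s ≫ n = m ≫ M.ren σ t := by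
  induction hm with
  | nil h =>
    obtain ⟨n, a, b⟩ := h.map σ
    exact ⟨_, .nil a, b⟩
  | @cons I i o s t r P p g m hp hg _ ih =>
    obtain ⟨p', a₁, b₁⟩ := hp.map σ
    obtain ⟨g', a₂, b₂⟩ := hg.map σ
    obtain ⟨m', a₃, b₃⟩ := ih
    refine ⟨_, .cons a₁ a₂ a₃, ?_⟩
    exact comp_square₃ b₁ ((tensorHom_comp_whiskerRight _ _ _).trans
      ((congrArg (· ⊗ₘ _) b₂).trans (whiskerRight_comp_tensorHom _ _ _).symm)) b₃

lemma of_eqToHom {s' t' : Tr Wire} (hs : s' = s) (ht : t' = t) {m : M.obj s ⟶ M.obj t}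
    {n : M.obj s' ⟶ M.obj t'} (hn : Sem M s' P t' n)
    (e : eqToHom (congrArg M.obj hs.symm) ≫ n = m ≫ eqToHom (congrArg M.obj ht.symm)) :
    Sem M s P t m := by
  subst hs ht
  simp only [eqToHom_refl, Category.id_comp, Category.comp_id] at e
  exact e ▸ hn

lemma rename {m : M.obj s ⟶ M.obj t} (hm : Sem M s P t m) (σ : ℕ → ℕ)
    (hs : s.map (Wire.map σ) = s) (ht : t.map (Wire.map σ) = t) :
    Sem M s (P.map (Instr.map σ)) t m := by
  obtain ⟨n, a, b⟩ := hm.map σ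
  rw [Interp.ren_eq_eqToHom σ s hs, Interp.ren_eq_eqToHom σ t ht] at b
  exact a.of_eqToHom hs ht b

/-- Identity operations between a wire and itself. -/
def isTrivial : Instr → Bool
  | .idH x y => x == y
  | .idA x y => x == y
  | .idE x y => x == y
  | _ => false

omit [SymmetricCategory C] in
lemma _root_.WeakCleft.Interp.Mor.eq_of_isTrivial {I : Instr} {i o : Tr Wire}
    {g : M.obj i ⟶ M.obj o} (hg : M.Mor I i o g) (hI : isTrivial I = true) :
    (⟨o, g⟩ : Σ o : Tr Wire, (M.obj i ⟶ M.obj o)) = ⟨i, 𝟙 _⟩ := by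
  cases hg <;> simp only [isTrivial, beq_iff_eq, Bool.false_eq_true] at hI <;> subst hI <;> rfl

lemma filter {m : M.obj s ⟶ M.obj t} (hm : Sem M s P t m) :
    Sem M s (P.filter fun I => !isTrivial I) t m := by
  induction hm with
  | nil h => exact .nil h
  | @cons I i o s t r P p g m hp hg _ ih =>
    by_cases hI : isTrivial I = true
    · rw [List.filter_cons_of_neg (by simp [hI])]
      cases hg.eq_of_isTrivial hI
      simpa using ih.pre hp
    · rw [List.filter_cons_of_pos (by simpa using hI)]
      exact .cons hp hg ih

end Sem

end WeakCleft

namespace WeakCleft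

open Tr

/-! ### Rewriting of programs -/

namespace Instr

/-- A number which identifies the kind of an operation. -/
def code : Instr → ℕ
  | idH _ _ => 0 | idA _ _ => 1 | idE _ _ => 2 | mul _ _ _ => 3 | .one _ => 4 | com _ _ _ => 5
  | eps _ => 6 | ant _ _ => 7 | piL _ _ => 8 | piR _ _ => 9 | mulA _ _ _ => 10 | oneA _ => 11
  | act _ _ _ => 12 | u _ _ => 13 | f _ _ _ => 14 | g _ _ _ => 15 | inc _ _ _ => 16
  | prj _ _ _ => 17

/-- The names of the wires of an operation. -/
def args : Instr → List ℕ
  | idH x y => [x, y] | idA x y => [x, y] | idE x y => [x, y] | mul x y z => [x, y, z]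
  | .one x => [x] | com x y z => [x, y, z] | eps x => [x] | ant x y => [x, y]
  | piL x y => [x, y] | piR x y => [x, y] | mulA x y z => [x, y, z] | oneA x => [x]
  | act x y z => [x, y, z] | u x y => [x, y] | f x y z => [x, y, z] | g x y z => [x, y, z]
  | inc x y z => [x, y, z] | prj x y z => [x, y, z]

end Instr

/-- The name of a wire. -/
def Wire.name : Wire → ℕ
  | h n => n | a n => n | e n => n

/-- Partial renamings. -/
abbrev Subst := List (ℕ × ℕ)

namespace Subst

/-- The renaming which is the identity where the partial renaming is not defined. -/
def toFun (σ : Subst) (x : ℕ) : ℕ := (σ.lookup x).getD x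

/-- Extend a partial renaming so that it maps the first list to the second. -/
def matchArgs (σ : Subst) : List ℕ → List ℕ → Option Subst
  | x :: xs, y :: ys =>
    match σ.lookup x with
    | some z => if z == y then matchArgs σ xs ys else none
    | none => matchArgs ((x, y) :: σ) xs ys
  | _, _ => some σ

/-- Match an operation with an operation of the program which shares one of its known wires. -/
def matchInstr (σ : Subst) (I : Instr) (P : List Instr) : Option Subst :=
  P.findSome? fun J =>
    if I.code == J.code && (I.args.zip J.args).any (fun p => σ.lookup p.1 == some p.2) then
      matchArgs σ I.args J.args
    else none

/-- Match each of the operations of a pattern once; return also the operations not matched. -/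
def matchPass (P : List Instr) : Subst → List Instr → Subst × List Instr
  | σ, [] => (σ, [])
  | σ, I :: L =>
    match matchInstr σ I P with
    | some σ' => matchPass P σ' L
    | none => ((matchPass P σ L).1, I :: (matchPass P σ L).2)

/-- Match a pattern with a program. -/
def matchAll (P : List Instr) : ℕ → Subst → List Instr → Subst
  | 0, σ, _ => σ
  | n + 1, σ, L =>
    match matchPass P σ L with
    | (σ', []) => σ'
    | (σ', L') => matchAll P n σ' L'

/-- Give new names to the wires on which the partial renaming is not defined. -/
def fresh : Subst → ℕ → List ℕ → Subst
  | σ, _, [] => σ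
  | σ, n, x :: l =>
    match σ.lookup x with
    | some _ => fresh σ n l
    | none => fresh ((x, n) :: σ) (n + 1) l

end Subst

/-- A diagrammatic equation: two programs with the same source and target. -/
structure Rule where
  /-- The source. -/
  src : Tr Wire
  /-- The left hand side. -/
  lhs : List Instr
  /-- The right hand side. -/
  rhs : List Instr
  /-- The target. -/
  tgt : Tr Wire

namespace Rule

/-- The reversed equation. -/
def symm (R : Rule) : Rule := ⟨R.src, R.rhs, R.lhs, R.tgt⟩

/-- One more than the largest name in a program. -/
def bound (P : List Instr) : ℕ :=
  P.foldl (fun n I => I.args.foldl (fun n x => max n (x + 1)) n) 0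

/-- The operations which depend on the given wires, or not. -/
def split : List Wire → List Instr → List Instr × List Instr
  | _, [] => ([], [])
  | l, I :: P =>
    if I.ins.leaves.any (l.contains ·) then
      ((split (I.outs.leaves ++ l) P).1, I :: (split (I.outs.leaves ++ l) P).2)
    else (I :: (split l P).1, (split l P).2)

/-- The renaming which identifies the two wires of an identity operation. -/
def idSubst (s t : Tr Wire) : Instr → Option Subst
  | .idH x y => if x == y then none else if !t.leaves.contains (.h y) then some [(y, x)]
      else if !s.leaves.contains (.h x) then some [(x, y)] else none
  | .idA x y => if x == y then none else if !t.leaves.contains (.a y) then some [(y, x)]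
      else if !s.leaves.contains (.a x) then some [(x, y)] else none
  | .idE x y => if x == y then none else if !t.leaves.contains (.e y) then some [(y, x)]
      else if !s.leaves.contains (.e x) then some [(x, y)] else none
  | _ => none

/-- Remove the identity operations. -/
def removeIds (s t : Tr Wire) : ℕ → List Instr → List Instr
  | 0, P => P
  | n + 1, P =>
    match P.findSome? (idSubst s t) with
    | some σ =>
      if s.map (Wire.map σ.toFun) = s ∧ t.map (Wire.map σ.toFun) = t then
        removeIds s t n ((P.map (Instr.map σ.toFun)).filter fun I => !Sem.isTrivial I)
      else P
    | none => P

/-- Replace `L` by `L'` in the program `P`, where `P` is to be reordered as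
`P₁ ++ (L ++ P₂)`. -/
def replace (s A : Tr Wire) (P P₁ L L' P₂ : List Instr) : Option (List Instr) :=
  if Sem.Good s.leaves P ∧ P.Perm (P₁ ++ (L ++ P₂)) ∧
      (Sem.exec s.leaves (P₁ ++ (L ++ P₂))).isSome = true then
    match Sem.exec s.leaves P₁ with
    | some l =>
      if l.Perm (A.leaves ++ l.diff A.leaves) then some (P₁ ++ (L' ++ P₂)) else none
    | none => none
  else none

/-- The partial renaming given by the position at which an equation is to be applied: the first wire
of the first operation of its left hand side. -/
def anchor (R : Rule) (n : ℕ) (P : List Instr) : Option Subst :=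
  match R.lhs with
  | [] => none
  | I :: _ =>
    P.findSome? fun J =>
      if I.code == J.code && J.args.head? == some n then some (I.args.zip J.args) else none

/-- Apply the equation `R` from left to right at the wire `n`. -/
def apply (s t : Tr Wire) (P : List Instr) (R : Rule) (n : ℕ) : Option (List Instr) :=
  match R.anchor n P with
  | none => none
  | some σ₀ =>
    let σ := (Subst.matchAll P R.lhs.length σ₀ R.lhs).fresh (bound P) (R.rhs.flatMap Instr.args)
    let L := R.lhs.map (Instr.map σ.toFun)
    let P' := split (L.flatMap fun I => I.outs.leaves) (P.filter fun I => !L.contains I)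
    match replace s (R.src.map (Wire.map σ.toFun)) P P'.1 L (R.rhs.map (Instr.map σ.toFun)) P'.2 with
    | none => none
    | some Q => some (removeIds s t Q.length Q)

/-- Apply a sequence of equations. -/
def run (s t : Tr Wire) : List Instr → List (Rule × ℕ) → Option (List Instr)
  | P, [] => some P
  | P, (R, n) :: c =>
    match apply s t P R n with
    | none => none
    | some Q => run s t Q c

/-- Test whether a program is well formed. -/
def valid (s t : Tr Wire) (P : List Instr) : Bool :=
  match Sem.exec s.leaves P with
  | some l => decide (Sem.Good s.leaves P ∧ l.Perm t.leaves)
  | none => false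

/-- Test whether two programs agree up to the order of the operations and the names of the inner
wires. -/
def alpha (s t : Tr Wire) (P Q : List Instr) : Bool :=
  let σ₀ : Subst := (s.leaves ++ t.leaves).map fun w => (w.name, w.name)
  let σ := Subst.matchAll Q P.length σ₀ P
  decide (s.map (Wire.map σ.toFun) = s ∧ t.map (Wire.map σ.toFun) = t ∧
    Sem.Good s.leaves (P.map (Instr.map σ.toFun)) ∧ Sem.Good s.leaves Q ∧
    (P.map (Instr.map σ.toFun)).Perm Q ∧ (Sem.exec s.leaves Q).isSome = true)

/-- Test whether the two sides of an equation become equal after application of two sequences of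
equations. -/
def check (R : Rule) (c c' : List (Rule × ℕ)) : Bool :=
  valid R.src R.tgt R.lhs && valid R.src R.tgt R.rhs &&
    match run R.src R.tgt R.lhs c, run R.src R.tgt R.rhs c' with
    | some P, some Q => alpha R.src R.tgt P Q
    | _, _ => false

variable {C : Type u} [Category.{v} C] [MonoidalCategory C] [SymmetricCategory C]

/-- The equation holds in the interpretation `M`. -/
class Holds (M : Interp C) (R : Rule) : Prop where
  sound : ∃ m, Sem M R.src R.lhs R.tgt m ∧ Sem M R.src R.rhs R.tgt m

/-- The equations of a sequence hold in the interpretation `M`. -/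
class AllHold (M : Interp C) (c : List (Rule × ℕ)) : Prop where
  sound : ∀ p ∈ c, p.1.Holds M

variable {M : Interp C}

instance : AllHold M [] := ⟨by simp⟩

instance (R : Rule) (n : ℕ) (c : List (Rule × ℕ)) [R.Holds M] [AllHold M c] :
    AllHold M ((R, n) :: c) :=
  ⟨by simpa using ⟨‹R.Holds M›, fun a b => AllHold.sound (a, b)⟩⟩

instance (R : Rule) [h : R.Holds M] : R.symm.Holds M := by
  obtain ⟨m, h₁, h₂⟩ := h
  exact ⟨m, h₂, h₁⟩

variable {s t : Tr Wire} {m : M.obj s ⟶ M.obj t}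

lemma sem_removeIds (n : ℕ) {P : List Instr} (hm : Sem M s P t m) :
    Sem M s (removeIds s t n P) t m := by
  induction n generalizing P with
  | zero => exact hm
  | succ n ih =>
    rw [removeIds]
    split
    · split
      · rename_i h
        exact ih (hm.rename _ h.1 h.2).filter
      · exact hm
    · exact hm

/-- The renaming need not be injective: the interpretation depends only on the kinds of the wires,
and the comparison `ren` is invertible. -/
lemma Holds.rename (R : Rule) [h : R.Holds M] (σ : ℕ → ℕ) :
    ∃ m, Sem M (R.src.map (Wire.map σ)) (R.lhs.map (Instr.map σ)) (R.tgt.map (Wire.map σ)) m ∧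
      Sem M (R.src.map (Wire.map σ)) (R.rhs.map (Instr.map σ)) (R.tgt.map (Wire.map σ)) m := by
  obtain ⟨m, h₁, h₂⟩ := h
  obtain ⟨n₁, a₁, b₁⟩ := h₁.map σ
  obtain ⟨n₂, a₂, b₂⟩ := h₂.map σ
  have := Interp.ren_isIso (M := M) σ R.src
  obtain rfl : n₁ = n₂ := by rw [← cancel_epi (M.ren σ R.src), b₁, b₂]
  exact ⟨_, a₁, a₂⟩

/-- Nothing is assumed about the search for a match. The conditions tested by `Rule.replace` suffice
for soundness, whichever renaming was found. -/
lemma sem_apply {P Q : List Instr} (R : Rule) [R.Holds M] {n : ℕ} (hm : Sem M s P t m)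
    (h : apply s t P R n = some Q) : Sem M s Q t m := by
  unfold apply at h
  split at h
  · simp at h
  · dsimp only at h
    split at h
    · simp at h
    · rename_i Q' h'
      obtain rfl := Option.some.inj h
      apply sem_removeIds
      unfold replace at h'
      split at h'
      · rename_i hs
        split at h'
        · rename_i h₁
          split at h'
          · rename_i hl
            obtain rfl := Option.some.inj h'
            obtain ⟨k, hL, hL'⟩ := Holds.rename (M := M) R
              (Subst.toFun (Subst.fresh (Subst.matchAll P R.lhs.length _ R.lhs) (bound P)
                (R.rhs.flatMap Instr.args)))
            exact (hm.reorder hs.1 hs.2.1 hs.2.2 (List.Perm.refl _)).replace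
              (hs.1.perm_right hs.2.1) hL hL' h₁ hl
          · simp at h'
        · simp at h'
      · simp at h'

lemma sem_run {P Q : List Instr} {c : List (Rule × ℕ)} [hc : AllHold M c] (hm : Sem M s P t m)
    (h : run s t P c = some Q) : Sem M s Q t m := by
  obtain ⟨hc⟩ := hc
  induction c generalizing P with
  | nil =>
    obtain rfl := Option.some.inj h
    exact hm
  | cons p c ih =>
    rw [run] at h
    have := hc p List.mem_cons_self
    split at h
    · simp at h
    · rename_i h'
      exact ih (sem_apply p.1 hm h') h fun q hq => hc q (List.mem_cons_of_mem _ hq)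

lemma exists_sem {P : List Instr} (h : valid s t P = true) : ∃ m, Sem M s P t m := by
  unfold valid at h
  split at h
  · rename_i h'
    exact Sem.exists_of_exec_perm h' (of_decide_eq_true h).2
  · simp at h

lemma sem_alpha {P Q : List Instr} (hm : Sem M s P t m) (h : alpha s t P Q = true) :
    Sem M s Q t m := by
  obtain ⟨h₁, h₂, h₃, -, h₄, h₅⟩ := of_decide_eq_true h
  exact (hm.rename _ h₁ h₂).reorder h₃ h₄ h₅ (List.Perm.refl _)

/-- An equation holds if its two sides can be rewritten to the same program. -/
lemma derive {R : Rule} (c c' : List (Rule × ℕ)) [AllHold M c] [AllHold M c']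
    (h : R.check c c' = true) : R.Holds M := by
  unfold check at h
  rw [Bool.and_eq_true, Bool.and_eq_true] at h
  obtain ⟨⟨h₁, h₂⟩, h₃⟩ := h
  obtain ⟨m, hm⟩ := exists_sem (M := M) h₁
  obtain ⟨m', hm'⟩ := exists_sem (M := M) h₂
  split at h₃
  · rename_i P Q hP hQ
    have a := sem_alpha (sem_run hm hP) h₃
    have b := sem_run hm' hQ
    obtain ⟨-, -, -, h₃, -⟩ := of_decide_eq_true h₃
    obtain rfl := a.unique b h₃
    exact ⟨m, hm, hm'⟩
  · simp at h₃

end Rule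

end WeakCleft

namespace WeakCleft

open Tr

/-! ### Translation of morphisms into programs -/

/-- A wire which carries `H`. -/
abbrev hw (n : ℕ) : Tr Wire := leaf (.h n)
/-- A wire which carries `A`. -/
abbrev aw (n : ℕ) : Tr Wire := leaf (.a n)
/-- A wire which carries `E`. -/
abbrev ew (n : ℕ) : Tr Wire := leaf (.e n)

infixr:70 " ⊠ " => Tr.node

section Seg

variable {C : Type u} [Category.{v} C] [MonoidalCategory C]

/-- The tree `t` carries the object `X`. -/
class IsObj (M : Interp C) (t : Tr Wire) (X : outParam C) : Prop where
  eq : M.obj t = X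

variable [SymmetricCategory C]

/-- The first operations of the program `P` transform `s` into `t`, their interpretation is `m`, and
`Q` is the remaining part of `P`. -/
class Seg (M : Interp C) (s : Tr Wire) (P : List Instr) (Q : outParam (List Instr))
    (t : outParam (Tr Wire)) {X Y : C} (m : X ⟶ Y) : Prop where
  sound : ∃ (hX : M.obj s = X) (hY : M.obj t = Y) (P' : List Instr), P = P' ++ Q ∧
    Sem M s P' t (eqToHom hX ≫ m ≫ eqToHom hY.symm)

namespace Seg

variable {M : Interp C} {a b c d s s' t t' r : Tr Wire} {P Q R : List Instr} {X Y Z V X' Y' : C}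

lemma of_str {m : M.obj s ⟶ M.obj t} (h : Str M.ob s t m) : Seg M s P P t m :=
  ⟨rfl, rfl, [], rfl, by simpa using .nil h⟩

lemma of_mor {I : Instr} {m : M.obj s ⟶ M.obj t} (h : M.Mor I s t m) :
    Seg M s (I :: P) P t m := by
  refine ⟨rfl, rfl, [I], rfl, ?_⟩
  have := (Sem.cons (.rightUnitorInv _) h (.nil (.rightUnitor _)))
  convert this using 1
  simp

instance {m : X ⟶ Y} {n : Y ⟶ Z} [h : Seg M s P Q t m] [h' : Seg M t Q R r n] :
    Seg M s P R r (m ≫ n) := by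
  obtain ⟨hX, hY, P₁, rfl, h⟩ := h
  obtain ⟨hY', hZ, P₂, rfl, h'⟩ := h'
  subst hX hY hZ
  exact ⟨rfl, rfl, P₁ ++ P₂, by simp, by simpa using h.append h'⟩

instance {m : X ⟶ Y} [h : Seg M s P Q t m] [hZ : IsObj M r Z] :
    Seg M (r ⊠ s) P Q (r ⊠ t) (Z ◁ m) := by
  obtain ⟨hX, hY, P₁, rfl, h⟩ := h
  obtain ⟨rfl⟩ := hZ
  subst hX hY
  exact ⟨rfl, rfl, P₁, rfl, by simpa using h.whiskerLeft r⟩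

instance {m : X ⟶ Y} [h : Seg M s P Q t m] [hZ : IsObj M r Z] :
    Seg M (s ⊠ r) P Q (t ⊠ r) (m ▷ Z) := by
  obtain ⟨hX, hY, P₁, rfl, h⟩ := h
  obtain ⟨rfl⟩ := hZ
  subst hX hY
  exact ⟨rfl, rfl, P₁, rfl, by simpa using h.whiskerRight r⟩

instance {m : X ⟶ Y} {n : X' ⟶ Y'} [h : Seg M s P Q t m] [h' : Seg M s' Q R t' n] :
    Seg M (s ⊠ s') P R (t ⊠ t') (m ⊗ₘ n) := by
  obtain ⟨hX, hY, P₁, rfl, h⟩ := h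
  obtain ⟨hX', hY', P₂, rfl, h'⟩ := h'
  subst hX hY hX' hY'
  refine ⟨rfl, rfl, P₁ ++ P₂, by simp, ?_⟩
  have := (h.whiskerRight s').append (h'.whiskerLeft t)
  simpa [MonoidalCategory.tensorHom_def] using this

instance (priority := low) [hX : IsObj M s X] : Seg M s P P s (𝟙 X) := by
  obtain ⟨rfl⟩ := hX
  exact of_str (.id s)

instance [hX : IsObj M a X] [hY : IsObj M b Y] [hZ : IsObj M c Z] :
    Seg M ((a ⊠ b) ⊠ c) P P (a ⊠ b ⊠ c) (α_ X Y Z).hom := by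
  obtain ⟨rfl⟩ := hX; obtain ⟨rfl⟩ := hY; obtain ⟨rfl⟩ := hZ
  exact of_str (.assoc a b c)

instance [hX : IsObj M a X] [hY : IsObj M b Y] [hZ : IsObj M c Z] :
    Seg M (a ⊠ b ⊠ c) P P ((a ⊠ b) ⊠ c) (α_ X Y Z).inv := by
  obtain ⟨rfl⟩ := hX; obtain ⟨rfl⟩ := hY; obtain ⟨rfl⟩ := hZ
  exact of_str (.assocInv a b c)

instance [hX : IsObj M a X] : Seg M (.one ⊠ a) P P a (λ_ X).hom := by
  obtain ⟨rfl⟩ := hX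
  exact of_str (.leftUnitor a)

instance [hX : IsObj M a X] : Seg M a P P (.one ⊠ a) (λ_ X).inv := by
  obtain ⟨rfl⟩ := hX
  exact of_str (.leftUnitorInv a)

instance [hX : IsObj M a X] : Seg M (a ⊠ .one) P P a (ρ_ X).hom := by
  obtain ⟨rfl⟩ := hX
  exact of_str (.rightUnitor a)

instance [hX : IsObj M a X] : Seg M a P P (a ⊠ .one) (ρ_ X).inv := by
  obtain ⟨rfl⟩ := hX
  exact of_str (.rightUnitorInv a)

instance [hX : IsObj M a X] [hY : IsObj M b Y] : Seg M (a ⊠ b) P P (b ⊠ a) (β_ X Y).hom := by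
  obtain ⟨rfl⟩ := hX; obtain ⟨rfl⟩ := hY
  exact of_str (.braid a b)

instance [hX : IsObj M a X] [hY : IsObj M b Y] : IsObj M (a ⊠ b) (X ⊗ Y) := by
  obtain ⟨rfl⟩ := hX; obtain ⟨rfl⟩ := hY
  exact ⟨rfl⟩

instance : IsObj M .one (𝟙_ C) := ⟨rfl⟩

instance [hX : IsObj M a X] [hY : IsObj M b Y] [hZ : IsObj M c Z] [hV : IsObj M d V] :
    Seg M ((a ⊠ b) ⊠ c ⊠ d) P P ((a ⊠ c) ⊠ b ⊠ d) (tensorμ X Y Z V) := by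
  unfold tensorμ
  infer_instance

/-- An equation of morphisms gives an equation of programs. -/
lemma holds {L L' : List Instr} {m n : X ⟶ Y} (e : m = n) [h : Seg M s L [] t m]
    [h' : Seg M s L' [] t n] : Rule.Holds M ⟨s, L, L', t⟩ := by
  obtain ⟨hX, hY, P₁, rfl, h⟩ := h
  obtain ⟨hX', hY', P₂, rfl, h'⟩ := h'
  subst hX hY e
  exact ⟨_, by simpa using h, by simpa using h'⟩

/-- An equation of programs gives an equation of morphisms. -/
lemma eq_of_holds {L L' : List Instr} {m n : X ⟶ Y} (e : Rule.Holds M ⟨s, L, L', t⟩)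
    (hL : Sem.Good s.leaves L ∧ Sem.Good s.leaves L') [h : Seg M s L [] t m]
    [h' : Seg M s L' [] t n] : m = n := by
  obtain ⟨hX, hY, P₁, e₁, h⟩ := h
  obtain ⟨hX', hY', P₂, e₂, h'⟩ := h'
  obtain ⟨k, hk, hk'⟩ := e
  subst hX hY
  rw [List.append_nil] at e₁ e₂
  subst e₁ e₂
  have := (h.unique hk hL.1).trans (h'.unique hk' hL.2).symm
  simpa using this

end Seg

end Seg

/-! ### The operations of a crossed product -/

section Interp

variable {C : Type u} [Category.{v} C] [MonoidalCategory C] [SymmetricCategory C]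
variable {H A E : C} [WeakHopfObj H] [MonObj A]

/-- The interpretation given by a weak Hopf algebra `H`, an algebra `A` and maps. -/
def interp (act : H ⊗ A ⟶ A) (f g : H ⊗ H ⟶ A) (inc : E ⟶ A ⊗ H) (prj : A ⊗ H ⟶ E) :
    Interp C where
  H := H
  A := A
  E := E
  mul := μ[H]
  one := η[H]
  com := Δ[H]
  eps := ε[H]
  ant := WeakHopfObj.antipode
  piL := piL H
  piR := piR H
  mulA := μ[A]
  oneA := η[A]
  act := act
  u := u₁ act
  f := f
  g := g
  inc := inc
  prj := prj

variable {act : H ⊗ A ⟶ A} {f g : H ⊗ H ⟶ A} {inc : E ⟶ A ⊗ H} {prj : A ⊗ H ⟶ E}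

namespace Seg

variable {P : List Instr}

local notation "𝓜" => interp act f g inc prj

instance (n : ℕ) : IsObj 𝓜 (leaf (.h n)) H := ⟨rfl⟩
instance (n : ℕ) : IsObj 𝓜 (leaf (.a n)) A := ⟨rfl⟩
instance (n : ℕ) : IsObj 𝓜 (leaf (.e n)) E := ⟨rfl⟩

instance (x y : ℕ) : Seg 𝓜 (hw x) (.idH x y :: P) P (hw y) (𝟙 H) := of_mor (M := 𝓜) (.idH x y)
instance (x y : ℕ) : Seg 𝓜 (aw x) (.idA x y :: P) P (aw y) (𝟙 A) := of_mor (M := 𝓜) (.idA x y)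
instance (x y : ℕ) : Seg 𝓜 (ew x) (.idE x y :: P) P (ew y) (𝟙 E) := of_mor (M := 𝓜) (.idE x y)
instance (x y z : ℕ) : Seg 𝓜 (hw x ⊠ hw y) (.mul x y z :: P) P (hw z) μ[H] :=
  of_mor (M := 𝓜) (.mul x y z)
instance (x : ℕ) : Seg 𝓜 .one (.one x :: P) P (hw x) η[H] := of_mor (M := 𝓜) (.one x)
instance (x y z : ℕ) : Seg 𝓜 (hw x) (.com x y z :: P) P (hw y ⊠ hw z) Δ[H] :=
  of_mor (M := 𝓜) (.com x y z)
instance (x : ℕ) : Seg 𝓜 (hw x) (.eps x :: P) P .one ε[H] := of_mor (M := 𝓜) (.eps x)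
instance (x y : ℕ) : Seg 𝓜 (hw x) (.ant x y :: P) P (hw y) (WeakHopfObj.antipode (H := H)) :=
  of_mor (M := 𝓜) (.ant x y)
instance (x y : ℕ) : Seg 𝓜 (hw x) (.piL x y :: P) P (hw y) (piL H) :=
  of_mor (M := 𝓜) (.piL x y)
instance (x y : ℕ) : Seg 𝓜 (hw x) (.piR x y :: P) P (hw y) (piR H) :=
  of_mor (M := 𝓜) (.piR x y)
instance (x y z : ℕ) : Seg 𝓜 (aw x ⊠ aw y) (.mulA x y z :: P) P (aw z) μ[A] :=
  of_mor (M := 𝓜) (.mulA x y z)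
instance (x : ℕ) : Seg 𝓜 .one (.oneA x :: P) P (aw x) η[A] := of_mor (M := 𝓜) (.oneA x)
instance (x y z : ℕ) : Seg 𝓜 (hw x ⊠ aw y) (.act x y z :: P) P (aw z) act :=
  of_mor (M := 𝓜) (.act x y z)
instance (x y : ℕ) : Seg 𝓜 (hw x) (.u x y :: P) P (aw y) (u₁ act) := of_mor (M := 𝓜) (.u x y)
instance (x y z : ℕ) : Seg 𝓜 (hw x ⊠ hw y) (.f x y z :: P) P (aw z) f :=
  of_mor (M := 𝓜) (.f x y z)
instance (x y z : ℕ) : Seg 𝓜 (hw x ⊠ hw y) (.g x y z :: P) P (aw z) g :=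
  of_mor (M := 𝓜) (.g x y z)
instance (x y z : ℕ) : Seg 𝓜 (ew x) (.inc x y z :: P) P (aw y ⊠ hw z) inc :=
  of_mor (M := 𝓜) (.inc x y z)
instance (x y z : ℕ) : Seg 𝓜 (aw x ⊠ hw y) (.prj x y z :: P) P (ew z) prj :=
  of_mor (M := 𝓜) (.prj x y z)

instance (x x₁ x₂ y y₁ y₂ : ℕ) :
    Seg 𝓜 (hw x ⊠ hw y) (.com x x₁ x₂ :: .com y y₁ y₂ :: P) P
      ((hw x₁ ⊠ hw y₁) ⊠ hw x₂ ⊠ hw y₂) (comul₂ H) := by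
  unfold comul₂
  infer_instance

instance (x y z : ℕ) : Seg 𝓜 .one (.one x :: .com x y z :: P) P (hw y ⊠ hw z) (comulOne H) := by
  unfold comulOne
  infer_instance

instance (x y z : ℕ) : Seg 𝓜 (hw x ⊠ hw y) (.mul x y z :: .eps z :: P) P .one (counitMul H) := by
  unfold counitMul
  infer_instance

instance (x x₁ x₂ y z : ℕ) : Seg 𝓜 (hw x ⊠ aw y) (.com x x₁ x₂ :: .act x₁ y z :: P) P
    (aw z ⊠ hw x₂) (chi act) := by
  unfold chi
  infer_instance

instance (x y y₁ y₂ z w v : ℕ) : Seg 𝓜 (aw x ⊠ hw y)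
    (.oneA z :: .com y y₁ y₂ :: .act y₁ z w :: .mulA x w v :: P) P (aw v ⊠ hw y₂)
    (nabla act) := by
  unfold nabla
  infer_instance

instance (x y y₁ y₂ z w v : ℕ) : Seg 𝓜 .one
    (.oneA x :: .one y :: .oneA z :: .com y y₁ y₂ :: .act y₁ z w :: .mulA x w v :: P) P
    (aw v ⊠ hw y₂) (nu act) := by
  unfold nu
  infer_instance

instance (x x₁ x₂ y y₁ y₂ z w : ℕ) :
    Seg 𝓜 (hw x ⊠ hw y) (.com x x₁ x₂ :: .com y y₁ y₂ :: .f x₁ y₁ z :: .mul x₂ y₂ w :: P) P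
      (aw z ⊠ hw w) (cocycleMap f) := by
  unfold cocycleMap
  infer_instance

instance {X : C} (d : X ⟶ X ⊗ X) (m n : X ⟶ A) {s t : Tr Wire} {Q : List Instr}
    [h : Seg 𝓜 s P Q t (d ≫ (m ⊗ₘ n) ≫ μ[A])] : Seg 𝓜 s P Q t (conv d m n) := h

instance (x y z w : ℕ) : Seg 𝓜 (hw x ⊠ hw y) (.mul x y z :: .u z w :: P) P (aw w) (u₂ act) := by
  unfold u₂
  infer_instance

instance (x y y₁ y₂ z w v a b : ℕ) : Seg 𝓜 (aw a)
    (.oneA x :: .one y :: .oneA z :: .com y y₁ y₂ :: .act y₁ z w :: .mulA x w v ::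
      .mulA a v b :: P) P (aw b ⊠ hw y₂) (jPre act) := by
  unfold jPre
  infer_instance

instance (a x x₁ x₂ y₁ b b' y x₃ x₄ y₂ z w k l : ℕ) : Seg 𝓜 ((aw a ⊠ hw x) ⊠ aw b ⊠ hw y)
    (.com x x₁ x₂ :: .act x₁ b b' :: .mulA a b' k :: .com x₂ x₃ x₄ :: .com y y₁ y₂ ::
      .f x₃ y₁ z :: .mul x₄ y₂ w :: .mulA k z l :: P) P (aw l ⊠ hw w) (mulPre act f) := by
  unfold mulPre
  infer_instance

end Seg

end Interp

end WeakCleft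

namespace WeakCleft

open Tr

/-! ### The equations of a crossed product -/

namespace Rule

open Instr

def mulAssoc : Rule :=
  ⟨(hw 0 ⊠ hw 1) ⊠ hw 2, [mul 0 1 3, mul 3 2 4], [mul 1 2 3, mul 0 3 4], hw 4⟩
-- Both sides of an equation share the names of source and target, so an identity map is written as
-- an operation that renames a wire; `removeIds` eliminates it after use.
def oneMul : Rule := ⟨.one ⊠ hw 0, [.one 1, mul 1 0 2], [idH 0 2], hw 2⟩
def mulOne : Rule := ⟨hw 0 ⊠ .one, [.one 1, mul 0 1 2], [idH 0 2], hw 2⟩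
def coassoc : Rule := ⟨hw 0, [com 0 1 2, com 1 3 4], [com 0 3 5, com 5 4 2], hw 3 ⊠ hw 4 ⊠ hw 2⟩
def counitLeft : Rule := ⟨hw 0, [com 0 1 2, eps 1], [idH 0 2], .one ⊠ hw 2⟩
def counitRight : Rule := ⟨hw 0, [com 0 1 2, eps 2], [idH 0 1], hw 1 ⊠ .one⟩
def mulCom : Rule :=
  ⟨hw 0 ⊠ hw 1, [mul 0 1 2, com 2 7 8], [com 0 3 4, com 1 5 6, mul 3 5 7, mul 4 6 8],
    hw 7 ⊠ hw 8⟩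
def epsMul : Rule :=
  ⟨(hw 0 ⊠ hw 1) ⊠ hw 2, [mul 0 1 3, mul 3 2 4, eps 4],
    [com 1 3 4, mul 0 3 5, eps 5, mul 4 2 6, eps 6], .one⟩
def epsMul' : Rule :=
  ⟨(hw 0 ⊠ hw 1) ⊠ hw 2, [mul 0 1 3, mul 3 2 4, eps 4],
    [com 1 3 4, mul 0 4 5, eps 5, mul 3 2 6, eps 6], .one⟩
def oneCom : Rule :=
  ⟨.one, [.one 0, com 0 1 2, com 1 3 4], [.one 0, com 0 3 5, .one 1, com 1 6 2, mul 5 6 4],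
    (hw 3 ⊠ hw 4) ⊠ hw 2⟩
def oneCom' : Rule :=
  ⟨.one, [.one 0, com 0 1 2, com 1 3 4], [.one 0, com 0 3 5, .one 1, com 1 6 2, mul 6 5 4],
    (hw 3 ⊠ hw 4) ⊠ hw 2⟩
def piLDef : Rule := ⟨hw 0, [.piL 0 3], [.one 1, com 1 2 3, mul 2 0 4, eps 4], hw 3⟩
def piRDef : Rule := ⟨hw 0, [.piR 0 2], [.one 1, com 1 2 3, mul 0 3 4, eps 4], hw 2⟩
def idAnt : Rule := ⟨hw 0, [com 0 1 2, ant 2 3, mul 1 3 4], [.piL 0 4], hw 4⟩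
def antId : Rule := ⟨hw 0, [com 0 1 2, ant 1 3, mul 3 2 4], [.piR 0 4], hw 4⟩
def antIdAnt : Rule :=
  ⟨hw 0, [com 0 1 2, com 1 3 4, ant 3 5, ant 2 6, mul 5 4 7, mul 7 6 8], [ant 0 8], hw 8⟩
def mulAAssoc : Rule :=
  ⟨(aw 0 ⊠ aw 1) ⊠ aw 2, [mulA 0 1 3, mulA 3 2 4], [mulA 1 2 3, mulA 0 3 4], aw 4⟩
def oneMulA : Rule := ⟨.one ⊠ aw 0, [oneA 1, mulA 1 0 2], [idA 0 2], aw 2⟩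
def mulAOne : Rule := ⟨aw 0 ⊠ .one, [oneA 1, mulA 0 1 2], [idA 0 2], aw 2⟩
def uDef : Rule := ⟨hw 0, [u 0 2], [oneA 1, act 0 1 2], aw 2⟩
def oneAct : Rule := ⟨aw 0, [.one 1, act 1 0 2], [idA 0 2], aw 2⟩
def actMul : Rule :=
  ⟨hw 0 ⊠ aw 1 ⊠ aw 2, [mulA 1 2 3, act 0 3 4], [com 0 5 6, act 5 1 7, act 6 2 8, mulA 7 8 4],
    aw 4⟩
def mulActOne : Rule := ⟨hw 0 ⊠ hw 1, [mul 0 1 2, u 2 3], [u 1 4, act 0 4 3], aw 3⟩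
def piLAct : Rule := ⟨hw 0 ⊠ aw 1, [.piL 0 2, act 2 1 3], [u 0 2, mulA 2 1 3], aw 3⟩
def normalized : Rule :=
  ⟨hw 0 ⊠ hw 1, [f 0 1 2], [com 0 3 4, com 1 5 6, f 3 5 7, mul 4 6 8, u 8 9, mulA 7 9 2], aw 2⟩
def twisted : Rule :=
  ⟨(hw 0 ⊠ hw 1) ⊠ aw 2, [com 0 3 4, com 1 5 6, f 3 5 7, mul 4 6 8, act 8 2 9, mulA 7 9 10],
    [com 1 3 4, act 3 2 5, com 0 6 7, act 6 5 8, f 7 4 9, mulA 8 9 10], aw 10⟩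
def cocycle : Rule :=
  ⟨(hw 0 ⊠ hw 1) ⊠ hw 2,
    [com 1 3 4, com 2 5 6, f 3 5 7, mul 4 6 8, com 0 9 10, act 9 7 11, f 10 8 12, mulA 11 12 13],
    [com 0 3 4, com 1 5 6, f 3 5 7, mul 4 6 8, f 8 2 9, mulA 7 9 13], aw 13⟩
def preunitRight : Rule :=
  ⟨hw 0, [com 0 10 11, oneA 1, .one 2, oneA 3, com 2 4 5, act 4 3 6, mulA 1 6 7, act 10 7 12,
    f 11 5 13, mulA 12 13 20], [u 0 20], aw 20⟩
def preunitLeft : Rule :=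
  ⟨hw 0, [oneA 1, .one 2, oneA 3, com 2 4 5, act 4 3 6, mulA 1 6 7, f 5 0 8, mulA 7 8 20],
    [u 0 20], aw 20⟩
def preunitCentral : Rule :=
  ⟨aw 0, [oneA 1, .one 2, oneA 3, com 2 4 5, act 4 3 6, mulA 1 6 7, com 5 8 9, act 8 0 10,
    mulA 7 10 11], [oneA 1, .one 2, oneA 3, com 2 4 9, act 4 3 6, mulA 1 6 7, mulA 0 7 11],
    aw 11 ⊠ hw 9⟩
def fg : Rule :=
  ⟨hw 0 ⊠ hw 1, [com 0 3 4, com 1 5 6, f 3 5 7, g 4 6 8, mulA 7 8 2], [mul 0 1 3, u 3 2], aw 2⟩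
def gf : Rule :=
  ⟨hw 0 ⊠ hw 1, [com 0 3 4, com 1 5 6, g 3 5 7, f 4 6 8, mulA 7 8 2], [mul 0 1 3, u 3 2], aw 2⟩
def gu : Rule :=
  ⟨hw 0 ⊠ hw 1, [g 0 1 2], [com 0 3 4, com 1 5 6, g 3 5 7, mul 4 6 8, u 8 9, mulA 7 9 2], aw 2⟩
def ug : Rule :=
  ⟨hw 0 ⊠ hw 1, [g 0 1 2], [com 0 3 4, com 1 5 6, mul 3 5 8, u 8 9, g 4 6 7, mulA 9 7 2], aw 2⟩
def incPrj : Rule := ⟨ew 0, [inc 0 1 2, prj 1 2 3], [idE 0 3], ew 3⟩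
def prjInc : Rule :=
  ⟨aw 0 ⊠ hw 1, [prj 0 1 2, inc 2 3 4], [oneA 5, com 1 6 4, act 6 5 7, mulA 0 7 3],
    aw 3 ⊠ hw 4⟩

variable {C : Type u} [Category.{v} C] [MonoidalCategory C] [SymmetricCategory C]

/-- The equations of a weak Hopf algebra. -/
class WeakHopf (M : Interp C) : Prop where
  mulAssoc : mulAssoc.Holds M
  oneMul : oneMul.Holds M
  mulOne : mulOne.Holds M
  coassoc : coassoc.Holds M
  counitLeft : counitLeft.Holds M
  counitRight : counitRight.Holds M
  mulCom : mulCom.Holds M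
  epsMul : epsMul.Holds M
  epsMul' : epsMul'.Holds M
  oneCom : oneCom.Holds M
  oneCom' : oneCom'.Holds M
  piLDef : piLDef.Holds M
  piRDef : piRDef.Holds M
  idAnt : idAnt.Holds M
  antId : antId.Holds M
  antIdAnt : antIdAnt.Holds M

/-- The equations of a weak action. -/
class WeakAction (M : Interp C) : Prop extends WeakHopf M where
  mulAAssoc : mulAAssoc.Holds M
  oneMulA : oneMulA.Holds M
  mulAOne : mulAOne.Holds M
  uDef : uDef.Holds M
  oneAct : oneAct.Holds M
  actMul : actMul.Holds M
  mulActOne : mulActOne.Holds M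
  piLAct : piLAct.Holds M

/-- The equations of a crossed product. -/
class CrossedProduct (M : Interp C) : Prop extends WeakAction M where
  normalized : normalized.Holds M
  twisted : twisted.Holds M
  cocycle : cocycle.Holds M
  preunitRight : preunitRight.Holds M
  preunitLeft : preunitLeft.Holds M
  preunitCentral : preunitCentral.Holds M
  incPrj : incPrj.Holds M
  prjInc : prjInc.Holds M

/-- The equations of a crossed product with regular `f`. -/
class Regular (M : Interp C) : Prop extends CrossedProduct M where
  fg : fg.Holds M
  gf : gf.Holds M

/-- The equations of a crossed product with regular `f` and normalized inverse. -/
class NormalizedRegular (M : Interp C) : Prop extends Regular M where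
  gu : gu.Holds M
  ug : ug.Holds M

attribute [instance] WeakHopf.mulAssoc WeakHopf.oneMul WeakHopf.mulOne WeakHopf.coassoc
  WeakHopf.counitLeft WeakHopf.counitRight WeakHopf.mulCom WeakHopf.epsMul WeakHopf.epsMul'
  WeakHopf.oneCom WeakHopf.oneCom' WeakHopf.piLDef WeakHopf.piRDef WeakHopf.idAnt WeakHopf.antId
  WeakHopf.antIdAnt WeakAction.mulAAssoc WeakAction.oneMulA WeakAction.mulAOne
  WeakAction.uDef WeakAction.oneAct WeakAction.actMul WeakAction.mulActOne
  WeakAction.piLAct CrossedProduct.normalized CrossedProduct.twisted CrossedProduct.cocycle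
  CrossedProduct.preunitRight CrossedProduct.preunitLeft CrossedProduct.preunitCentral
  CrossedProduct.incPrj CrossedProduct.prjInc Regular.fg Regular.gf NormalizedRegular.gu
  NormalizedRegular.ug

end Rule

section

variable {C : Type u} [Category.{v} C] [MonoidalCategory C] [SymmetricCategory C]
variable {H A E : C} [WeakHopfObj H] [MonObj A]
variable {act : H ⊗ A ⟶ A} {f g : H ⊗ H ⟶ A} {inc : E ⟶ A ⊗ H} {prj : A ⊗ H ⟶ E}

lemma interp_weakHopf : Rule.WeakHopf (interp act f g inc prj) where
  mulAssoc := Seg.holds (MonObj.mul_assoc H)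
  oneMul := Seg.holds ((MonObj.one_mul H).trans (Category.comp_id _).symm)
  mulOne := Seg.holds ((MonObj.mul_one H).trans (Category.comp_id _).symm)
  coassoc := Seg.holds (ComonObj.comul_assoc H).symm
  counitLeft := Seg.holds ((ComonObj.counit_comul H).trans (Category.id_comp _).symm)
  counitRight := Seg.holds ((ComonObj.comul_counit H).trans (Category.id_comp _).symm)
  mulCom := Seg.holds (WeakBialgebraObj.mul_comul (H := H))
  epsMul := Seg.holds (WeakBialgebraObj.counit_mul_mul (H := H))
  epsMul' := Seg.holds (WeakBialgebraObj.counit_mul_mul' (H := H))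
  oneCom := Seg.holds (WeakBialgebraObj.comul_comul_one (H := H))
  oneCom' := Seg.holds (WeakBialgebraObj.comul_comul_one' (H := H))
  piLDef := Seg.holds (m := WeakCleft.piL H) (by rw [WeakCleft.piL])
  piRDef := Seg.holds (m := WeakCleft.piR H) (by rw [WeakCleft.piR])
  idAnt := Seg.holds (WeakHopfObj.id_conv_antipode (H := H))
  antId := Seg.holds (WeakHopfObj.antipode_conv_id (H := H))
  antIdAnt := Seg.holds (WeakHopfObj.antipode_conv_id_conv_antipode (H := H))

lemma interp_weakAction (hact : IsWeakAction act) :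
    Rule.WeakAction (interp act f g inc prj) where
  toWeakHopf := interp_weakHopf
  mulAAssoc := Seg.holds (MonObj.mul_assoc A)
  oneMulA := Seg.holds ((MonObj.one_mul A).trans (Category.comp_id _).symm)
  mulAOne := Seg.holds ((MonObj.mul_one A).trans (Category.comp_id _).symm)
  uDef := Seg.holds (m := u₁ act) (by rw [u₁])
  oneAct := Seg.holds hact.one_act
  actMul := Seg.holds hact.act_mul
  mulActOne := Seg.holds hact.mul_act_one
  piLAct := Seg.holds hact.piL_act

lemma interp_crossedProduct (hact : IsWeakAction act) (hf : IsCrossedProductDatum act f)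
    (h₁ : inc ≫ prj = 𝟙 E) (h₂ : prj ≫ inc = nabla act) :
    Rule.CrossedProduct (interp act f g inc prj) where
  toWeakAction := interp_weakAction hact
  normalized := Seg.holds hf.cocycle_normalized
  twisted := Seg.holds hf.twisted_module
  cocycle := Seg.holds hf.cocycle
  preunitRight := Seg.holds hf.preunit_right.symm
  preunitLeft := Seg.holds hf.preunit_left.symm
  preunitCentral := Seg.holds hf.preunit_central
  incPrj := Seg.holds h₁
  prjInc := Seg.holds h₂

lemma interp_regular (hact : IsWeakAction act) (hf : IsCrossedProductDatum act f)
    (h₁ : inc ≫ prj = 𝟙 E) (h₂ : prj ≫ inc = nabla act)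
    (h₃ : conv (comul₂ H) f g = u₂ act) (h₄ : conv (comul₂ H) g f = u₂ act) :
    Rule.Regular (interp act f g inc prj) where
  toCrossedProduct := interp_crossedProduct hact hf h₁ h₂
  fg := Seg.holds h₃
  gf := Seg.holds h₄

end

end WeakCleft

namespace WeakCleft

open Tr

namespace Rule

open Instr

/-! The comments use Sweedler notation: `S` is the antipode, `L` and `R` are `Π^L` and `Π^R`, `o`,
`p`, `q` are units of `H`, and `e -> a, h` is the inclusion of `E` into `A ⊗ H`. -/

set_option synthInstance.maxSize 1000
set_option synthInstance.maxHeartbeats 400000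

variable {C : Type u} [Category.{v} C] [MonoidalCategory C] [SymmetricCategory C]
variable {M : Interp C}

/-! ### Weak Hopf algebras: the projections Π^L and Π^R. -/

/-- `o1 * h1, o2 * h2` equals `h1, h2`. -/
def oneComMul : Rule :=
  ⟨hw 0, [com 0 3 4, .one 5, com 5 6 7, mul 6 3 1, mul 7 4 2], [com 0 1 2], hw 1 ⊠ hw 2⟩

instance [WeakHopf M] : oneComMul.Holds M :=
  derive [(mulCom.symm, 5), (oneMul, 5)] [] (by decide +kernel)

/-- `h1 * o1, h2 * o2` equals `h1, h2`. -/
def mulOneCom : Rule :=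
  ⟨hw 0, [com 0 3 4, .one 5, com 5 6 7, mul 3 6 1, mul 4 7 2], [com 0 1 2], hw 1 ⊠ hw 2⟩

instance [WeakHopf M] : mulOneCom.Holds M :=
  derive [(mulCom.symm, 0), (mulOne, 5)] [] (by decide +kernel)

/-- `o1 * h1, o3, eps(o2 * h2)` equals `h1, o2, eps(o1 * h2)`. -/
def counitPiLAux : Rule :=
  ⟨hw 0, [com 0 3 4, .one 5, com 5 6 7, com 7 8 2, mul 6 3 1, mul 8 4 11, eps 11], [com 0 1 4,
    .one 5, com 5 6 2, mul 6 4 8, eps 8], hw 1 ⊠ hw 2⟩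

instance [WeakHopf M] : counitPiLAux.Holds M :=
  derive [(coassoc.symm, 5), (oneCom', 5), (mulAssoc, 14), (oneComMul, 0)] [] (by decide +kernel)

/-- `o1 * h1, o3, eps(o2 * h2)` equals `o1 * h, o2`. -/
def counitPiLAux' : Rule :=
  ⟨hw 0, [com 0 3 4, .one 5, com 5 6 7, com 7 8 2, mul 6 3 1, mul 8 4 11, eps 11], [.one 3,
    com 3 4 2, mul 4 0 1], hw 1 ⊠ hw 2⟩

instance [WeakHopf M] : counitPiLAux'.Holds M :=
  derive [(coassoc.symm, 5), (mulCom.symm, 12), (counitRight, 13)] [] (by decide +kernel)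

/-- `h1, L(h2)` equals `o1 * h, o2`. -/
def comPiL : Rule :=
  ⟨hw 0, [com 0 1 4, .piL 4 2], [.one 3, com 3 4 2, mul 4 0 1], hw 1 ⊠ hw 2⟩

/-- The element 1₁h₁ ⊗ 1₃ ε(1₂h₂) is evaluated twice: splitting 1₁ ⊗ 1₂ ⊗ 1₃ into two copies of Δ(1)
gives h₁ ⊗ Π^L(h₂), while multiplicativity of Δ and the counit give 1₁h ⊗ 1₂. -/
instance [WeakHopf M] : comPiL.Holds M :=
  derive [(piLDef, 4), (counitPiLAux.symm, 0), (counitPiLAux', 0)] [] (by decide +kernel)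

/-- `o1, h2 * o3, eps(h1 * o2)` equals `o1, h2, eps(h1 * o2)`. -/
def counitPiRAux : Rule :=
  ⟨hw 0, [com 0 3 4, .one 5, com 5 1 7, com 7 8 9, mul 4 9 2, mul 3 8 11, eps 11], [com 0 3 2,
    .one 5, com 5 1 7, mul 3 7 8, eps 8], hw 1 ⊠ hw 2⟩

instance [WeakHopf M] : counitPiRAux.Holds M :=
  derive [(coassoc.symm, 5), (oneCom', 5), (mulAssoc.symm, 14), (mulOneCom, 0)] []
    (by decide +kernel)

/-- `o1, h2 * o3, eps(h1 * o2)` equals `o1, h * o2`. -/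
def counitPiRAux' : Rule :=
  ⟨hw 0, [com 0 3 4, .one 5, com 5 1 7, com 7 8 9, mul 4 9 2, mul 3 8 11, eps 11], [.one 3,
    com 3 1 5, mul 0 5 2], hw 1 ⊠ hw 2⟩

instance [WeakHopf M] : counitPiRAux'.Holds M :=
  derive [(mulCom.symm, 0), (counitLeft, 12)] [] (by decide +kernel)

/-- `R(h1), h2` equals `o1, h * o2`. -/
def comPiR : Rule :=
  ⟨hw 0, [com 0 3 2, .piR 3 1], [.one 3, com 3 1 5, mul 0 5 2], hw 1 ⊠ hw 2⟩

instance [WeakHopf M] : comPiR.Holds M :=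
  derive [(piRDef, 3), (counitPiRAux.symm, 0), (counitPiRAux', 0)] [] (by decide +kernel)

/-- `R(h1), L(h2)` equals `o1, p2, eps(p1 * h * o2)`. -/
def piRPiLAux : Rule :=
  ⟨hw 0, [com 0 3 4, .piR 3 1, .piL 4 2], [.one 3, com 3 1 5, .one 6, com 6 7 2, mul 7 0 9,
    mul 9 5 10, eps 10], hw 1 ⊠ hw 2⟩

instance [WeakHopf M] : piRPiLAux.Holds M :=
  derive [(piRDef, 3), (piLDef, 4), (epsMul'.symm, 0), (mulAssoc, 9)] [(mulAssoc, 7)]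
    (by decide +kernel)

/-- `R(h2), L(h1)` equals `o1, p2, eps(p1 * h * o2)`. -/
def piRPiLAux' : Rule :=
  ⟨hw 0, [com 0 3 4, .piR 4 1, .piL 3 2], [.one 3, com 3 1 5, .one 6, com 6 7 2, mul 7 0 9,
    mul 9 5 10, eps 10], hw 1 ⊠ hw 2⟩

instance [WeakHopf M] : piRPiLAux'.Holds M :=
  derive [(piRDef, 4), (piLDef, 3), (epsMul.symm, 0), (mulAssoc, 9)] [(mulAssoc, 7)]
    (by decide +kernel)

/-- `R(h1), L(h2)` equals `R(h2), L(h1)`. -/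
def piRPiL : Rule :=
  ⟨hw 0, [com 0 3 4, .piR 3 1, .piL 4 2], [com 0 3 4, .piR 4 1, .piL 3 2], hw 1 ⊠ hw 2⟩

/-- The two weak multiplicativity axioms of ε bring both sides to 1₁ ⊗ 1'₂ ε(1'₁h1₂). -/
instance [WeakHopf M] : piRPiL.Holds M :=
  derive [(piRPiLAux, 0), (mulAssoc, 7), (mulAssoc.symm, 0), (piRPiLAux'.symm, 3)] []
    (by decide +kernel)

/-- `x = L(h); x1, x2` equals `L(h) * o1, o2`. -/
def piLCom : Rule :=
  ⟨hw 0, [.piL 0 3, com 3 1 2], [.one 3, com 3 4 2, .piL 0 6, mul 6 4 1], hw 1 ⊠ hw 2⟩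

instance [WeakHopf M] : piLCom.Holds M :=
  derive [(piLDef, 0), (coassoc.symm, 4), (oneCom, 4)] [(piLDef, 0)] (by decide +kernel)

/-- `x = L(h); x1, x2` equals `o1 * L(h), o2`. -/
def piLCom' : Rule :=
  ⟨hw 0, [.piL 0 3, com 3 1 2], [.one 3, com 3 4 2, .piL 0 6, mul 4 6 1], hw 1 ⊠ hw 2⟩

instance [WeakHopf M] : piLCom'.Holds M :=
  derive [(piLDef, 0), (coassoc.symm, 4), (oneCom', 4)] [(piLDef, 0)] (by decide +kernel)

/-- `x = R(h); x1, x2` equals `o1, R(h) * o2`. -/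
def piRCom : Rule :=
  ⟨hw 0, [.piR 0 3, com 3 1 2], [.one 3, com 3 1 5, .piR 0 6, mul 6 5 2], hw 1 ⊠ hw 2⟩

instance [WeakHopf M] : piRCom.Holds M :=
  derive [(piRDef, 0), (coassoc, 4), (coassoc.symm, 4), (oneCom', 4)] [(piRDef, 0)]
    (by decide +kernel)

/-- `x = R(h); x1, x2` equals `o1, o2 * R(h)`. -/
def piRCom' : Rule :=
  ⟨hw 0, [.piR 0 3, com 3 1 2], [.one 3, com 3 1 5, .piR 0 6, mul 5 6 2], hw 1 ⊠ hw 2⟩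

instance [WeakHopf M] : piRCom'.Holds M :=
  derive [(piRDef, 0), (coassoc, 4), (coassoc.symm, 4), (oneCom, 4)] [(piRDef, 0)]
    (by decide +kernel)

/-- `o1, L(o2)` equals `o1, o2`. -/
def onePiL : Rule :=
  ⟨.one, [.one 2, com 2 0 4, .piL 4 1], [.one 2, com 2 0 1], hw 0 ⊠ hw 1⟩

instance [WeakHopf M] : onePiL.Holds M :=
  derive [(piLDef, 4), (oneCom'.symm, 2), (counitRight, 5)] [] (by decide +kernel)

/-! ### The antipode reverses the comultiplication. -/

/-- `S(h1) * L(h2)` equals `S(h)`. -/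
def antPiL : Rule :=
  ⟨hw 0, [com 0 2 3, ant 2 4, .piL 3 5, mul 4 5 1], [ant 0 1], hw 1⟩

instance [WeakHopf M] : antPiL.Holds M :=
  derive [(idAnt.symm, 3), (coassoc.symm, 0), (mulAssoc.symm, 6), (antIdAnt, 0)] []
    (by decide +kernel)

/-- `R(h1) * S(h2)` equals `S(h)`. -/
def piRAnt : Rule :=
  ⟨hw 0, [com 0 2 3, .piR 2 4, ant 3 5, mul 4 5 1], [ant 0 1], hw 1⟩

instance [WeakHopf M] : piRAnt.Holds M :=
  derive [(antId.symm, 2), (coassoc, 0), (mulAssoc, 8), (coassoc.symm, 0), (mulAssoc.symm, 7),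
    (antIdAnt, 0)] [] (by decide +kernel)

/-- `x = S(h3); h1 * x1, h2 * x2` equals `x = L(h); x1, x2`. -/
def mulAntCom : Rule :=
  ⟨hw 0, [com 0 3 4, com 4 5 6, ant 6 7, com 7 8 9, mul 3 8 1, mul 5 9 2], [.piL 0 3, com 3 1 2],
    hw 1 ⊠ hw 2⟩

instance [WeakHopf M] : mulAntCom.Holds M :=
  derive [(coassoc.symm, 0), (mulCom.symm, 10), (idAnt, 0)] [] (by decide +kernel)

/-- `S(h2) * h3, S(h1) * h4` equals `x = R(h); x1, x2`. -/
def antAntMul : Rule :=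
  ⟨hw 0, [com 0 3 4, com 4 5 6, com 6 7 8, ant 5 9, mul 9 7 1, ant 3 11, mul 11 8 2], [.piR 0 3,
    com 3 1 2], hw 1 ⊠ hw 2⟩

/-- The inner product is Π^R(h₂), and Π^R(h₂) ⊗ h₃ = 1₁ ⊗ h₂1₂. What remains is 1₁ ⊗ Π^R(h)1₂ =
Δ(Π^R(h)). -/
instance [WeakHopf M] : antAntMul.Holds M :=
  derive [(coassoc.symm, 4), (antId, 12), (comPiR, 4), (mulAssoc.symm, 4), (antId, 0),
    (piRCom.symm, 12)] [] (by decide +kernel)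

/-- `h1 * S(h4), h2 * S(h3)` equals `x = L(h); x1, x2`. -/
def mulAntAnt : Rule :=
  ⟨hw 0, [com 0 3 4, com 4 5 6, com 6 7 8, ant 8 9, mul 3 9 1, ant 7 11, mul 5 11 2], [.piL 0 3,
    com 3 1 2], hw 1 ⊠ hw 2⟩

instance [WeakHopf M] : mulAntAnt.Holds M :=
  derive [(coassoc.symm, 4), (idAnt, 12), (coassoc.symm, 0), (comPiL, 13), (mulAssoc, 12),
    (idAnt, 0), (piLCom'.symm, 14)] [] (by decide +kernel)

/-- `S(h2) * h3 * S(h6), S(h1) * h4 * S(h5)` equals `S(h2), S(h1)`. -/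
def antAntMulAntAnt : Rule :=
  ⟨hw 0, [com 0 3 4, com 4 5 6, com 6 7 8, com 8 9 10, com 10 11 12, ant 5 13, mul 13 7 14,
    ant 12 15, mul 14 15 1, ant 3 17, mul 17 9 18, ant 11 19, mul 18 19 2], [com 0 3 4, ant 4 1,
    ant 3 2], hw 1 ⊠ hw 2⟩

/-- The products collapse to Π^R(h₂)S(h₄) ⊗ S(h₁)Π^L(h₃). Exchanging the two legs by `piRPiL` puts
each projection next to the antipode that absorbs it. -/
instance [WeakHopf M] : antAntMulAntAnt.Holds M :=
  derive [(mulAssoc, 13), (mulAssoc, 17), (coassoc.symm, 4), (mulAssoc.symm, 7), (antId, 20),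
    (coassoc.symm, 8), (idAnt, 21), (coassoc.symm, 4), (piRPiL, 22), (coassoc, 4),
    (coassoc.symm, 0), (antPiL, 24), (piRAnt, 23)] [] (by decide +kernel)

/-- `y = S(h5); S(h2) * h3 * y1, S(h1) * h4 * y2` equals `x = S(h); x1, x2`. -/
def antComAux1 : Rule :=
  ⟨hw 0, [com 0 3 4, com 4 5 6, com 6 7 8, com 8 9 10, ant 10 11, com 11 12 13, ant 5 14,
    mul 14 7 15, mul 15 12 1, ant 3 17, mul 17 9 18, mul 18 13 2], [ant 0 3, com 3 1 2], hw 1 ⊠ hw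
    2⟩

instance [WeakHopf M] : antComAux1.Holds M :=
  derive [(mulAssoc, 14), (mulAssoc, 17), (coassoc.symm, 6), (coassoc.symm, 4), (coassoc.symm, 0),
    (mulAssoc.symm, 7), (mulAssoc.symm, 9), (antAntMul, 21), (mulCom.symm, 3), (piRAnt, 0)] []
    (by decide +kernel)

/-- `y = S(h5); S(h2) * h3 * y1, S(h1) * h4 * y2` equals `S(h2), S(h1)`. -/
def antComAux2 : Rule :=
  ⟨hw 0, [com 0 3 4, com 4 5 6, com 6 7 8, com 8 9 10, ant 10 11, com 11 12 13, ant 5 14,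
    mul 14 7 15, mul 15 12 1, ant 3 17, mul 17 9 18, mul 18 13 2], [com 0 3 4, ant 4 1, ant 3 2],
    hw 1 ⊠ hw 2⟩

instance [WeakHopf M] : antComAux2.Holds M :=
  derive [(mulAssoc, 14), (mulAssoc, 17), (mulAntCom, 6), (mulAntAnt.symm, 6), (mulAssoc.symm, 7),
    (mulAssoc.symm, 20), (antAntMulAntAnt, 0)] [] (by decide +kernel)

/-- `x = S(h); x1, x2` equals `S(h2), S(h1)`. -/
def antCom : Rule :=
  ⟨hw 0, [ant 0 3, com 3 1 2], [com 0 3 4, ant 4 1, ant 3 2], hw 1 ⊠ hw 2⟩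

/-- This is the uniqueness of convolution inverses: ΔS and (S ⊗ S)cΔ are both weakly inverse to Δ.
The product of (S ⊗ S)cΔ, Δ and ΔS equals ΔS when bracketed to the left (`antComAux1`) and (S ⊗ S)cΔ
when bracketed to the right (`antComAux2`). -/
instance [WeakHopf M] : antCom.Holds M :=
  derive [(antComAux1.symm, 0), (mulAssoc, 14), (mulAssoc, 16), (mulAssoc.symm, 7),
    (mulAssoc.symm, 9), (antComAux2, 0)] [] (by decide +kernel)

/-- `h1 * R(h2)` equals `h`. -/
def mulPiR : Rule :=
  ⟨hw 0, [com 0 2 3, .piR 3 4, mul 2 4 1], [idH 0 1], hw 1⟩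

instance [WeakHopf M] : mulPiR.Holds M :=
  derive [(piRDef, 3), (mulCom.symm, 0), (mulOne, 5), (counitRight, 0)] [] (by decide +kernel)

/-! ### The weak action, the normalization of f and the unit. -/

/-- `u(h1) * u(h2)` equals `u(h)`. -/
def uMulU : Rule :=
  ⟨hw 0, [com 0 2 3, u 2 4, u 3 5, mulA 4 5 1], [u 0 1], aw 1⟩

instance [CrossedProduct M] : uMulU.Holds M :=
  derive [(uDef, 3), (uDef, 2), (actMul.symm, 0), (oneMulA, 7)] [(uDef, 0)] (by decide +kernel)

/-- `u(h1) * act(h2, a)` equals `act(h, a)`. -/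
def uAct : Rule :=
  ⟨hw 0 ⊠ aw 1, [com 0 3 4, u 3 5, act 4 1 6, mulA 5 6 2], [act 0 1 2], aw 2⟩

instance [CrossedProduct M] : uAct.Holds M :=
  derive [(uDef, 3), (actMul.symm, 0), (oneMulA, 7)] [] (by decide +kernel)

/-- `act(h1, a) * u(h2)` equals `act(h, a)`. -/
def actU : Rule :=
  ⟨hw 0 ⊠ aw 1, [com 0 3 4, act 3 1 5, u 4 6, mulA 5 6 2], [act 0 1 2], aw 2⟩

instance [CrossedProduct M] : actU.Holds M :=
  derive [(uDef, 4), (actMul.symm, 0), (mulAOne, 7)] [] (by decide +kernel)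

/-- `act(h1, u(o1)) * f(h2, o2)` equals `u(h)`. -/
def preunitRightU : Rule :=
  ⟨hw 0, [com 0 2 3, .one 4, com 4 5 6, u 5 7, act 2 7 8, f 3 6 9, mulA 8 9 1], [u 0 1], aw 1⟩

instance [CrossedProduct M] : preunitRightU.Holds M :=
  derive [(uDef, 5)] [(preunitRight.symm, 0), (oneMulA, 4)] (by decide +kernel)

/-- `u(o1) * f(o2, h)` equals `u(h)`. -/
def preunitLeftU : Rule :=
  ⟨hw 0, [.one 2, com 2 3 4, u 3 5, f 4 0 6, mulA 5 6 1], [u 0 1], aw 1⟩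

instance [CrossedProduct M] : preunitLeftU.Holds M :=
  derive [(uDef, 3)] [(preunitLeft.symm, 0), (oneMulA, 2)] (by decide +kernel)

/-- `((1 * act(o1, 1)) * act(o2, a)), o3` equals `act(o1, 1) * act(o2, a), o3`. -/
def preunitCentralAux : Rule :=
  ⟨aw 0, [oneA 11, .one 12, oneA 3, com 12 4 5, act 4 3 6, mulA 11 6 7, com 5 8 2, act 8 0 10,
    mulA 7 10 1], [.one 3, com 3 4 5, com 5 6 2, oneA 8, act 4 8 9, act 6 0 10, mulA 9 10 1], aw 1
    ⊠ hw 2⟩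

instance [CrossedProduct M] : preunitCentralAux.Holds M :=
  derive [(oneMulA, 11)] [] (by decide +kernel)

/-- `u(o1) * act(o2, a), o3` equals `a * u(o1), o2`. -/
def preunitCentralU : Rule :=
  ⟨aw 0, [.one 3, com 3 4 5, com 5 6 2, u 4 8, act 6 0 9, mulA 8 9 1], [.one 3, com 3 4 2, u 4 6,
    mulA 0 6 1], aw 1 ⊠ hw 2⟩

instance [CrossedProduct M] : preunitCentralU.Holds M :=
  derive [(uDef, 4), (preunitCentralAux.symm, 3), (preunitCentral, 11), (oneMulA, 11)] [(uDef, 4)]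
    (by decide +kernel)

/-- `f(h1, k1) * u(h2 * k2)` equals `f(h, k)`. -/
def mulUF : Rule :=
  ⟨hw 0 ⊠ hw 1, [com 0 3 4, com 1 5 6, f 3 5 7, mul 4 6 8, u 8 9, mulA 7 9 2], [f 0 1 2], aw 2⟩

instance [CrossedProduct M] : mulUF.Holds M :=
  derive [(normalized.symm, 0)] [] (by decide +kernel)

/-- `act(h1, u(k1)) * f(h2, k2)` equals `f(h, k)`. -/
def actUF : Rule :=
  ⟨hw 0 ⊠ hw 1, [com 0 3 4, com 1 5 6, u 5 7, act 3 7 8, f 4 6 9, mulA 8 9 2], [f 0 1 2], aw 2⟩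

/-- This is the twisted module condition at a = 1, together with the normalization of f. -/
instance [CrossedProduct M] : actUF.Holds M :=
  derive [(uDef, 5), (twisted.symm, 1), (uDef.symm, 10), (mulUF, 0)] [] (by decide +kernel)

/-- `u(h1) * f(h2, k)` equals `f(h, k)`. -/
def uF : Rule :=
  ⟨hw 0 ⊠ hw 1, [com 0 3 4, u 3 5, f 4 1 6, mulA 5 6 2], [f 0 1 2], aw 2⟩

instance [CrossedProduct M] : uF.Holds M :=
  derive [(actUF.symm, 4), (coassoc.symm, 0), (mulAAssoc.symm, 12), (uAct, 14), (actUF, 0)] []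
    (by decide +kernel)

/-- `u(h1 * k1) * f(h2, k2)` equals `f(h, k)`. -/
def uMulF : Rule :=
  ⟨hw 0 ⊠ hw 1, [com 0 3 4, com 1 5 6, mul 3 5 7, u 7 8, f 4 6 9, mulA 8 9 2], [f 0 1 2], aw 2⟩

instance [CrossedProduct M] : uMulF.Holds M :=
  derive [(mulActOne, 3), (actUF, 0)] [] (by decide +kernel)

/-- `f(h * o1, k), o2` equals `f(h, o1 * k), o2`. -/
def balF : Rule :=
  ⟨hw 0 ⊠ hw 1, [.one 4, com 4 5 3, mul 0 5 7, f 7 1 2], [.one 4, com 4 5 3, mul 5 1 7, f 0 7 2],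
    aw 2 ⊠ hw 3⟩

/-- Write f = f * u₂ on both sides and split 1₁ ⊗ 1₂ ⊗ 1₃ into two copies of Δ(1). One copy is
absorbed into Δ(h) or Δ(k), and both sides become f(h₁,k₁)u(h₂1₁k₂) ⊗ 1₂. -/
instance [CrossedProduct M] : balF.Holds M :=
  derive [(mulUF.symm, 7), (mulCom, 0), (coassoc, 4), (mulAssoc, 16), (coassoc.symm, 4),
    (oneCom, 4), (mulAssoc, 21), (mulAssoc.symm, 21), (mulOneCom, 0)] [(mulUF.symm, 0),
    (mulCom, 5), (coassoc, 4), (coassoc.symm, 4), (oneCom', 4), (mulAssoc, 22), (oneComMul, 1)]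
    (by decide +kernel)

/-- `f(h, o)` equals `u(h)`. -/
def fOne : Rule :=
  ⟨hw 0, [.one 2, f 0 2 1], [u 0 1], aw 1⟩

/-- Expanding f(h,1) by `actUF` produces exactly the right preunit condition. -/
instance [CrossedProduct M] : fOne.Holds M :=
  derive [(actUF.symm, 0), (preunitRightU, 0)] [] (by decide +kernel)

/-- `f(o, h)` equals `u(h)`. -/
def oneF : Rule :=
  ⟨hw 0, [.one 2, f 2 0 1], [u 0 1], aw 1⟩

instance [CrossedProduct M] : oneF.Holds M :=
  derive [(uF.symm, 2), (preunitLeftU, 2)] [] (by decide +kernel)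

/-- `f(x, q1), q2` equals `u(x * q1), q2`. -/
def fOneCom : Rule :=
  ⟨hw 0, [.one 3, com 3 4 2, f 0 4 1], [.one 3, com 3 4 2, mul 0 4 6, u 6 1], aw 1 ⊠ hw 2⟩

instance [CrossedProduct M] : fOneCom.Holds M :=
  derive [] [(fOne.symm, 6), (balF, 3), (mulOne, 7)] (by decide +kernel)

/-- `u(L(h))` equals `u(h)`. -/
def uPiL : Rule :=
  ⟨hw 0, [.piL 0 2, u 2 1], [u 0 1], aw 1⟩

instance [CrossedProduct M] : uPiL.Holds M :=
  derive [(uDef, 2), (piLAct, 0), (mulAOne, 3)] [] (by decide +kernel)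

/-- `x = L(h); u(x1), x2` equals `u(h) * u(o1), o2`. -/
def uPiLCom : Rule :=
  ⟨hw 0, [.piL 0 3, com 3 4 2, u 4 1], [.one 3, com 3 4 2, u 0 6, u 4 7, mulA 6 7 1], aw 1 ⊠ hw 2⟩

instance [CrossedProduct M] : uPiLCom.Holds M :=
  derive [(piLCom, 0), (mulActOne, 6), (piLAct, 0)] [] (by decide +kernel)

/-! ### Calculus of the splitting: p and ι absorb ∇. -/

/-- `e = prj(a, h); e -> x, y; prj(x, y)` equals `prj(a * u(h1), h2)`. -/
def prjIncPrjAux : Rule :=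
  ⟨aw 0 ⊠ hw 1, [prj 0 1 3, inc 3 4 5, prj 4 5 2], [com 1 3 4, u 3 5, mulA 0 5 6, prj 6 4 2], ew
    2⟩

instance [CrossedProduct M] : prjIncPrjAux.Holds M :=
  derive [(prjInc, 0)] [(uDef, 3)] (by decide +kernel)

/-- `e = prj(a, h); e -> x, y; prj(x, y)` equals `prj(a, h)`. -/
def prjIncPrj : Rule :=
  ⟨aw 0 ⊠ hw 1, [prj 0 1 3, inc 3 4 5, prj 4 5 2], [prj 0 1 2], ew 2⟩

instance [CrossedProduct M] : prjIncPrj.Holds M :=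
  derive [(incPrj, 3)] [] (by decide +kernel)

/-- `prj(a * u(h1), h2)` equals `prj(a, h)`. -/
def prjU : Rule :=
  ⟨aw 0 ⊠ hw 1, [com 1 3 4, u 3 5, mulA 0 5 6, prj 6 4 2], [prj 0 1 2], ew 2⟩

/-- The composite pιp is computed from ιp = ∇ and from pι = id. -/
instance [CrossedProduct M] : prjU.Holds M :=
  derive [(prjIncPrjAux.symm, 1), (prjIncPrj, 0)] [] (by decide +kernel)

/-- `prj((1 * u(h1)), h2)` equals `prj(u(h1), h2)`. -/
def prjUOneAux : Rule :=
  ⟨hw 0, [oneA 2, com 0 3 4, u 3 5, mulA 2 5 6, prj 6 4 1], [com 0 2 3, u 2 4, prj 4 3 1], ew 1⟩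

instance [CrossedProduct M] : prjUOneAux.Holds M :=
  derive [(oneMulA, 2)] [] (by decide +kernel)

/-- `prj(u(h1), h2)` equals `prj(1, h)`. -/
def prjUOne : Rule :=
  ⟨hw 0, [com 0 2 3, u 2 4, prj 4 3 1], [oneA 2, prj 2 0 1], ew 1⟩

instance [CrossedProduct M] : prjUOne.Holds M :=
  derive [(prjUOneAux.symm, 0), (prjU, 0)] [] (by decide +kernel)

/-- `e -> x, y; z = prj(x, y); z -> v, w; v, w` equals `e -> x, y; x * u(y1), y2`. -/
def incPrjIncAux : Rule :=
  ⟨ew 0, [inc 0 3 4, prj 3 4 5, inc 5 1 2], [inc 0 3 4, com 4 5 2, u 5 7, mulA 3 7 1], aw 1 ⊠ hw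
    2⟩

instance [CrossedProduct M] : incPrjIncAux.Holds M :=
  derive [(prjInc, 3)] [(uDef, 5)] (by decide +kernel)

/-- `e -> x, y; z = prj(x, y); z -> v, w; v, w` equals `e -> x, y; x, y`. -/
def incPrjInc : Rule :=
  ⟨ew 0, [inc 0 3 4, prj 3 4 5, inc 5 1 2], [inc 0 1 2], aw 1 ⊠ hw 2⟩

instance [CrossedProduct M] : incPrjInc.Holds M :=
  derive [(incPrj, 0)] [] (by decide +kernel)

/-- `e -> x, y; x * u(y1), y2` equals `e -> x, y; x, y`. -/
def incU : Rule :=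
  ⟨ew 0, [inc 0 3 4, com 4 5 2, u 5 7, mulA 3 7 1], [inc 0 1 2], aw 1 ⊠ hw 2⟩

instance [CrossedProduct M] : incU.Holds M :=
  derive [(incPrjIncAux.symm, 0), (incPrjInc, 0)] [] (by decide +kernel)

/-- `e = prj(a, h); e -> x, y; prj(x * act(y1, b) * f(y2, k1), y3 * k2)` equals `prj(a * act(h1,
  b) * f(h2, k1), h3 * k2)`. -/
def prjMulLeft : Rule :=
  ⟨aw 0 ⊠ hw 1 ⊠ aw 2 ⊠ hw 3, [com 3 5 6, prj 0 1 7, inc 7 8 9, com 9 10 11, com 11 12 13,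
    act 10 2 14, mulA 8 14 15, f 12 5 16, mulA 15 16 17, mul 13 6 18, prj 17 18 4], [com 1 5 6,
    com 6 7 8, com 3 9 10, act 5 2 11, mulA 0 11 12, f 7 9 13, mulA 12 13 14, mul 8 10 15,
    prj 14 15 4], ew 4⟩

/-- The factor u(h₁) created by ∇ on the left argument is absorbed by the action next to it:
u(h₁)(h₂·b) = h·b. -/
instance [CrossedProduct M] : prjMulLeft.Holds M :=
  derive [(mulAAssoc, 8), (prjInc, 0), (mulAAssoc, 0), (uDef.symm, 19), (coassoc.symm, 1),
    (mulAAssoc.symm, 14), (uAct, 22)] [(mulAAssoc, 0)] (by decide +kernel)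

/-- `d = prj(b, k); d -> z, w; prj(a * act(h1, z) * f(h2, w1), h3 * w2)` equals `prj(a * act(h1,
  b) * f(h2, k1), h3 * k2)`. -/
def prjMulRight : Rule :=
  ⟨aw 0 ⊠ hw 1 ⊠ aw 2 ⊠ hw 3, [com 1 5 6, com 6 7 8, prj 2 3 9, inc 9 10 11, com 11 12 13,
    act 5 10 14, mulA 0 14 15, f 7 12 16, mulA 15 16 17, mul 8 13 18, prj 17 18 4], [com 1 5 6,
    com 6 7 8, com 3 9 10, act 5 2 11, mulA 0 11 12, f 7 9 13, mulA 12 13 14, mul 8 10 15,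
    prj 14 15 4], ew 4⟩

/-- Acting on b·u(k₁) leaves (h₂·u(k₁))f(h₃,k₂), which is f(h₂,k) by `actUF`. -/
instance [CrossedProduct M] : prjMulRight.Holds M :=
  derive [(mulAAssoc, 0), (prjInc, 2), (uDef.symm, 19), (actMul, 2), (coassoc, 1),
    (mulAAssoc, 24), (coassoc.symm, 3), (coassoc.symm, 26), (actUF, 28)] [(mulAAssoc, 0)]
    (by decide +kernel)

/-- `e = prj(a, h); e -> x, y; prj(x, y1), y2` equals `prj(a, h1), h2`. -/
def coactPrj : Rule :=
  ⟨aw 0 ⊠ hw 1, [prj 0 1 4, inc 4 5 6, com 6 7 3, prj 5 7 2], [com 1 4 3, prj 0 4 2], ew 2 ⊠ hw 3⟩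

instance [CrossedProduct M] : coactPrj.Holds M :=
  derive [(prjInc, 0), (uDef.symm, 8), (coassoc.symm, 1), (prjU, 11)] [] (by decide +kernel)

/-- `f(x1, q1), x2 * q2` equals `u(x1), x2`. -/
def mulOneComF : Rule :=
  ⟨hw 0, [com 0 3 4, .one 5, com 5 6 7, f 3 6 1, mul 4 7 2], [com 0 3 2, u 3 1], aw 1 ⊠ hw 2⟩

instance [CrossedProduct M] : mulOneComF.Holds M :=
  derive [(fOneCom, 5), (mulOneCom, 0)] [] (by decide +kernel)

/-- `o1, f(o2, x1), o3 * x2` equals `o1, f(o2, x1), x2`. -/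
def oneComMulF : Rule :=
  ⟨hw 0, [com 0 4 5, .one 6, com 6 1 8, com 8 9 10, f 9 4 2, mul 10 5 3], [com 0 4 3, .one 6,
    com 6 1 8, f 8 4 2], hw 1 ⊠ aw 2 ⊠ hw 3⟩

/-- Splitting 1₁ ⊗ 1₂ ⊗ 1₃ gives f(1₂1'₁,x₁) ⊗ 1'₂x₂; by `balF` the second unit moves across f and
is absorbed into Δ(x). -/
instance [CrossedProduct M] : oneComMulF.Holds M :=
  derive [(coassoc.symm, 6), (oneCom, 6), (balF, 11), (oneComMul, 0)] [] (by decide +kernel)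

/-- `act(o1, a), o2` equals `a * u(o1), o2`. -/
def oneActCentral : Rule :=
  ⟨aw 0, [.one 3, com 3 4 2, act 4 0 1], [.one 3, com 3 4 2, u 4 6, mulA 0 6 1], aw 1 ⊠ hw 2⟩

instance [CrossedProduct M] : oneActCentral.Holds M :=
  derive [(uAct.symm, 4), (coassoc, 3), (preunitCentralU, 3)] [] (by decide +kernel)

/-! ### The algebra and comodule structure of E. -/

/-- `X = incH(e); Y = incH(d); Z = incH(prj(((incA(e) * act(X1, incA(d))) * f(X2, Y1)), (X3 *
  Y2))); U = incH(c); prj(((incA(prj(((incA(e) * act(X1, incA(d))) * f(X2, Y1)), (X3 * Y2))) *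
  act(Z1, incA(c))) * f(Z2, U1)), (Z3 * U2))` equals `X = incH(e); Y = incH(d); Z = incH(c); U =
  incH(prj(((incA(d) * act(Y1, incA(c))) * f(Y2, Z1)), (Y3 * Z2))); prj(((incA(e) * act(X1,
  incA(prj(((incA(d) * act(Y1, incA(c))) * f(Y2, Z1)), (Y3 * Z2))))) * f(X2, U1)), (X3 * U2))`. -/
def mulE_assoc : Rule :=
  ⟨(ew 0 ⊠ ew 1) ⊠ ew 2, [inc 0 4 5, inc 1 6 7, com 5 8 9, act 8 6 10, mulA 4 10 11, com 9 12 13,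
    com 7 14 15, f 12 14 16, mul 13 15 17, mulA 11 16 18, prj 18 17 19, inc 19 20 21, inc 2 22 23,
    com 21 24 25, act 24 22 26, mulA 20 26 27, com 25 28 29, com 23 30 31, f 28 30 32,
    mul 29 31 33, mulA 27 32 34, prj 34 33 3], [inc 1 4 5, inc 2 6 7, com 5 8 9, act 8 6 10,
    mulA 4 10 11, com 9 12 13, com 7 14 15, f 12 14 16, mul 13 15 17, mulA 11 16 18, prj 18 17 19,
    inc 0 20 21, inc 19 22 23, com 21 24 25, act 24 22 26, mulA 20 26 27, com 25 28 29,
    com 23 30 31, f 28 30 32, mul 29 31 33, mulA 27 32 34, prj 34 33 3], ew 3⟩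

/-- After removal of ∇, the right-hand side acts by h on the product b(k₁·c)f(k₂,l₁). The cocycle
condition turns the action on f(k,l) into f(h,k)f(hk,l), and the twisted module condition, read
backwards, turns h·(k·c) into (hk)·c to its right. -/
instance [CrossedProduct M] : mulE_assoc.Holds M :=
  derive [(mulAAssoc, 4), (mulAAssoc, 20), (mulAAssoc.symm, 26), (prjMulLeft, 23), (mulAAssoc, 4),
    (mulAAssoc, 4), (mulAAssoc, 10), (mulAAssoc, 10), (mulAAssoc, 16), (mulCom, 13), (mulCom, 33),
    (mulAssoc, 37)] [(mulAAssoc, 4), (mulAAssoc, 20), (mulAAssoc.symm, 26), (prjMulRight, 21),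
    (mulAAssoc, 20), (mulCom, 13), (actMul, 4), (coassoc, 21), (mulAAssoc, 38), (actMul, 10),
    (coassoc, 40), (mulAAssoc, 43), (coassoc.symm, 7), (coassoc.symm, 9), (coassoc.symm, 45),
    (cocycle, 47), (coassoc, 9), (coassoc, 45), (coassoc.symm, 5), (coassoc.symm, 40),
    (mulAAssoc.symm, 16), (twisted.symm, 51), (coassoc, 5), (coassoc, 40), (mulAAssoc, 12)]
    (by decide +kernel)

/-- `X = incH(prj((1 * act(o1, 1)), o2)); Y = incH(e); prj(((incA(prj((1 * act(o1, 1)), o2)) *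
  act(X1, incA(e))) * f(X2, Y1)), (X3 * Y2))` equals `e`. -/
def oneE_mulE : Rule :=
  ⟨.one ⊠ ew 0, [oneA 2, .one 3, oneA 4, com 3 5 6, act 5 4 7, mulA 2 7 8, prj 8 6 9, inc 9 10 11,
    inc 0 12 13, com 11 14 15, act 14 12 16, mulA 10 16 17, com 15 18 19, com 13 20 21,
    f 18 20 22, mul 19 21 23, mulA 17 22 24, prj 24 23 1], [idE 0 1], ew 1⟩

/-- With representative u(1₁) ⊗ 1₂ for the unit, the product is u(1₁)(1₂·a)f(1₃,h₁) ⊗ 1₄h₂. The last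
unit leg is absorbed, the central preunit condition moves a to the front, and the left one removes
f. -/
instance [CrossedProduct M] : oneE_mulE.Holds M :=
  derive [(oneMulA, 2), (mulAAssoc, 10), (uDef.symm, 4), (prjUOne, 3), (prjInc, 5), (oneMulA, 5),
    (uDef.symm, 25), (coassoc.symm, 3), (oneComMulF, 13), (coassoc, 3), (mulAAssoc.symm, 16),
    (preunitCentralU, 3), (mulAAssoc, 12), (preunitLeftU, 3), (prjU, 13), (incPrj, 0)] []
    (by decide +kernel)

/-- `X = incH(e); Y = incH(prj((1 * act(o1, 1)), o2)); prj(((incA(e) * act(X1, incA(prj((1 *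
  act(o1, 1)), o2)))) * f(X2, Y1)), (X3 * Y2))` equals `e`. -/
def mulE_oneE : Rule :=
  ⟨ew 0 ⊠ .one, [oneA 2, .one 3, oneA 4, com 3 5 6, act 5 4 7, mulA 2 7 8, prj 8 6 9, inc 0 10 11,
    inc 9 12 13, com 11 14 15, act 14 12 16, mulA 10 16 17, com 15 18 19, com 13 20 21,
    f 18 20 22, mul 19 21 23, mulA 17 22 24, prj 24 23 1], [idE 0 1], ew 1⟩

instance [CrossedProduct M] : mulE_oneE.Holds M :=
  derive [(oneMulA, 2), (mulAAssoc, 10), (uDef.symm, 4), (prjUOne, 3), (mulAAssoc.symm, 16),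
    (prjMulRight, 11), (mulAAssoc, 10), (uDef.symm, 5), (coassoc.symm, 11), (uF, 22),
    (mulOneComF, 11), (prjU, 11), (incPrj, 0)] [] (by decide +kernel)

/-- `X = incH(e); Y = incH(prj(incA(e), X1)); prj(incA(prj(incA(e), X1)), Y1), Y2, X2` equals `X =
  incH(e); prj(incA(e), X1), X2, X3`. -/
def coact_coact : Rule :=
  ⟨ew 0, [inc 0 4 5, com 5 6 3, prj 4 6 7, inc 7 8 9, com 9 10 2, prj 8 10 1], [inc 0 4 5,
    com 5 6 7, prj 4 6 1, com 7 2 3], ew 1 ⊠ hw 2 ⊠ hw 3⟩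

instance [CrossedProduct M] : coact_coact.Holds M :=
  derive [(coactPrj, 4), (coassoc, 5)] [] (by decide +kernel)

/-- `X = incH(e); prj(incA(e), X1), eps(X2)` equals `e`. -/
def coact_eps : Rule :=
  ⟨ew 0, [inc 0 2 3, com 3 4 5, prj 2 4 1, eps 5], [idE 0 1], ew 1 ⊠ .one⟩

instance [CrossedProduct M] : coact_eps.Holds M :=
  derive [(counitRight, 3), (incPrj, 0)] [] (by decide +kernel)

/-- `X = incH(e); Y = incH(d); Z = incH(prj(((incA(e) * act(X1, incA(d))) * f(X2, Y1)), (X3 *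
  Y2))); prj(incA(prj(((incA(e) * act(X1, incA(d))) * f(X2, Y1)), (X3 * Y2))), Z1), Z2` equals `X
  = incH(e); Y = incH(prj(incA(e), X1)); Z = incH(d); U = incH(prj(incA(d), Z1));
  prj(((incA(prj(incA(e), X1)) * act(Y1, incA(prj(incA(d), Z1)))) * f(Y2, U1)), (Y3 * U2)), (X2 *
  Z2)`. -/
def mulE_coact : Rule :=
  ⟨ew 0 ⊠ ew 1, [inc 0 4 5, inc 1 6 7, com 5 8 9, act 8 6 10, mulA 4 10 11, com 9 12 13,
    com 7 14 15, f 12 14 16, mul 13 15 17, mulA 11 16 18, prj 18 17 19, inc 19 20 21, com 21 22 3,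
    prj 20 22 2], [inc 0 4 5, com 5 6 7, prj 4 6 8, inc 1 9 10, com 10 11 12, prj 9 11 13,
    inc 8 14 15, inc 13 16 17, com 15 18 19, act 18 16 20, mulA 14 20 21, com 19 22 23,
    com 17 24 25, f 22 24 26, mul 23 25 27, mulA 21 26 28, prj 28 27 2, mul 7 12 3], ew 2 ⊠ hw 3⟩

instance [CrossedProduct M] : mulE_coact.Holds M :=
  derive [(mulAAssoc, 4), (coactPrj, 18), (mulCom, 13)] [(mulAAssoc, 14), (mulAAssoc.symm, 20),
    (prjMulLeft, 17), (coassoc, 5), (coassoc, 26), (mulAAssoc, 4), (coassoc.symm, 26),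
    (coassoc.symm, 5), (mulAAssoc.symm, 19), (prjMulRight, 29), (coassoc, 5), (coassoc, 10),
    (coassoc, 30), (mulAAssoc, 4)] (by decide +kernel)

/-- `X = incH(prj((1 * act(o1, 1)), o2)); prj(incA(prj((1 * act(o1, 1)), o2)), X1), X2, X3` equals
  `X = incH(prj((1 * act(o1, 1)), o2)); prj(incA(prj((1 * act(o1, 1)), o2)), X1), (X2 * p1), p2`.
  -/
def oneE_coact : Rule :=
  ⟨.one, [oneA 3, .one 4, oneA 5, com 4 6 7, act 6 5 8, mulA 3 8 9, prj 9 7 10, inc 10 11 12,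
    com 12 13 14, prj 11 13 0, com 14 1 2], [oneA 3, .one 4, oneA 5, com 4 6 7, act 6 5 8,
    mulA 3 8 9, prj 9 7 10, .one 11, inc 10 12 13, com 13 14 15, prj 12 14 0, com 11 16 2,
    mul 15 16 1], ew 0 ⊠ hw 1 ⊠ hw 2⟩

instance [CrossedProduct M] : oneE_coact.Holds M :=
  derive [(oneMulA, 3), (coactPrj, 8)] [(oneMulA, 3), (coactPrj, 8), (coassoc.symm, 4),
    (oneCom.symm, 4), (coassoc, 4), (coassoc, 4)] (by decide +kernel)

/-! ### The inclusion j of A and the coinvariants of E. -/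

/-- `prj((1 * (1 * act(o1, 1))), o2)` equals `prj((1 * act(o1, 1)), o2)`. -/
def oneA_incl : Rule :=
  ⟨.one, [oneA 1, oneA 2, .one 3, oneA 4, com 3 5 6, act 5 4 7, mulA 2 7 8, mulA 1 8 9,
    prj 9 6 0], [oneA 1, .one 2, oneA 3, com 2 4 5, act 4 3 6, mulA 1 6 7, prj 7 5 0], ew 0⟩

instance [CrossedProduct M] : oneA_incl.Holds M :=
  derive [(oneMulA, 1), (oneMulA, 2)] [(oneMulA, 1)] (by decide +kernel)

/-- `prj(a * act(o1, 1), o2)` equals `prj(a, o)`. -/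
def incl_eq : Rule :=
  ⟨aw 0, [.one 2, com 2 3 4, oneA 5, act 3 5 6, mulA 0 6 7, prj 7 4 1], [.one 2, prj 0 2 1], ew 1⟩

instance [CrossedProduct M] : incl_eq.Holds M :=
  derive [(uDef.symm, 5), (prjU, 2)] [] (by decide +kernel)

/-- `prj(((a * b) * (1 * act(o1, 1))), o2)` equals `X = incH(prj((a * (1 * act(o1, 1))), o2)); Y =
  incH(prj((b * (1 * act(p1, 1))), p2)); prj(((incA(prj((a * (1 * act(o1, 1))), o2)) * act(X1,
  incA(prj((b * (1 * act(p1, 1))), p2)))) * f(X2, Y1)), (X3 * Y2))`. -/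
def mulA_incl : Rule :=
  ⟨aw 0 ⊠ aw 1, [mulA 0 1 3, oneA 4, .one 5, oneA 6, com 5 7 8, act 7 6 9, mulA 4 9 10,
    mulA 3 10 11, prj 11 8 2], [oneA 3, .one 4, oneA 5, com 4 6 7, act 6 5 8, mulA 3 8 9,
    mulA 0 9 10, prj 10 7 11, oneA 12, .one 13, oneA 14, com 13 15 16, act 15 14 17,
    mulA 12 17 18, mulA 1 18 19, prj 19 16 20, inc 11 21 22, inc 20 23 24, com 22 25 26,
    act 25 23 27, mulA 21 27 28, com 26 29 30, com 24 31 32, f 29 31 33, mul 30 32 34,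
    mulA 28 33 35, prj 35 34 2], ew 2⟩

/-- Since j(a) = p(a ⊗ 1), the product is represented by a(1₁·b)f(1₂,1'₁) ⊗ 1₃1'₂. Here f reduces to
u and is absorbed, and (1₁·b) ⊗ 1₂ = b u(1₁) ⊗ 1₂. -/
instance [CrossedProduct M] : mulA_incl.Holds M :=
  derive [(oneMulA, 4), (mulAAssoc, 0), (mulAAssoc.symm, 1), (incl_eq, 5)] [(oneMulA, 3),
    (oneMulA, 12), (mulAAssoc, 21), (incl_eq, 4), (incl_eq, 13), (mulAAssoc.symm, 27),
    (prjMulLeft, 24), (mulAAssoc, 0), (mulAAssoc.symm, 26), (prjMulRight, 4), (mulAAssoc, 0),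
    (mulOneComF, 32), (coassoc.symm, 4), (actU, 33), (oneActCentral, 4), (mulAAssoc.symm, 1),
    (prjU, 4)] (by decide +kernel)

/-- `incA(prj((a * (1 * act(o1, 1))), o2)), eps(incH(prj((a * (1 * act(o1, 1))), o2)))` equals
  `a`. -/
def incl_inc_eps : Rule :=
  ⟨aw 0, [oneA 2, .one 3, oneA 4, com 3 5 6, act 5 4 7, mulA 2 7 8, mulA 0 8 9, prj 9 6 10,
    inc 10 1 12, eps 12], [idA 0 1], aw 1⟩

instance [CrossedProduct M] : incl_inc_eps.Holds M :=
  derive [(oneMulA, 2), (uDef.symm, 4), (prjU, 3), (prjInc, 0), (counitRight, 3), (oneAct, 3),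
    (mulAOne, 13)] [] (by decide +kernel)

/-- `X = incH(prj((a * (1 * act(o1, 1))), o2)); prj(incA(prj((a * (1 * act(o1, 1))), o2)), X1),
  X2` equals `X = incH(prj((a * (1 * act(o1, 1))), o2)); prj(incA(prj((a * (1 * act(o1, 1))),
  o2)), X1), piL(X2)`. -/
def incl_coact : Rule :=
  ⟨aw 0, [oneA 3, .one 4, oneA 5, com 4 6 7, act 6 5 8, mulA 3 8 9, mulA 0 9 10, prj 10 7 11,
    inc 11 12 13, com 13 14 2, prj 12 14 1], [oneA 3, .one 4, oneA 5, com 4 6 7, act 6 5 8,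
    mulA 3 8 9, mulA 0 9 10, prj 10 7 11, inc 11 12 13, com 13 14 15, prj 12 14 1, .piL 15 2], ew
    1 ⊠ hw 2⟩

instance [CrossedProduct M] : incl_coact.Holds M :=
  derive [(oneMulA, 3), (incl_eq, 4), (coactPrj, 0)] [(oneMulA, 3), (incl_eq, 4), (coactPrj, 0),
    (onePiL, 4)] (by decide +kernel)

/-- `X = incH(e); prj(incA(prj(incA(e), X1)), X2), eps(incH(prj(incA(e), X1)))` equals `e`. -/
def coact_retract : Rule :=
  ⟨ew 0, [inc 0 2 3, com 3 4 5, prj 2 4 6, inc 6 7 8, eps 8, prj 7 5 1], [idE 0 1], ew 1⟩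

instance [CrossedProduct M] : coact_retract.Holds M :=
  derive [(prjInc, 2), (counitRight, 4), (uDef.symm, 9), (prjU, 3), (incPrj, 0)] []
    (by decide +kernel)

/-- `e -> x, y; x * u(y)` equals `e -> x, y; x, eps(y)`. -/
def incUEps : Rule :=
  ⟨ew 0, [inc 0 2 3, u 3 4, mulA 2 4 1], [inc 0 1 3, eps 3], aw 1⟩

/-- Apply ε to the last leg of `incU`. -/
instance [CrossedProduct M] : incUEps.Holds M :=
  derive [] [(incU.symm, 0), (counitRight, 5)] (by decide +kernel)

/-- `X = incH(e); prj(incA(prj(incA(e), X1)), piL(X2)), eps(incH(prj(incA(e), X1)))` equals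
  `prj((incA(e) * (1 * act(o1, 1))), o2), eps(incH(e))`. -/
def coact_piL_retract : Rule :=
  ⟨ew 0, [inc 0 2 3, com 3 4 5, prj 2 4 6, .piL 5 7, inc 6 8 9, eps 9, prj 8 7 1], [inc 0 2 3,
    eps 3, oneA 4, .one 5, oneA 6, com 5 7 8, act 7 6 9, mulA 4 9 10, mulA 2 10 11, prj 11 8 1],
    ew 1⟩

/-- For ι(e) = x ⊗ y, formula `comPiL` turns x u(y₁) ⊗ Π^L(y₂) into x u(1₁y) ⊗ 1₂ = x u(y)u(1₁) ⊗
1₂, whose image under p is j(x u(y)) = j(x ε(y)). -/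
instance [CrossedProduct M] : coact_piL_retract.Holds M :=
  derive [(prjInc, 2), (counitRight, 4), (uDef.symm, 10), (comPiL, 3), (mulActOne, 5),
    (oneActCentral, 13), (mulAAssoc.symm, 14), (prjU, 13), (incUEps, 0)] [(oneMulA, 4),
    (incl_eq, 5)] (by decide +kernel)

/-! ### The total integral γ. -/

/-- `X = incH(prj(1, h)); prj(incA(prj(1, h)), X1), X2` equals `prj(1, h1), h2`. -/
def gamma_coact : Rule :=
  ⟨hw 0, [oneA 3, prj 3 0 4, inc 4 5 6, com 6 7 2, prj 5 7 1], [com 0 3 2, oneA 4, prj 4 3 1], ew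
    1 ⊠ hw 2⟩

instance [CrossedProduct M] : gamma_coact.Holds M :=
  derive [(coactPrj, 3)] [] (by decide +kernel)

/-- `prj(1, o)` equals `prj((1 * act(o1, 1)), o2)`. -/
def one_gamma : Rule :=
  ⟨.one, [.one 1, oneA 2, prj 2 1 0], [oneA 1, .one 2, oneA 3, com 2 4 5, act 4 3 6, mulA 1 6 7,
    prj 7 5 0], ew 0⟩

instance [CrossedProduct M] : one_gamma.Holds M :=
  derive [] [(oneMulA, 1), (uDef.symm, 3), (prjUOne, 2)] (by decide +kernel)

/-- `prj(1, piL(h))` equals `prj((u(h) * (1 * act(o1, 1))), o2)`. -/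
def piL_gamma : Rule :=
  ⟨hw 0, [.piL 0 2, oneA 3, prj 3 2 1], [u 0 2, oneA 3, .one 4, oneA 5, com 4 6 7, act 6 5 8,
    mulA 3 8 9, mulA 2 9 10, prj 10 7 1], ew 1⟩

/-- The factor absorbed by p is u evaluated on Δ(Π^L(h)) = Π^L(h)1₁ ⊗ 1₂, which gives u(h)u(1₁) ⊗
1₂. Hence γΠ^L factors through j by u₁. -/
instance [CrossedProduct M] : piL_gamma.Holds M :=
  derive [(prjUOne.symm, 3), (uPiLCom, 0)] [(oneMulA, 3), (uDef.symm, 5)] (by decide +kernel)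

/-! ### The convolution inverse g of the cocycle. -/

/-- `f(o1, x), o2` equals `u(o1 * x), o2`. -/
def oneComF' : Rule :=
  ⟨hw 0, [.one 3, com 3 4 2, f 4 0 1], [.one 3, com 3 4 2, mul 4 0 6, u 6 1], aw 1 ⊠ hw 2⟩

instance [CrossedProduct M] : oneComF'.Holds M :=
  derive [] [(oneF.symm, 6), (balF.symm, 3), (oneMul, 7)] (by decide +kernel)

/-- `g(h * o1, k), o2` equals `g(h, o1 * k), o2`. -/
def balG : Rule :=
  ⟨hw 0 ⊠ hw 1, [.one 4, com 4 5 3, mul 0 5 7, g 7 1 2], [.one 4, com 4 5 3, mul 5 1 7, g 0 7 2],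
    aw 2 ⊠ hw 3⟩

instance [NormalizedRegular M] : balG.Holds M :=
  derive [(gu, 7), (mulCom, 0), (coassoc, 4), (mulAssoc, 16), (coassoc.symm, 4), (oneCom, 4),
    (mulAssoc, 21), (mulAssoc.symm, 21), (mulOneCom, 0)] [(gu, 0), (mulCom, 5), (coassoc, 4),
    (coassoc.symm, 4), (oneCom', 4), (mulAssoc, 22), (oneComMul, 1)] (by decide +kernel)

/-- `g(h * o2, k), o1` equals `g(h, o2 * k), o1`. -/
def balGR : Rule :=
  ⟨hw 0 ⊠ hw 1, [.one 4, com 4 3 6, mul 0 6 7, g 7 1 2], [.one 4, com 4 3 6, mul 6 1 7, g 0 7 2],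
    aw 2 ⊠ hw 3⟩

instance [NormalizedRegular M] : balGR.Holds M :=
  derive [(ug, 7), (mulCom, 0), (mulAssoc, 15), (coassoc.symm, 4), (oneCom', 4), (mulAssoc, 21),
    (mulAssoc.symm, 21), (mulOneCom, 0)] [(ug, 0), (mulCom, 6), (coassoc.symm, 4), (oneCom, 4),
    (mulAssoc, 20), (oneComMul, 1)] (by decide +kernel)

/-- `g(o, h)` equals `u(h)`. -/
def oneG : Rule :=
  ⟨hw 0, [.one 2, g 2 0 1], [u 0 1], aw 1⟩

/-- In g(1,h) = u(1₁h₁)g(1₂,h₂) the factor u(1₁h₁) may be replaced by f(1₁,h₁), and f * g = u₂. -/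
instance [NormalizedRegular M] : oneG.Holds M :=
  derive [(ug, 2), (oneComF'.symm, 2), (fg, 2), (oneMul, 2)] [] (by decide +kernel)

/-- `g(o1, x), o2` equals `u(o1 * x), o2`. -/
def oneComG : Rule :=
  ⟨hw 0, [.one 3, com 3 4 2, g 4 0 1], [.one 3, com 3 4 2, mul 4 0 6, u 6 1], aw 1 ⊠ hw 2⟩

instance [NormalizedRegular M] : oneComG.Holds M :=
  derive [] [(oneG.symm, 6), (balG.symm, 3), (oneMul, 7)] (by decide +kernel)

/-- `act(h1, g(k1, l1)) * f(h2, k2) * f(h3 * k3, l2) * g(h4 * k4, l3)` equals `act(h1, g(k1, l)) *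
  f(h2, k2)`. -/
def starAux : Rule :=
  ⟨hw 0 ⊠ hw 1 ⊠ hw 2, [com 0 4 5, com 5 6 7, com 7 8 9, com 1 10 11, com 11 12 13, com 13 14 15,
    com 2 16 17, com 17 18 19, g 10 16 20, act 4 20 21, f 6 12 22, mulA 21 22 23, mul 8 14 24,
    f 24 18 25, mulA 23 25 26, mul 9 15 27, g 27 19 28, mulA 26 28 3], [com 0 4 5, com 1 6 7,
    g 6 2 8, act 4 8 9, f 5 7 10, mulA 9 10 3], aw 3⟩

/-- The last two factors form f * g = u₂. The twisted module condition moves u(h₃k₃l₂), read as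
(h₃k₃)·u(l₂), to the left of f, where g * u₂ = g absorbs it. -/
instance [NormalizedRegular M] : starAux.Holds M :=
  derive [(mulAAssoc, 21), (mulAAssoc, 21), (mulAAssoc, 22), (mulCom.symm, 7), (fg, 29),
    (mulAssoc, 7), (mulAssoc.symm, 13), (mulActOne, 29), (twisted, 5), (coassoc.symm, 0),
    (mulAAssoc.symm, 29), (actMul.symm, 31), (mulActOne.symm, 17), (coassoc.symm, 1),
    (gu.symm, 34)] [] (by decide +kernel)

/-- `act(h1, g(k1, l)) * f(h2, k2)` equals `f(h1, k1 * l1) * g(h2 * k2, l2)`. -/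
def star : Rule :=
  ⟨hw 0 ⊠ hw 1 ⊠ hw 2, [com 0 4 5, com 1 6 7, g 6 2 8, act 4 8 9, f 5 7 10, mulA 9 10 3],
    [com 0 4 5, com 1 6 7, com 2 8 9, mul 6 8 10, f 4 10 11, mul 5 7 12, g 12 9 13, mulA 11 13 3],
    aw 3⟩

/-- In the longer expression of `starAux` the cocycle condition rewrites f(h₂,k₂)f(h₃k₃,l₂) as
(h₂·f(k₂,l₂))f(h₃,k₃l₃). Now g * f = u₂ inside the action, and f absorbs what is left. -/
instance [NormalizedRegular M] : star.Holds M :=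
  derive [(starAux.symm, 0), (mulAAssoc, 21), (mulAAssoc, 21), (mulAAssoc, 22), (coassoc.symm, 5),
    (coassoc.symm, 11), (mulAAssoc.symm, 25), (cocycle.symm, 29), (coassoc, 5), (coassoc, 11),
    (coassoc, 17), (mulAAssoc, 32), (coassoc.symm, 0), (mulAAssoc.symm, 32), (actMul.symm, 37),
    (coassoc.symm, 1), (coassoc.symm, 2), (gf, 39), (coassoc.symm, 1), (coassoc.symm, 2),
    (mulCom.symm, 41), (coassoc.symm, 0), (mulAAssoc.symm, 33), (actUF, 44)] []
    (by decide +kernel)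

/-- `x = S(h4); act(h1, g(x1, h5)) * f(h2, x2), h3 * x3` equals `u(h1), L(h2)`. -/
def regAux : Rule :=
  ⟨hw 0, [com 0 3 4, com 4 5 6, com 6 7 8, com 8 9 10, ant 9 11, com 11 12 13, com 13 14 15,
    g 12 10 16, act 3 16 17, f 5 14 18, mulA 17 18 1, mul 7 15 2], [com 0 3 4, u 3 1, .piL 4 2],
    aw 1 ⊠ hw 2⟩

/-- With k = S(h₄) and l = h₅, `star` makes the products S(h)h and hS(h) appear in the arguments of
f and g. They are Π^R and Π^L, which `comPiR` and `comPiL` turn into legs of Δ(1), and on these f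
and g reduce to u. -/
instance [NormalizedRegular M] : regAux.Holds M :=
  derive [(coassoc.symm, 0), (coassoc.symm, 11), (star, 19), (coassoc, 0), (coassoc, 11),
    (antCom, 9), (coassoc, 8), (antCom, 11), (coassoc, 8), (coassoc.symm, 27), (antId, 30),
    (coassoc.symm, 6), (idAnt, 31), (coassoc.symm, 24), (comPiL, 32), (mulAssoc, 31),
    (coassoc.symm, 24), (idAnt, 34), (coassoc.symm, 0), (comPiL, 35), (comPiR, 27), (fOneCom, 30),
    (mulAssoc, 34), (mulOneCom, 0), (balGR, 36), (oneComMul, 0), (oneComG, 33), (comPiL.symm, 33),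
    (coassoc.symm, 0), (uMulU, 40)] [] (by decide +kernel)

/-! ### The weak convolution inverse of γ. -/

/-- `X = incH(prj(1, h1)); Y = incH(prj(g(ant(h3), h4), ant(h2))); prj(((incA(prj(1, h1)) *
  act(X1, incA(prj(g(ant(h3), h4), ant(h2))))) * f(X2, Y1)), (X3 * Y2))` equals `prj(1, piL(h))`.
  -/
def gamma_conv_gammaInv : Rule :=
  ⟨hw 0, [com 0 2 3, oneA 4, prj 4 2 5, com 3 6 7, ant 6 8, com 7 9 10, ant 9 11, g 11 10 12,
    prj 12 8 13, inc 5 14 15, inc 13 16 17, com 15 18 19, act 18 16 20, mulA 14 20 21,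
    com 19 22 23, com 17 24 25, f 22 24 26, mul 23 25 27, mulA 21 26 28, prj 28 27 1], [.piL 0 2,
    oneA 3, prj 3 2 1], ew 1⟩

instance [NormalizedRegular M] : gamma_conv_gammaInv.Holds M :=
  derive [(mulAAssoc, 14), (mulAAssoc.symm, 20), (prjMulRight, 15), (mulAAssoc, 14),
    (mulAAssoc.symm, 17), (prjMulLeft, 8), (coassoc, 0), (coassoc, 25), (oneMulA, 4),
    (coassoc.symm, 3), (antCom.symm, 27), (regAux, 0), (comPiL, 0)] [(prjUOne.symm, 3),
    (piLCom', 0), (mulActOne, 6), (uPiL, 0), (mulActOne.symm, 0)] (by decide +kernel)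

/-- `X = incH(prj(g(ant(h2), h3), ant(h1))); Y = incH(prj(1, h4)); prj(((incA(prj(g(ant(h2), h3),
  ant(h1))) * act(X1, incA(prj(1, h4)))) * f(X2, Y1)), (X3 * Y2))` equals `prj(1, piR(h))`. -/
def gammaInv_conv_gamma : Rule :=
  ⟨hw 0, [com 0 2 3, com 2 4 5, ant 4 6, com 5 7 8, ant 7 9, g 9 8 10, prj 10 6 11, oneA 12,
    prj 12 3 13, inc 11 14 15, inc 13 16 17, com 15 18 19, act 18 16 20, mulA 14 20 21,
    com 19 22 23, com 17 24 25, f 22 24 26, mul 23 25 27, mulA 21 26 28, prj 28 27 1], [.piR 0 2,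
    oneA 3, prj 3 2 1], ew 1⟩

/-- Since S reverses Δ, the factors g and f combine to (g * f)(S(h₂),h₃) = u(S(h₂)h₃), beside
S(h₁)h₄. By `antAntMul` these are the legs of Δ(Π^R(h)), and p absorbs u. -/
instance [NormalizedRegular M] : gammaInv_conv_gamma.Holds M :=
  derive [(coassoc, 0), (coassoc, 29), (mulAAssoc, 14), (mulAAssoc.symm, 20), (prjMulRight, 15),
    (mulAAssoc, 14), (uDef.symm, 12), (coassoc.symm, 15), (uF, 31), (prjInc, 10), (mulAAssoc, 10),
    (uDef.symm, 32), (coassoc.symm, 6), (uF, 35), (antCom, 4), (coassoc, 0), (coassoc.symm, 37),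
    (antCom.symm, 38), (coassoc.symm, 30), (gf, 36), (antAntMul, 0), (prjUOne, 6)] []
    (by decide +kernel)

/-- `X = incH(prj(1, h1)); Y = incH(prj(1, piR(h2))); prj(((incA(prj(1, h1)) * act(X1, incA(prj(1,
  piR(h2))))) * f(X2, Y1)), (X3 * Y2))` equals `prj(1, h)`. -/
def gamma_conv_piR_gamma : Rule :=
  ⟨hw 0, [com 0 2 3, oneA 4, prj 4 2 5, .piR 3 6, oneA 7, prj 7 6 8, inc 5 9 10, inc 8 11 12,
    com 10 13 14, act 13 11 15, mulA 9 15 16, com 14 17 18, com 12 19 20, f 17 19 21,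
    mul 18 20 22, mulA 16 21 23, prj 23 22 1], [oneA 2, prj 2 0 1], ew 1⟩

/-- Because Δ(Π^R(h)) = 1₁ ⊗ 1₂Π^R(h), the cocycle sees only a unit leg and becomes u; then
h₁Π^R(h₂) = h. -/
instance [CrossedProduct M] : gamma_conv_piR_gamma.Holds M :=
  derive [(mulAAssoc, 9), (mulAAssoc.symm, 15), (prjMulRight, 10), (mulAAssoc, 9),
    (mulAAssoc.symm, 12), (prjMulLeft, 6), (coassoc, 0), (coassoc, 20), (oneMulA, 4),
    (uDef.symm, 7), (coassoc.symm, 0), (uF, 22), (piRCom', 3), (coassoc.symm, 0),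
    (mulAssoc.symm, 23), (mulOneComF, 25), (coassoc, 0), (mulPiR, 26), (prjUOne, 0)] []
    (by decide +kernel)

/-! ### Normalization of the inverse of f, and idempotence of ∇. -/

/-- `(f(h1, k1) * ((u((h2 * k2)) * g(h3, k3)) * u((h4 * k4))))` equals `u((h * k))`. -/
def f_conv_norm : Rule :=
  ⟨hw 0 ⊠ hw 1, [com 0 3 4, com 1 5 6, f 3 5 7, com 4 8 9, com 6 10 11, com 8 12 13, com 10 14 15,
    mul 12 14 16, u 16 17, g 13 15 18, mulA 17 18 19, mul 9 11 20, u 20 21, mulA 19 21 22,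
    mulA 7 22 2], [mul 0 1 3, u 3 2], aw 2⟩

instance [Regular M] : f_conv_norm.Holds M :=
  derive [(coassoc, 4), (coassoc, 6), (mulAAssoc, 17), (coassoc.symm, 0), (coassoc.symm, 1),
    (mulAAssoc.symm, 17), (mulUF, 25), (coassoc.symm, 0), (coassoc.symm, 1), (mulAAssoc.symm, 18),
    (fg, 27), (mulCom.symm, 0), (uMulU, 29)] [] (by decide +kernel)

/-- `(((u((h1 * k1)) * g(h2, k2)) * u((h3 * k3))) * f(h4, k4))` equals `u((h * k))`. -/
def norm_conv_f : Rule :=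
  ⟨hw 0 ⊠ hw 1, [com 0 3 4, com 1 5 6, com 3 7 8, com 5 9 10, com 7 11 12, com 9 13 14,
    mul 11 13 15, u 15 16, g 12 14 17, mulA 16 17 18, mul 8 10 19, u 19 20, mulA 18 20 21,
    f 4 6 22, mulA 21 22 2], [mul 0 1 3, u 3 2], aw 2⟩

instance [Regular M] : norm_conv_f.Holds M :=
  derive [(coassoc, 0), (coassoc, 0), (coassoc, 1), (coassoc, 1), (mulAAssoc, 16),
    (mulAAssoc, 16), (mulAAssoc, 17), (uMulF, 23), (gf, 24), (mulCom.symm, 0), (uMulU, 27)] []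
    (by decide +kernel)

/-- `((u((h1 * k1)) * g(h2, k2)) * u((h3 * k3)))` equals `(((u((h1 * k1)) * g(h2, k2)) * u((h3 *
  k3))) * u((h4 * k4)))`. -/
def norm_conv_u : Rule :=
  ⟨hw 0 ⊠ hw 1, [com 0 3 4, com 1 5 6, com 3 7 8, com 5 9 10, mul 7 9 11, u 11 12, g 8 10 13,
    mulA 12 13 14, mul 4 6 15, u 15 16, mulA 14 16 2], [com 0 3 4, com 1 5 6, com 3 7 8,
    com 5 9 10, com 7 11 12, com 9 13 14, mul 11 13 15, u 15 16, g 12 14 17, mulA 16 17 18,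
    mul 8 10 19, u 19 20, mulA 18 20 21, mul 4 6 22, u 22 23, mulA 21 23 2], aw 2⟩

instance [Regular M] : norm_conv_u.Holds M :=
  derive [(coassoc, 0), (coassoc, 1), (mulAAssoc, 12)] [(coassoc, 0), (coassoc, 0), (coassoc, 1),
    (coassoc, 1), (mulAAssoc, 16), (mulAAssoc, 16), (mulAAssoc, 17), (mulCom.symm, 24),
    (uMulU, 28)] (by decide +kernel)

/-- `((u((h1 * k1)) * g(h2, k2)) * u((h3 * k3)))` equals `(u((h1 * k1)) * ((u((h2 * k2)) * g(h3,
  k3)) * u((h4 * k4))))`. -/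
def u_conv_norm : Rule :=
  ⟨hw 0 ⊠ hw 1, [com 0 3 4, com 1 5 6, com 3 7 8, com 5 9 10, mul 7 9 11, u 11 12, g 8 10 13,
    mulA 12 13 14, mul 4 6 15, u 15 16, mulA 14 16 2], [com 0 3 4, com 1 5 6, mul 3 5 7, u 7 8,
    com 4 9 10, com 6 11 12, com 9 13 14, com 11 15 16, mul 13 15 17, u 17 18, g 14 16 19,
    mulA 18 19 20, mul 10 12 21, u 21 22, mulA 20 22 23, mulA 8 23 2], aw 2⟩

instance [Regular M] : u_conv_norm.Holds M :=
  derive [(coassoc, 0), (coassoc, 1), (mulAAssoc, 12)] [(coassoc, 4), (coassoc, 6),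
    (mulAAssoc, 18), (coassoc.symm, 0), (coassoc.symm, 1), (mulCom.symm, 26),
    (mulAAssoc.symm, 18), (uMulU, 28)] (by decide +kernel)

/-- `((a * act(h1, 1)) * act(h2, 1)), h3` equals `(a * act(h1, 1)), h2`. -/
def nabla_nabla : Rule :=
  ⟨aw 0 ⊠ hw 1, [oneA 4, com 1 5 6, act 5 4 7, mulA 0 7 8, oneA 9, com 6 10 3, act 10 9 11,
    mulA 8 11 2], [oneA 4, com 1 5 3, act 5 4 6, mulA 0 6 2], aw 2 ⊠ hw 3⟩

instance [WeakAction M] : nabla_nabla.Holds M :=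
  derive [(mulAAssoc, 0), (coassoc.symm, 1), (actMul.symm, 12), (oneMulA, 4)] []
    (by decide +kernel)

end Rule

end WeakCleft

namespace WeakCleft

open Tr

variable {C : Type u} [Category.{v} C] [MonoidalCategory C] [SymmetricCategory C]
variable {H A E : C} [WeakHopfObj H] [MonObj A]
variable {act : H ⊗ A ⟶ A} {f g : H ⊗ H ⟶ A}

/-! ### The structure maps of a crossed product as programs -/

namespace Seg

variable {P : List Instr} {s : NablaSplitting act E}

local notation "𝓜" => interp act f g s.i s.r

instance (a x x₁ x₂ y₁ c c' y x₃ x₄ y₂ z w k l e d e' : ℕ) : Seg 𝓜 (ew e ⊠ ew d)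
    (.inc e a x :: .inc d c y :: .com x x₁ x₂ :: .act x₁ c c' :: .mulA a c' k :: .com x₂ x₃ x₄ ::
      .com y y₁ y₂ :: .f x₃ y₁ z :: .mul x₄ y₂ w :: .mulA k z l :: .prj l w e' :: P) P (ew e')
    (s.mul f) := by
  unfold NablaSplitting.mul
  infer_instance

instance (x y y₁ y₂ z w v e : ℕ) : Seg 𝓜 .one
    (.oneA x :: .one y :: .oneA z :: .com y y₁ y₂ :: .act y₁ z w :: .mulA x w v ::
      .prj v y₂ e :: P) P (ew e) s.one := by
  unfold NablaSplitting.one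
  infer_instance

instance (e a x x₁ x₂ e' : ℕ) : Seg 𝓜 (ew e) (.inc e a x :: .com x x₁ x₂ :: .prj a x₁ e' :: P) P
    (ew e' ⊠ hw x₂) s.coact := by
  unfold NablaSplitting.coact
  infer_instance

instance (x y y₁ y₂ z w v a b e : ℕ) : Seg 𝓜 (aw a)
    (.oneA x :: .one y :: .oneA z :: .com y y₁ y₂ :: .act y₁ z w :: .mulA x w v ::
      .mulA a v b :: .prj b y₂ e :: P) P (ew e) s.j := by
  unfold NablaSplitting.j
  infer_instance

instance (x a e : ℕ) : Seg 𝓜 (hw x) (.oneA a :: .prj a x e :: P) P (ew e) s.gamma := by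
  unfold NablaSplitting.gamma
  infer_instance

end Seg

/-! ### The crossed product is a cleft extension -/

lemma nabla_nabla (hact : IsWeakAction act) : nabla act ≫ nabla act = nabla act := by
  -- Idempotence involves only the action; the remaining entries are placeholders of the right type.
  have : Rule.WeakAction (interp act (u₂ act) (u₂ act) (𝟙 (A ⊗ H)) (𝟙 _)) :=
    interp_weakAction hact
  exact Seg.eq_of_holds (inferInstance : Rule.nabla_nabla.Holds
    (interp act (u₂ act) (u₂ act) (𝟙 (A ⊗ H)) (𝟙 _))) (by decide +kernel)

/-- The programs of a crossed product, with its structure maps. -/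
abbrev NablaSplitting.interp (s : NablaSplitting act E) (f g : H ⊗ H ⟶ A) :
    Interp C :=
  WeakCleft.interp act f g s.i s.r

section CrossedProduct

variable (hact : IsWeakAction act) (hf : IsCrossedProductDatum act f) (s : NablaSplitting act E)
include hact hf

lemma NablaSplitting.interp_crossedProduct : Rule.CrossedProduct (s.interp f g) :=
  WeakCleft.interp_crossedProduct hact hf s.retract s.r_i

lemma NablaSplitting.mul_assoc :
    s.mul f ▷ E ≫ s.mul f = (α_ E E E).hom ≫ E ◁ s.mul f ≫ s.mul f := by
  have := s.interp_crossedProduct (g := (u₂ act)) hact hf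
  exact Seg.eq_of_holds (inferInstance : Rule.mulE_assoc.Holds (s.interp f (u₂ act)))
    (by decide +kernel)

lemma NablaSplitting.one_mul :
    s.one ▷ E ≫ s.mul f = (λ_ E).hom := by
  have := s.interp_crossedProduct (g := (u₂ act)) hact hf
  rw [← Category.comp_id (λ_ E).hom]
  exact Seg.eq_of_holds (inferInstance : Rule.oneE_mulE.Holds (s.interp f (u₂ act)))
    (by decide +kernel)

lemma NablaSplitting.mul_one :
    E ◁ s.one ≫ s.mul f = (ρ_ E).hom := by
  have := s.interp_crossedProduct (g := (u₂ act)) hact hf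
  rw [← Category.comp_id (ρ_ E).hom]
  exact Seg.eq_of_holds (inferInstance : Rule.mulE_oneE.Holds (s.interp f (u₂ act)))
    (by decide +kernel)

lemma NablaSplitting.coact_coact :
    s.coact ≫ s.coact ▷ H ≫ (α_ E H H).hom = s.coact ≫ E ◁ Δ[H] := by
  have := s.interp_crossedProduct (g := (u₂ act)) hact hf
  exact Seg.eq_of_holds (inferInstance : Rule.coact_coact.Holds (s.interp f (u₂ act)))
    (by decide +kernel)

lemma NablaSplitting.coact_counit :
    s.coact ≫ E ◁ ε[H] = (ρ_ E).inv := by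
  have := s.interp_crossedProduct (g := (u₂ act)) hact hf
  rw [← Category.id_comp (ρ_ E).inv]
  exact Seg.eq_of_holds (inferInstance : Rule.coact_eps.Holds (s.interp f (u₂ act)))
    (by decide +kernel)

lemma NablaSplitting.mul_coact :
    s.mul f ≫ s.coact = (s.coact ⊗ₘ s.coact) ≫ tensorμ E H E H ≫ (s.mul f ⊗ₘ μ[H]) := by
  have := s.interp_crossedProduct (g := (u₂ act)) hact hf
  exact Seg.eq_of_holds (inferInstance : Rule.mulE_coact.Holds (s.interp f (u₂ act)))
    (by decide +kernel)

lemma NablaSplitting.one_coact :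
    s.one ≫ s.coact ≫ E ◁ Δ[H] =
      (λ_ (𝟙_ C)).inv ≫ (s.one ⊗ₘ η[H]) ≫ (s.coact ⊗ₘ Δ[H]) ≫ (α_ (E ⊗ H) H H).inv ≫
        (α_ E H H).hom ▷ H ≫ (E ◁ μ[H]) ▷ H ≫ (α_ E H H).hom := by
  have := s.interp_crossedProduct (g := (u₂ act)) hact hf
  exact Seg.eq_of_holds (inferInstance : Rule.oneE_coact.Holds (s.interp f (u₂ act)))
    (by decide +kernel)

lemma NablaSplitting.one_j :
    η[A] ≫ s.j = s.one := by
  have := s.interp_crossedProduct (g := (u₂ act)) hact hf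
  exact Seg.eq_of_holds (inferInstance : Rule.oneA_incl.Holds (s.interp f (u₂ act)))
    (by decide +kernel)

lemma NablaSplitting.mul_j :
    μ[A] ≫ s.j = (s.j ⊗ₘ s.j) ≫ s.mul f := by
  have := s.interp_crossedProduct (g := (u₂ act)) hact hf
  exact Seg.eq_of_holds (inferInstance : Rule.mulA_incl.Holds (s.interp f (u₂ act)))
    (by decide +kernel)

lemma NablaSplitting.j_fiber :
    s.j ≫ s.i ≫ A ◁ ε[H] ≫ (ρ_ A).hom = 𝟙 A := by
  have := s.interp_crossedProduct (g := (u₂ act)) hact hf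
  exact Seg.eq_of_holds (inferInstance : Rule.incl_inc_eps.Holds (s.interp f (u₂ act)))
    (by decide +kernel)

lemma NablaSplitting.j_coact :
    s.j ≫ s.coact = s.j ≫ s.coact ≫ E ◁ piL H := by
  have := s.interp_crossedProduct (g := (u₂ act)) hact hf
  exact Seg.eq_of_holds (inferInstance : Rule.incl_coact.Holds (s.interp f (u₂ act)))
    (by decide +kernel)

lemma NablaSplitting.coact_retract :
    s.coact ≫ (s.i ≫ A ◁ ε[H] ≫ (ρ_ A).hom) ▷ H ≫ s.r = 𝟙 E := by
  have := s.interp_crossedProduct (g := (u₂ act)) hact hf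
  exact Seg.eq_of_holds (inferInstance : Rule.coact_retract.Holds (s.interp f (u₂ act)))
    (by decide +kernel)

lemma NablaSplitting.coact_piL_retract :
    s.coact ≫ E ◁ piL H ≫ (s.i ≫ A ◁ ε[H] ≫ (ρ_ A).hom) ▷ H ≫ s.r =
      (s.i ≫ A ◁ ε[H] ≫ (ρ_ A).hom) ≫ s.j := by
  have := s.interp_crossedProduct (g := (u₂ act)) hact hf
  exact Seg.eq_of_holds (inferInstance : Rule.coact_piL_retract.Holds (s.interp f (u₂ act)))
    (by decide +kernel)

lemma NablaSplitting.gamma_coact :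
    s.gamma ≫ s.coact = Δ[H] ≫ s.gamma ▷ H := by
  have := s.interp_crossedProduct (g := (u₂ act)) hact hf
  exact Seg.eq_of_holds (inferInstance : Rule.gamma_coact.Holds (s.interp f (u₂ act)))
    (by decide +kernel)

lemma NablaSplitting.one_gamma :
    η[H] ≫ s.gamma = s.one := by
  have := s.interp_crossedProduct (g := (u₂ act)) hact hf
  exact Seg.eq_of_holds (inferInstance : Rule.one_gamma.Holds (s.interp f (u₂ act)))
    (by decide +kernel)

lemma NablaSplitting.piL_gamma :
    piL H ≫ s.gamma = u₁ act ≫ s.j := by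
  have := s.interp_crossedProduct (g := (u₂ act)) hact hf
  exact Seg.eq_of_holds (inferInstance : Rule.piL_gamma.Holds (s.interp f (u₂ act)))
    (by decide +kernel)

lemma NablaSplitting.gamma_conv_piR_gamma :
    Δ[H] ≫ (s.gamma ⊗ₘ piR H ≫ s.gamma) ≫ s.mul f = s.gamma := by
  have := s.interp_crossedProduct (g := (u₂ act)) hact hf
  exact Seg.eq_of_holds (inferInstance : Rule.gamma_conv_piR_gamma.Holds (s.interp f (u₂ act)))
    (by decide +kernel)

end CrossedProduct

end WeakCleft

namespace WeakCleft

variable {C : Type u} [Category.{v} C] [MonoidalCategory C]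

/-! ### Convolution -/

lemma conv_assoc {X B : C} [ComonObj X] [MonObj B] (a b c : X ⟶ B) :
    conv Δ[X] (conv Δ[X] a b) c = conv Δ[X] a (conv Δ[X] b c) := by
  have h₁ : (Δ[X] ≫ (a ⊗ₘ b) ≫ μ[B]) ⊗ₘ c = Δ[X] ▷ X ≫ ((a ⊗ₘ b) ⊗ₘ c) ≫ μ[B] ▷ B := by
    simp only [← tensorHom_id, tensorHom_comp_tensorHom, Category.comp_id, Category.id_comp]
  have h₂ : a ⊗ₘ (Δ[X] ≫ (b ⊗ₘ c) ≫ μ[B]) = X ◁ Δ[X] ≫ (a ⊗ₘ (b ⊗ₘ c)) ≫ B ◁ μ[B] := by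
    simp only [← id_tensorHom, tensorHom_comp_tensorHom, Category.comp_id, Category.id_comp]
  simp only [conv, h₁, h₂, Category.assoc]
  rw [MonObj.mul_assoc, associator_naturality_assoc, ← ComonObj.comul_assoc_assoc]

variable [SymmetricCategory C]

/-- The third hypothesis makes kΠ^R idempotent for convolution, so (kΠ^R) * k' still satisfies the
first two equations and also the normalization. -/
lemma IsConvInvertible.of_weak {H B : C} [WeakBialgebraObj H] [MonObj B] {k k' : H ⟶ B}
    (h₁ : conv Δ[H] k' k = piR H ≫ k) (h₂ : conv Δ[H] k k' = piL H ≫ k)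
    (h₃ : conv Δ[H] k (piR H ≫ k) = k) : IsConvInvertible k := by
  have h₄ : conv Δ[H] (piR H ≫ k) (piR H ≫ k) = piR H ≫ k := by
    rw [← h₁, conv_assoc, h₁, h₃, h₁]
  refine ⟨conv Δ[H] (piR H ≫ k) k', ?_, ?_, ?_⟩
  · rw [conv_assoc, h₁, h₄]
  · rw [← conv_assoc, h₃, h₂]
  · rw [← conv_assoc, h₄]

/-! ### The crossed product is a cleft extension -/

variable {H A E : C} [WeakHopfObj H] [MonObj A]
variable {act : H ⊗ A ⟶ A} {f g : H ⊗ H ⟶ A}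

lemma exists_nablaSplitting [IsIdempotentComplete C] (hact : IsWeakAction act) :
    ∃ E : C, Nonempty (NablaSplitting act E) := by
  obtain ⟨E, i, r, h₁, h₂⟩ :=
    IsIdempotentComplete.idempotents_split _ _ (nabla_nabla hact)
  exact ⟨E, ⟨{ i := i, r := r, retract := h₁, r_i := h₂ }⟩⟩

section

variable (hact : IsWeakAction act) (hf : IsCrossedProductDatum act f) (s : NablaSplitting act E)
include hact hf

lemma IsRegular.exists_normalized (hreg : IsRegular act f) (s : NablaSplitting act E) :
    ∃ g, Rule.NormalizedRegular (s.interp f g) := by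
  obtain ⟨-, g, h₁, h₂⟩ := hreg
  have : Rule.Regular (s.interp f g) :=
    interp_regular hact hf s.retract s.r_i h₁ h₂
  have h₃ : conv (comul₂ H) f (conv (comul₂ H) (conv (comul₂ H) (u₂ act) g) (u₂ act)) = u₂ act :=
    Seg.eq_of_holds (inferInstance : Rule.f_conv_norm.Holds (s.interp f g)) (by decide +kernel)
  have h₄ : conv (comul₂ H) (conv (comul₂ H) (conv (comul₂ H) (u₂ act) g) (u₂ act)) f = u₂ act :=
    Seg.eq_of_holds (inferInstance : Rule.norm_conv_f.Holds (s.interp f g)) (by decide +kernel)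
  have h₅ : conv (comul₂ H) (conv (comul₂ H) (u₂ act) g) (u₂ act) =
      conv (comul₂ H) (conv (comul₂ H) (conv (comul₂ H) (u₂ act) g) (u₂ act)) (u₂ act) :=
    Seg.eq_of_holds (inferInstance : Rule.norm_conv_u.Holds (s.interp f g)) (by decide +kernel)
  have h₆ : conv (comul₂ H) (conv (comul₂ H) (u₂ act) g) (u₂ act) =
      conv (comul₂ H) (u₂ act) (conv (comul₂ H) (conv (comul₂ H) (u₂ act) g) (u₂ act)) :=
    Seg.eq_of_holds (inferInstance : Rule.u_conv_norm.Holds (s.interp f g)) (by decide +kernel)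
  -- The normalized inverse is made a single map, so that it can be the operation `g` of a new
  -- interpretation.
  generalize conv (comul₂ H) (conv (comul₂ H) (u₂ act) g) (u₂ act) = g' at h₃ h₄ h₅ h₆
  exact ⟨g', { interp_regular hact hf s.retract s.r_i h₃ h₄ with
    gu := Seg.holds h₅
    ug := Seg.holds h₆ }⟩

/-- The algebra structure of a crossed product. -/
abbrev NablaSplitting.monObj : MonObj E where
  mul := s.mul f
  one := s.one
  mul_assoc := s.mul_assoc hact hf
  one_mul := s.one_mul hact hf
  mul_one := s.mul_one hact hf

end

/-- A weak convolution inverse of `γ`, that is `h ↦ p(g(S(h₂), h₃) ⊗ S(h₁))`. -/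
def NablaSplitting.gammaInv (s : NablaSplitting act E) (g : H ⊗ H ⟶ A) : H ⟶ E :=
  Δ[H] ≫ WeakHopfObj.antipode ▷ H ≫ H ◁ (Δ[H] ≫ WeakHopfObj.antipode ▷ H ≫ g) ≫ (β_ H A).hom ≫ s.r

instance {s : NablaSplitting act E} {P : List Instr} (h h₁ h₂ x h₃ h₄ y z e : ℕ) :
    Seg (s.interp f g) (hw h) (.com h h₁ h₂ :: .ant h₁ x :: .com h₂ h₃ h₄ :: .ant h₃ y ::
      .g y h₄ z :: .prj z x e :: P) P (ew e) (s.gammaInv g) := by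
  unfold NablaSplitting.gammaInv
  infer_instance

lemma NablaSplitting.gammaInv_conv_gamma (s : NablaSplitting act E)
    [Rule.NormalizedRegular (s.interp f g)] :
    Δ[H] ≫ (s.gammaInv g ⊗ₘ s.gamma) ≫ s.mul f = piR H ≫ s.gamma :=
  Seg.eq_of_holds (inferInstance : Rule.gammaInv_conv_gamma.Holds (s.interp f g))
    (by decide +kernel)

lemma NablaSplitting.gamma_conv_gammaInv (s : NablaSplitting act E)
    [Rule.NormalizedRegular (s.interp f g)] :
    Δ[H] ≫ (s.gamma ⊗ₘ s.gammaInv g) ≫ s.mul f = piL H ≫ s.gamma :=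
  Seg.eq_of_holds (inferInstance : Rule.gamma_conv_gammaInv.Holds (s.interp f g))
    (by decide +kernel)

section

variable (hact : IsWeakAction act) (hf : IsCrossedProductDatum act f) (s : NablaSplitting act E)
include hact hf

lemma NablaSplitting.isExtension :
    letI := s.monObj hact hf
    IsExtension s.coact s.j := by
  let _ := s.monObj hact hf
  have hj := s.j_fiber hact hf
  refine ⟨⟨s.coact_coact hact hf, s.coact_counit hact hf, s.mul_coact hact hf,
    s.one_coact hact hf⟩, ⟨s.one_j hact hf, s.mul_j hact hf⟩, ⟨fun a b h => ?_⟩,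
    s.j_coact hact hf, ⟨Limits.Fork.IsLimit.mk _ (fun t => t.ι ≫ s.i ≫ A ◁ ε[H] ≫ (ρ_ A).hom)
      (fun t => ?_) fun t m hm => ?_⟩⟩
  · simpa [hj] using h =≫ (s.i ≫ A ◁ ε[H] ≫ (ρ_ A).hom)
  -- Composing with p(q ⊗ H), where q = (A ⊗ ε)ι, turns the two sides of the fork condition into t
  -- and tqj.
  · have := t.condition =≫ ((s.i ≫ A ◁ ε[H] ≫ (ρ_ A).hom) ▷ H ≫ s.r)
    simp only [Category.assoc] at this
    rw [s.coact_retract hact hf, s.coact_piL_retract hact hf, Category.comp_id] at this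
    simpa using this.symm
  · rw [← hm]
    simp [hj]

lemma NablaSplitting.isCleavingMap (hreg : IsRegular act f) :
    letI := s.monObj hact hf
    IsCleavingMap s.coact s.j s.gamma := by
  let _ := s.monObj hact hf
  obtain ⟨g, hg⟩ := hreg.exists_normalized hact hf s
  exact ⟨⟨s.gamma_coact hact hf, s.one_gamma hact hf⟩,
    .of_weak (s.gammaInv_conv_gamma (g := g)) s.gamma_conv_gammaInv
      (s.gamma_conv_piR_gamma hact hf),
    u₁ act, s.piL_gamma hact hf⟩

end

end WeakCleft

theorem mainTheorem2 {C : Type u} [Category.{v} C] [MonoidalCategory C] [SymmetricCategory C]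
    [IsIdempotentComplete C] (H A : C) [WeakCleft.WeakHopfObj H] [MonObj A]
    (act : H ⊗ A ⟶ A) (hact : WeakCleft.IsWeakAction act)
    (f : H ⊗ H ⟶ A) (hf : WeakCleft.IsCrossedProductDatum act f)
    (hreg : WeakCleft.IsRegular act f) :
    (∃ E : C, Nonempty (WeakCleft.NablaSplitting act E)) ∧
      ∀ (E : C) (s : WeakCleft.NablaSplitting act E),
        ∃ monE : MonObj E, monE.mul = s.mul f ∧ monE.one = s.one ∧
          WeakCleft.IsCleftExtension s.coact s.j ∧
          WeakCleft.IsCleavingMap s.coact s.j s.gamma :=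
  ⟨WeakCleft.exists_nablaSplitting hact, fun _ s => ⟨s.monObj hact hf, rfl, rfl,
    ⟨s.isExtension hact hf, _, s.isCleavingMap hact hf hreg⟩, s.isCleavingMap hact hf hreg⟩⟩
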